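/- Let $B:\mathbb{R}^2\to\mathbb{R}$ satisfy $B\in L^p_{\rm loc}(\mathbb{R}^2)$ for some $p>2$ and $|B(x)|=\mathcal{O}(|x|^{-\tau})$ as $|x|\to\infty$ for some $\tau>2$. Let $$\alpha=\frac1{2\pi}\int_{\mathbb{R}^2}B\,dx,\qquad h(x)=-\frac1{2\pi}\int_{\mathbb{R}^2}B(y)\log|x-y|\,dy,\qquad \mu_\alpha=\min_{m\in\mathbb{Z}}|m-\alpha| .$$ For $\rho>0$ let $g_+(\rho;r)=1$ if $r\le\rho$ and $g_+(\rho;r)=\rho^{-\alpha}r^{\alpha}$ if $r>\rho$, let $g_-=1/g_+$, and put $$k_\pm(\rho)=\inf_{x\in\mathbb{R}^2}\frac{e^{\mp h(x)}}{g_\pm(\rho;|x|)},\qquad K_\pm(\rho)=\sup_{x\in\mathbb{R}^2}\frac{e^{\mp h(x)}}{g_\pm(\rho;|x|)},\qquad \beta_\pm(B;\rho)=\Big(\frac{k_\pm(\rho)}{K_\pm(\rho)}\Big)^2,$$ $$\mathrm{w}_\pm(\rho;x)=\beta_\pm(B;\rho)\begin{cases}\dfrac{\mu_\alpha^2}{\rho^2+|x|^2}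 & \text{if }\alpha\notin\mathbb{Z},\\[2ex] \dfrac{|\alpha|}{4|\alpha|+\pi}\,\dfrac{1}{\rho^2+|x|^2\big(1+\log^2(|x|/\rho)\big)} & \text{if }\alpha\in\mathbb{Z}.\end{cases}$$ Let $A\in L^2_{\rm loc}(\mathbb{R}^2;\mathbb{R}^2)$ be a vector potential of $B$, i.e. $\partial_1A_2-\partial_2A_1=B$ in the sense of distributions. If $\alpha\neq0$, then, with $\sigma=\operatorname{sign}\alpha$, $$\int_{\mathbb{R}^2}|(i\nabla+A)u|^2\,dx\;\ge\;\frac12\int_{\mathbb{R}^2}\mathrm{w}_\sigma(\rho;x)\,|u|^2\,dx$$ for all complex-valued $u\in H^1(\mathbb{R}^2)$ and all $\rho>0$, where both sides are understood as integrals of non-negative functions with values in $[0,\infty]$. -/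

import Mathlib

open MeasureTheory Filter
open scoped ENNReal ContDiff

noncomputable section

namespace MagneticHardy

/-- The Euclidean plane. -/
abbrev Plane : Type := EuclideanSpace ℝ (Fin 2)

/-- The partial derivative `∂ⱼ f`. -/
def partialDeriv {F : Type*} [NormedAddCommGroup F] [NormedSpace ℝ F]
    (j : Fin 2) (f : Plane → F) (x : Plane) : F :=
  fderiv ℝ f x (EuclideanSpace.single j 1)

/-- `φ` is a (real-valued) test function: smooth with compact support. -/
def IsTestFunction (φ : Plane → ℝ) : Prop :=
  ContDiff ℝ ∞ φ ∧ HasCompactSupport φ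

/-- The local Lebesgue space `L^p_loc(ℝ²; F)`. -/
def MemLpLoc {F : Type*} [NormedAddCommGroup F] (f : Plane → F) (p : ℝ≥0∞) : Prop :=
  ∀ K : Set Plane, IsCompact K → MemLp f p (volume.restrict K)

/-- The hypothesis on the magnetic field: `B ∈ L^p_loc` for some `p > 2`, and
`|B(x)| = O(|x|^{-τ})` as `|x| → ∞` for some `τ > 2` (`B` is a class of functions modulo null sets,
so the bound is required almost everywhere). -/
structure IsAdmissibleField (B : Plane → ℝ) : Prop where
  memLpLoc : ∃ p : ℝ≥0∞, 2 < p ∧ MemLpLoc B p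
  decay : ∃ τ : ℝ, 2 < τ ∧ ∃ C R : ℝ, 0 < R ∧
    ∀ᵐ x : Plane, R ≤ ‖x‖ → |B x| ≤ C * ‖x‖ ^ (-τ)

/-- The normalized flux `α = (1 / 2π) ∫ B`. -/
def flux (B : Plane → ℝ) : ℝ := 1 / (2 * Real.pi) * ∫ x, B x

/-- `A` is a vector potential of `B`: `A ∈ L²_loc(ℝ²; ℝ²)` and `∂₁A₂ - ∂₂A₁ = B` in the sense of
distributions. -/
structure IsVectorPotential (A : Plane → Plane) (B : Plane → ℝ) : Prop where
  memLpLoc : MemLpLoc A 2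
  curl_eq : ∀ φ : Plane → ℝ, IsTestFunction φ →
    ∫ x, (A x 0 * partialDeriv 1 φ x - A x 1 * partialDeriv 0 φ x) = ∫ x, B x * φ x

/-- `u ∈ H¹(ℝ²; ℂ)` with weak gradient `G = (G 0, G 1)`. -/
structure IsH1WithGradient (u : Plane → ℂ) (G : Fin 2 → Plane → ℂ) : Prop where
  memLp : MemLp u 2 volume
  memLp_grad : ∀ j, MemLp (G j) 2 volume
  weak_grad : ∀ j, ∀ φ : Plane → ℝ, IsTestFunction φ →
    ∫ x, u x * ((partialDeriv j φ x : ℝ) : ℂ) = - ∫ x, G j x * (φ x : ℂ)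

/-- The magnetic Dirichlet integral `∫ |(i∇ + A)u|² dx ∈ [0, ∞]`, where `G` is the weak gradient
of `u`. -/
def magneticEnergy (A : Plane → Plane) (u : Plane → ℂ) (G : Fin 2 → Plane → ℂ) : ℝ≥0∞ :=
  ∫⁻ x, ENNReal.ofReal (∑ j : Fin 2, ‖Complex.I * G j x + (A x j : ℂ) * u x‖ ^ 2)

/-- The scalar potential `h(x) = -(1 / 2π) ∫ B(y) log|x - y| dy`. -/
def scalarPotential (B : Plane → ℝ) (x : Plane) : ℝ :=
  -(1 / (2 * Real.pi)) * ∫ y, B y * Real.log ‖x - y‖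

/-- `g_±(ρ; r)` for `σ = ±1`: equal to `1` for `r ≤ ρ` and to `(ρ^{-α} r^α)^{±1}` for `r > ρ`. -/
def comparison (B : Plane → ℝ) (σ : SignType) (ρ r : ℝ) : ℝ :=
  if r ≤ ρ then 1 else (ρ ^ (-flux B) * r ^ flux B) ^ (σ : ℤ)

/-- The quotient `e^{∓h(x)} / g_±(ρ; |x|)`. -/
def expRatio (B : Plane → ℝ) (σ : SignType) (ρ : ℝ) (x : Plane) : ℝ :=
  Real.exp (-(σ : ℝ) * scalarPotential B x) / comparison B σ ρ ‖x‖

/-- `k_±(ρ)`, the infimum of the quotient `e^{∓h} / g_±`. -/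
def lowerConst (B : Plane → ℝ) (σ : SignType) (ρ : ℝ) : ℝ := ⨅ x, expRatio B σ ρ x

/-- `K_±(ρ)`, the supremum of the quotient `e^{∓h} / g_±`. -/
def upperConst (B : Plane → ℝ) (σ : SignType) (ρ : ℝ) : ℝ := ⨆ x, expRatio B σ ρ x

/-- `β_±(B; ρ) = (k_±(ρ) / K_±(ρ))²`. -/
def beta (B : Plane → ℝ) (σ : SignType) (ρ : ℝ) : ℝ :=
  (lowerConst B σ ρ / upperConst B σ ρ) ^ 2

/-- The distance `μ_α = min_{m ∈ ℤ} |m - α|` from `α` to the integers. -/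
def distToInt (α : ℝ) : ℝ := ⨅ m : ℤ, |(m : ℝ) - α|

open Classical in
/-- The Hardy weight `w_±(ρ; x)` of the Pauli operator, with the logarithmic version for
integer flux. -/
def hardyWeight (B : Plane → ℝ) (σ : SignType) (ρ : ℝ) (x : Plane) : ℝ :=
  beta B σ ρ *
    if ∃ m : ℤ, (m : ℝ) = flux B then
      |flux B| / (4 * |flux B| + Real.pi) *
        (1 / (ρ ^ 2 + ‖x‖ ^ 2 * (1 + Real.log (‖x‖ / ρ) ^ 2)))
    else
      distToInt (flux B) ^ 2 / (ρ ^ 2 + ‖x‖ ^ 2)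

end MagneticHardy

end

/-!
Let `s = -sign α`. Away from the trivial case `β = 0`, the function `exp (s h)` is comparable with
the radial function `growth |α| ρ`. Since `Δh = -B`, some gauge brings the components of `A` to
derivatives of `h`, and the Pauli factor `u ↦ i(∂₁ + is∂₂)u + (A₁ + isA₂)u` becomes, up to
unimodular factors, `exp (s h) (∂₁ + is∂₂) v` with `|u| = exp (s h) |v|`. Replacing `exp (s h)` by
its radial bounds costs `β` and reduces the claim to a weighted Hardy inequality for `∂₁ + is∂₂`,
which decouples into angular modes. In each mode, completing the square with a solution of a Riccati
differential inequality gives the weight; the mode that nearly cancels `|α|` is the source of `μ_α`,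
or of the logarithm when `α` is an integer. Finally `|p + isq|² ≤ 2 (|p|² + |q|²)` compares the
Pauli factor with the magnetic Dirichlet integral.

This applies to `C¹` functions with compact support after mollifying `A` and `h`. When the
right-hand side is finite, the inequality extends to `H¹` by cutting off in space, truncating values
and mollifying; the truncation is needed because `A` is only locally square integrable.
-/

noncomputable section

open Topology Set
open scoped NNReal

namespace MagneticHardy

/-! ### The radial weight -/

/-- The radial profile `max(1, r/ρ)^a` that the exponential of the scalar potential is compared
with; for `a = |α|` it is `g_σ(ρ; r)`, `σ = sign α`. -/
def growth (a ρ r : ℝ) : ℝ := max 1 (r / ρ) ^ a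

lemma growth_pos (a ρ r : ℝ) : 0 < growth a ρ r :=
  Real.rpow_pos_of_pos (one_pos.trans_le (le_max_left _ _)) a

lemma growth_of_le {a ρ r : ℝ} (hρ : 0 < ρ) (h : r ≤ ρ) : growth a ρ r = 1 := by
  rw [growth, max_eq_left ((div_le_one hρ).2 h), Real.one_rpow]

lemma growth_of_ge {a ρ r : ℝ} (hρ : 0 < ρ) (h : ρ ≤ r) : growth a ρ r = (r / ρ) ^ a := by
  rw [growth, max_eq_right ((one_le_div hρ).2 h)]

lemma continuous_growth (a ρ : ℝ) : Continuous (growth a ρ) :=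
  (continuous_const.max (continuous_id.div_const ρ)).rpow_const fun r =>
    Or.inl (one_pos.trans_le (le_max_left 1 (r / ρ))).ne'

lemma distToInt_le (α : ℝ) (m : ℤ) : distToInt α ≤ |(m : ℝ) - α| :=
  ciInf_le ⟨0, forall_mem_range.2 fun _ => abs_nonneg _⟩ m

lemma distToInt_nonneg (α : ℝ) : 0 ≤ distToInt α := Real.iInf_nonneg fun _ => abs_nonneg _

lemma distToInt_le_one (α : ℝ) : distToInt α ≤ 1 := by
  refine (distToInt_le α ⌊α⌋).trans ?_
  rw [abs_le]
  constructor <;> linarith [Int.floor_le α, Int.lt_floor_add_one α]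

lemma distToInt_le_abs_sub_abs (α : ℝ) (m : ℤ) : distToInt α ≤ abs (m - |α|) := by
  rcases abs_choice α with h | h <;> rw [h]
  · exact distToInt_le α m
  · refine (distToInt_le α (-m)).trans_eq ?_
    rw [← abs_neg]
    push_cast
    ring_nf

open Classical in
/-- The coefficient of the Hardy weight: `μ_α²` for `α ∉ ℤ` and `|α| / (4|α| + π)` for `α ∈ ℤ`. -/
def hardyCoeff (α : ℝ) : ℝ :=
  if ∃ m : ℤ, (m : ℝ) = α then |α| / (4 * |α| + Real.pi) else distToInt α ^ 2

open Classical in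
/-- The Hardy weight of flux `α` at distance `r` from the origin, without the factor `β`. -/
def radialWeight (α ρ r : ℝ) : ℝ :=
  if ∃ m : ℤ, (m : ℝ) = α then
    |α| / (4 * |α| + Real.pi) * (1 / (ρ ^ 2 + r ^ 2 * (1 + Real.log (r / ρ) ^ 2)))
  else distToInt α ^ 2 / (ρ ^ 2 + r ^ 2)

lemma radialWeight_nonneg (α ρ r : ℝ) : 0 ≤ radialWeight α ρ r := by
  have := Real.pi_pos
  unfold radialWeight
  split_ifs <;> positivity

lemma continuous_radialWeight (α : ℝ) {ρ : ℝ} (hρ : 0 < ρ) : Continuous (radialWeight α ρ) := by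
  have : Continuous fun r : ℝ => (r / ρ * Real.log (r / ρ)) ^ 2 :=
    (Real.continuous_mul_log.comp (continuous_id.div_const ρ)).pow 2
  have hden : (fun r : ℝ => ρ ^ 2 + r ^ 2 * (1 + Real.log (r / ρ) ^ 2)) =
      fun r => ρ ^ 2 + r ^ 2 + ρ ^ 2 * (r / ρ * Real.log (r / ρ)) ^ 2 := by
    funext r
    field_simp
    ring
  unfold radialWeight
  split_ifs
  · refine continuous_const.mul (continuous_const.div ?_ fun r => by positivity)
    rw [hden]
    fun_prop
  · exact continuous_const.div (by fun_prop) fun r => by positivity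

lemma hardyCoeff_nonneg (α : ℝ) : 0 ≤ hardyCoeff α := by
  have := Real.pi_pos
  unfold hardyCoeff
  split_ifs <;> positivity

lemma hardyCoeff_le_one (α : ℝ) : hardyCoeff α ≤ 1 := by
  unfold hardyCoeff
  split_ifs
  · exact div_le_one_of_le₀ (by linarith [abs_nonneg α, Real.pi_pos]) (by positivity)
  · exact pow_le_one₀ (distToInt_nonneg α) (distToInt_le_one α)

lemma hardyCoeff_le_abs (α : ℝ) : hardyCoeff α ≤ |α| := by
  unfold hardyCoeff
  split_ifs
  · exact div_le_self (abs_nonneg α) (by linarith [abs_nonneg α, Real.pi_gt_three])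
  · calc distToInt α ^ 2 ≤ distToInt α :=
          pow_le_of_le_one (distToInt_nonneg α) (distToInt_le_one α) two_ne_zero
      _ ≤ |α| := by simpa using distToInt_le α 0

lemma hardyCoeff_le_sub_sq {α : ℝ} {n : ℤ} (hn : (n : ℝ) ≠ |α|) :
    hardyCoeff α ≤ (n - |α|) ^ 2 := by
  by_cases h : ∃ m : ℤ, (m : ℝ) = α
  · refine (hardyCoeff_le_one α).trans ?_
    obtain ⟨m, rfl⟩ := h
    rw [← Int.cast_abs] at hn ⊢
    have hne : n - |m| ≠ 0 := sub_ne_zero.2 fun h => hn (by rw [h])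
    exact_mod_cast (one_le_sq_iff_one_le_abs _).2 (Int.one_le_abs hne)
  · rw [hardyCoeff, if_neg h]
    exact sq_le_sq.2 <|
      (abs_of_nonneg (distToInt_nonneg α)).trans_le (distToInt_le_abs_sub_abs α n)

lemma radialWeight_mul_le (α ρ r : ℝ) :
    radialWeight α ρ r * (ρ ^ 2 + r ^ 2) ≤ hardyCoeff α := by
  have hcoeff := hardyCoeff_nonneg α
  unfold radialWeight hardyCoeff at *
  split_ifs at *
  · rw [mul_assoc, one_div_mul_eq_div]
    refine mul_le_of_le_one_right hcoeff (div_le_one_of_le₀ ?_ (by positivity))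
    nlinarith [sq_nonneg (r * Real.log (r / ρ))]
  · rw [div_mul_eq_mul_div, mul_div_assoc]
    exact mul_le_of_le_one_right hcoeff (div_self_le_one _)

lemma radialWeight_mul_sq_le (α ρ r : ℝ) : radialWeight α ρ r * r ^ 2 ≤ hardyCoeff α :=
  (mul_le_mul_of_nonneg_left (le_add_of_nonneg_left (sq_nonneg ρ))
    (radialWeight_nonneg α ρ r)).trans (radialWeight_mul_le α ρ r)

lemma radialWeight_mul_radius_sq_le (α ρ r : ℝ) : radialWeight α ρ r * ρ ^ 2 ≤ hardyCoeff α :=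
  (mul_le_mul_of_nonneg_left (le_add_of_nonneg_right (sq_nonneg r))
    (radialWeight_nonneg α ρ r)).trans (radialWeight_mul_le α ρ r)

lemma radialWeight_intCast_mul_sq_le {m : ℤ} (hm : m ≠ 0) {ρ r : ℝ} (hρ : 0 < ρ) (hr : ρ ≤ r) :
    radialWeight m ρ r * r ^ 2 ≤
      (1 / (2 * (Real.log (r / ρ) + 1 / (2 * |(m : ℝ)|)))) ^ 2 := by
  rw [radialWeight, if_pos ⟨m, rfl⟩]
  set a : ℝ := |(m : ℝ)| with ha_def
  set t := Real.log (r / ρ)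
  have hr0 : 0 < r := hρ.trans_le hr
  have ha : 1 ≤ a := by
    rw [ha_def, ← Int.cast_abs]
    exact_mod_cast Int.one_le_abs hm
  have ht : 0 ≤ t := Real.log_nonneg ((one_le_div hρ).2 hr)
  have drop_radius : 1 / (ρ ^ 2 + r ^ 2 * (1 + t ^ 2)) * r ^ 2 ≤ 1 / (1 + t ^ 2) := by
    rw [one_div_mul_eq_div, div_le_div_iff₀ (by positivity) (by positivity)]
    nlinarith [sq_nonneg ρ]
  have cauchy_schwarz : (t + 1 / (2 * a)) ^ 2 ≤ (1 + t ^ 2) * (1 + (1 / (2 * a)) ^ 2) := by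
    nlinarith [sq_nonneg (1 - t * (1 / (2 * a)))]
  have coeff_le : a * (4 * (1 + (1 / (2 * a)) ^ 2)) ≤ 4 * a + Real.pi := by
    have hexpand : a * (4 * (1 + (1 / (2 * a)) ^ 2)) = 4 * a + 1 / a := by field_simp; ring
    have hinv : 1 / a ≤ 1 := (div_le_one (by linarith)).2 ha
    linarith [Real.pi_gt_three]
  have key : a * (2 * (t + 1 / (2 * a))) ^ 2 ≤ (4 * a + Real.pi) * (1 + t ^ 2) := by
    calc a * (2 * (t + 1 / (2 * a))) ^ 2 = a * 4 * (t + 1 / (2 * a)) ^ 2 := by ring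
      _ ≤ a * 4 * ((1 + t ^ 2) * (1 + (1 / (2 * a)) ^ 2)) := by gcongr
      _ = a * (4 * (1 + (1 / (2 * a)) ^ 2)) * (1 + t ^ 2) := by ring
      _ ≤ (4 * a + Real.pi) * (1 + t ^ 2) := by gcongr
  have := Real.pi_pos
  calc _ ≤ a / (4 * a + Real.pi) * (1 / (1 + t ^ 2)) := by rw [mul_assoc]; gcongr
    _ = a / ((4 * a + Real.pi) * (1 + t ^ 2)) := by rw [div_mul_div_comm, mul_one]
    _ ≤ 1 / (2 * (t + 1 / (2 * a))) ^ 2 := by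
      rw [div_le_div_iff₀ (by positivity) (by positivity), one_mul]
      exact key
    _ = _ := by rw [div_pow, one_pow]

/-! ### Riccati subsolutions and one-dimensional Hardy inequalities -/

/-- `Q` is a subsolution, on the interval `[x, y]`, of the Riccati equation
`r Q' = 2 n Q - Q² / w - W w r²` of the weighted Hardy inequality for `c ↦ c' + (n / r) c` with
measure `w r dr` and Hardy weight `W`. -/
structure IsRiccatiSubsolution (n : ℝ) (w W Q : ℝ → ℝ) (x y : ℝ) : Prop where
  continuousOn : ContinuousOn Q (Icc x y)
  deriv_le : ∀ r ∈ Ioo x y, ∃ q', HasDerivAt Q q' r ∧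
    r * q' ≤ 2 * n * Q r - Q r ^ 2 / w r - W r * w r * r ^ 2

section Riccati

variable {E : Type*} [NormedAddCommGroup E] [InnerProductSpace ℝ E]

lemma riccati_pointwise {r n q q' w W : ℝ} (hr : 0 < r) (hw : 0 < w)
    (h : r * q' ≤ 2 * n * q - q ^ 2 / w - W * w * r ^ 2) (c d : E) :
    W * w * r * ‖c‖ ^ 2 + (q' * ‖c‖ ^ 2 + q * (2 * inner ℝ c d)) ≤
      w * r * ‖d + (n / r) • c‖ ^ 2 := by
  have expand (t : ℝ) : ‖d + t • c‖ ^ 2 = ‖d‖ ^ 2 + 2 * t * inner ℝ c d + t ^ 2 * ‖c‖ ^ 2 := by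
    rw [norm_add_sq_real, real_inner_smul_right, real_inner_comm, norm_smul, mul_pow,
      Real.norm_eq_abs, sq_abs]
    ring
  have complete_square : w * r * ‖d + (n / r) • c‖ ^ 2 =
      w * r * ‖d + (n / r - q / (w * r)) • c‖ ^ 2 + q * (2 * inner ℝ c d) +
        (2 * n * q - q ^ 2 / w) / r * ‖c‖ ^ 2 := by
    rw [expand, expand]
    field_simp
    ring
  have hq' : W * w * r + q' ≤ (2 * n * q - q ^ 2 / w) / r := by
    rw [le_div_iff₀ hr]
    linarith
  have hsq : 0 ≤ w * r * ‖d + (n / r - q / (w * r)) • c‖ ^ 2 := by positivity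
  linarith [mul_le_mul_of_nonneg_right hq' (sq_nonneg ‖c‖)]

lemma IsRiccatiSubsolution.integral_le {n x y : ℝ} {w W Q : ℝ → ℝ}
    (hQ : IsRiccatiSubsolution n w W Q x y) (hx : 0 ≤ x) (hxy : x ≤ y)
    (hw : ∀ r ∈ Ioo x y, 0 < w r) {c c' : ℝ → E} (hc : ∀ r, HasDerivAt c (c' r) r)
    (hL : IntegrableOn (fun r => W r * w r * r * ‖c r‖ ^ 2) (Icc x y))
    (hR : IntegrableOn (fun r => w r * r * ‖c' r + (n / r) • c r‖ ^ 2) (Icc x y)) :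
    (∫ r in x..y, W r * w r * r * ‖c r‖ ^ 2) + (Q y * ‖c y‖ ^ 2 - Q x * ‖c x‖ ^ 2) ≤
      ∫ r in x..y, w r * r * ‖c' r + (n / r) • c r‖ ^ 2 := by
  choose! q' hq' hle using hQ.deriv_le
  have hcont : Continuous c := continuous_iff_continuousAt.2 fun r => (hc r).continuousAt
  have hbound := intervalIntegral.sub_le_integral_of_hasDeriv_right_of_le hxy
    (g := fun r => Q r * ‖c r‖ ^ 2) (hQ.continuousOn.mul (by fun_prop))
    (fun r hr => ((hq' r hr).mul (hc r).norm_sq).hasDerivWithinAt) (hR.sub hL) fun r hr =>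
      le_sub_iff_add_le'.2 <|
        riccati_pointwise (hx.trans_lt hr.1) (hw r hr) (hle r hr) (c r) (c' r)
  simp only [Pi.sub_apply] at hbound
  rw [intervalIntegral.integral_sub ((intervalIntegrable_iff_integrableOn_Icc_of_le hxy).2 hR)
    ((intervalIntegrable_iff_integrableOn_Icc_of_le hxy).2 hL)] at hbound
  linarith

lemma integral_le_of_isRiccatiSubsolution {n ρ S : ℝ} (hρ : 0 < ρ) (hρS : ρ ≤ S)
    {w W P Q : ℝ → ℝ} (hw : ∀ r, 0 < w r) (hP : IsRiccatiSubsolution n w W P 0 ρ)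
    (hQ : IsRiccatiSubsolution n w W Q ρ S) (hjump : Q ρ ≤ P ρ)
    {c c' : ℝ → E} (hc : ∀ r, HasDerivAt c (c' r) r) (h0 : P 0 * ‖c 0‖ ^ 2 = 0) (hS : c S = 0)
    (hL : IntegrableOn (fun r => W r * w r * r * ‖c r‖ ^ 2) (Icc 0 S))
    (hR : IntegrableOn (fun r => w r * r * ‖c' r + (n / r) • c r‖ ^ 2) (Icc 0 S)) :
    ∫ r in (0 : ℝ)..S, W r * w r * r * ‖c r‖ ^ 2 ≤
      ∫ r in (0 : ℝ)..S, w r * r * ‖c' r + (n / r) • c r‖ ^ 2 := by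
  have split {g : ℝ → ℝ} (hg : IntegrableOn g (Icc 0 S)) :
      ∫ r in (0 : ℝ)..S, g r = (∫ r in (0 : ℝ)..ρ, g r) + ∫ r in ρ..S, g r :=
    (intervalIntegral.integral_add_adjacent_intervals
      ((intervalIntegrable_iff_integrableOn_Icc_of_le hρ.le).2
        (hg.mono_set (Icc_subset_Icc_right hρS)))
      ((intervalIntegrable_iff_integrableOn_Icc_of_le hρS).2
        (hg.mono_set (Icc_subset_Icc_left hρ.le)))).symm
  have inner_le := hP.integral_le le_rfl hρ.le (fun r _ => hw r) hc
    (hL.mono_set (Icc_subset_Icc_right hρS)) (hR.mono_set (Icc_subset_Icc_right hρS))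
  have outer_le := hQ.integral_le hρ.le hρS (fun r _ => hw r) hc
    (hL.mono_set (Icc_subset_Icc_left hρ.le)) (hR.mono_set (Icc_subset_Icc_left hρ.le))
  rw [hS, norm_zero, zero_pow two_ne_zero, mul_zero] at outer_le
  rw [split hL, split hR]
  linarith [mul_le_mul_of_nonneg_right hjump (sq_nonneg ‖c ρ‖)]

lemma lintegral_ofReal_le_of_integral_le {X : Type*} [MeasurableSpace X] {μ : Measure X}
    {f g : X → ℝ} (hf : Integrable f μ) (hf0 : 0 ≤ᵐ[μ] f) (hg : AEStronglyMeasurable g μ)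
    (hg0 : 0 ≤ᵐ[μ] g) (h : Integrable g μ → ∫ x, f x ∂μ ≤ ∫ x, g x ∂μ) :
    ∫⁻ x, ENNReal.ofReal (f x) ∂μ ≤ ∫⁻ x, ENNReal.ofReal (g x) ∂μ := by
  by_cases hgi : Integrable g μ
  · rw [← ofReal_integral_eq_lintegral_ofReal hf hf0, ← ofReal_integral_eq_lintegral_ofReal hgi hg0]
    exact ENNReal.ofReal_le_ofReal (h hgi)
  · have htop : ∫⁻ x, ENNReal.ofReal (g x) ∂μ = ⊤ := by
      by_contra hfin
      exact hgi ⟨hg, (hasFiniteIntegral_iff_ofReal hg0).2 (lt_top_iff_ne_top.2 hfin)⟩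
    exact le_top.trans_eq htop.symm

lemma lintegral_le_of_isRiccatiSubsolution {n ρ S : ℝ} (hρ : 0 < ρ) (hρS : ρ ≤ S)
    {w W P Q : ℝ → ℝ} (hw : Continuous w) (hw0 : ∀ r, 0 < w r) (hW : Continuous W)
    (hW0 : ∀ r, 0 ≤ W r) (hP : IsRiccatiSubsolution n w W P 0 ρ)
    (hQ : IsRiccatiSubsolution n w W Q ρ S) (hjump : Q ρ ≤ P ρ)
    {c c' : ℝ → E} (hc : ∀ r, HasDerivAt c (c' r) r) (hc' : Continuous c')
    (h0 : P 0 * ‖c 0‖ ^ 2 = 0) (hS : ∀ r, S ≤ r → c r = 0) :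
    ∫⁻ r in Ioi 0, ENNReal.ofReal (W r * w r * r * ‖c r‖ ^ 2) ≤
      ∫⁻ r in Ioi 0, ENNReal.ofReal (w r * r * ‖c' r + (n / r) • c r‖ ^ 2) := by
  have hcont : Continuous c := continuous_iff_continuousAt.2 fun r => (hc r).continuousAt
  have hL : Continuous fun r => W r * w r * r * ‖c r‖ ^ 2 := by fun_prop
  have hR : ContinuousOn (fun r => w r * r * ‖c' r + (n / r) • c r‖ ^ 2) (Ioc 0 S) := by
    have : ContinuousOn (fun r : ℝ => n / r) (Ioc 0 S) :=
      continuousOn_const.div continuousOn_id fun r hr => hr.1.ne'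
    fun_prop
  have nonneg {g : ℝ → ℝ} (hg : ∀ r, 0 < r → 0 ≤ g r) : 0 ≤ᵐ[volume.restrict (Ioc 0 S)] g :=
    (ae_restrict_iff' measurableSet_Ioc).2 (ae_of_all _ fun r hr => hg r hr.1)
  have hsupp : ∫⁻ r in Ioi 0, ENNReal.ofReal (W r * w r * r * ‖c r‖ ^ 2) =
      ∫⁻ r in Ioc 0 S, ENNReal.ofReal (W r * w r * r * ‖c r‖ ^ 2) := by
    rw [← Ioc_union_Ioi_eq_Ioi (hρ.le.trans hρS),
      lintegral_union measurableSet_Ioi (Ioc_disjoint_Ioi le_rfl),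
      setLIntegral_eq_zero measurableSet_Ioi fun r hr => ?_, add_zero]
    simp [hS r (mem_Ioi.1 hr).le]
  rw [hsupp]
  refine (lintegral_ofReal_le_of_integral_le (hL.integrableOn_Icc.mono_set Ioc_subset_Icc_self)
    (nonneg fun r hr => ?_) (hR.aestronglyMeasurable measurableSet_Ioc) (nonneg fun r hr => ?_)
    fun hint => ?_).trans (lintegral_mono_set Ioc_subset_Ioi_self)
  · have := hW0 r
    have := (hw0 r).le
    positivity
  · have := (hw0 r).le
    positivity
  · simp only [← intervalIntegral.integral_of_le (hρ.le.trans hρS)]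
    exact integral_le_of_isRiccatiSubsolution hρ hρS hw0 hP hQ hjump hc h0 (hS S le_rfl)
      hL.integrableOn_Icc (integrableOn_Icc_iff_integrableOn_Ioc (by simp) |>.2 hint)

end Riccati

lemma isRiccatiSubsolution_inner_zero (α : ℝ) {ρ : ℝ} (hρ : 0 < ρ) :
    IsRiccatiSubsolution 0 (fun r => growth |α| ρ r ^ 2) (radialWeight α ρ)
      (fun r => -hardyCoeff α * (r / ρ) ^ 2) 0 ρ := by
  refine ⟨by fun_prop, fun r hr => ⟨-hardyCoeff α * (2 * (r / ρ) * (1 / ρ)), ?_, ?_⟩⟩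
  · simpa using (((hasDerivAt_id r).div_const ρ).pow 2).const_mul (-hardyCoeff α)
  set κ := hardyCoeff α
  set x := (r / ρ) ^ 2
  have hx : x ≤ 1 :=
    pow_le_one₀ (div_nonneg hr.1.le hρ.le) ((div_le_one hρ).2 hr.2.le)
  have hκx : κ * x ≤ 1 := mul_le_one₀ (hardyCoeff_le_one α) (sq_nonneg _) hx
  have hκx0 : 0 ≤ κ * x := mul_nonneg (hardyCoeff_nonneg α) (sq_nonneg _)
  have hW : radialWeight α ρ r * r ^ 2 ≤ κ * x := by
    calc radialWeight α ρ r * r ^ 2 = radialWeight α ρ r * ρ ^ 2 * x := by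
          simp only [x]
          field_simp
      _ ≤ κ * x := mul_le_mul_of_nonneg_right (radialWeight_mul_radius_sq_le α ρ r) (sq_nonneg _)
  have hderiv : r * (-κ * (2 * (r / ρ) * (1 / ρ))) = -2 * (κ * x) := by
    simp only [x]
    ring
  rw [growth_of_le hρ hr.2.le, hderiv]
  nlinarith

lemma isRiccatiSubsolution_inner_const (α : ℝ) {ρ : ℝ} (hρ : 0 < ρ) {n : ℤ} (hn : n ≠ 0) :
    IsRiccatiSubsolution n (fun r => growth |α| ρ r ^ 2) (radialWeight α ρ) (fun _ => n) 0 ρ := by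
  refine ⟨continuousOn_const, fun r hr => ⟨0, hasDerivAt_const _ _, ?_⟩⟩
  have hW : radialWeight α ρ r * r ^ 2 ≤ 1 :=
    (radialWeight_mul_sq_le α ρ r).trans (hardyCoeff_le_one α)
  have hn2 : (1 : ℝ) ≤ (n : ℝ) ^ 2 := by
    exact_mod_cast (one_le_sq_iff_one_le_abs n).2 (Int.one_le_abs hn)
  rw [growth_of_le hρ hr.2.le]
  linarith

lemma hasDerivAt_growth_sq (a : ℝ) {ρ r : ℝ} (hρ : 0 < ρ) (hr : ρ < r) :
    HasDerivAt (fun r => growth a ρ r ^ 2) (2 * a / r * growth a ρ r ^ 2) r := by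
  have hr0 : 0 < r := hρ.trans hr
  have hpow : HasDerivAt (fun r => (r / ρ) ^ a) (a / r * (r / ρ) ^ a) r := by
    convert ((hasDerivAt_id' r).div_const ρ).rpow_const (p := a) (Or.inl (div_pos hr0 hρ).ne')
      using 1
    rw [Real.rpow_sub_one (div_pos hr0 hρ).ne']
    field_simp
  have heq : growth a ρ =ᶠ[𝓝 r] fun r => (r / ρ) ^ a := by
    filter_upwards [lt_mem_nhds hr] with s hs using growth_of_ge hρ hs.le
  refine ((hpow.congr_of_eventuallyEq heq).fun_pow 2).congr_deriv ?_
  rw [growth_of_ge hρ hr.le]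
  push_cast
  ring

/-- The substitution `Q = g² q` absorbs the logarithmic derivative `2 a / r` of `g²` into `n`. -/
lemma IsRiccatiSubsolution.growth_sq_mul {n a ρ S : ℝ} (hρ : 0 < ρ) {W q : ℝ → ℝ}
    (hq : IsRiccatiSubsolution (n - a) 1 W q ρ S) :
    IsRiccatiSubsolution n (fun r => growth a ρ r ^ 2) W (fun r => growth a ρ r ^ 2 * q r) ρ S := by
  have hg := continuous_growth a ρ
  refine ⟨(hg.pow 2).continuousOn.mul hq.continuousOn, fun r hr => ?_⟩
  obtain ⟨q', hq', hle⟩ := hq.deriv_le r hr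
  refine ⟨_, (hasDerivAt_growth_sq a hρ hr.1).mul hq', ?_⟩
  have hr0 : 0 < r := hρ.trans hr.1
  have hw : 0 < growth a ρ r ^ 2 := pow_pos (growth_pos a ρ r) 2
  set w := growth a ρ r ^ 2
  have hleft : r * (2 * a / r * w * q r + w * q') = w * (r * q' + 2 * a * q r) := by
    field_simp
    ring
  have hright : 2 * n * (w * q r) - (w * q r) ^ 2 / w - W r * w * r ^ 2 =
      w * (2 * n * q r - q r ^ 2 - W r * r ^ 2) := by
    field_simp
  rw [hleft, hright]
  simp only [Pi.one_apply, div_one, mul_one] at hle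
  exact mul_le_mul_of_nonneg_left (by linarith) hw.le

lemma isRiccatiSubsolution_outer_const {α : ℝ} {n : ℤ} (hn : (n : ℝ) ≠ |α|) (ρ S : ℝ) :
    IsRiccatiSubsolution (n - |α|) 1 (radialWeight α ρ) (fun _ => n - |α|) ρ S := by
  refine ⟨continuousOn_const, fun r _ => ⟨0, hasDerivAt_const _ _, ?_⟩⟩
  have hW := (radialWeight_mul_sq_le α ρ r).trans (hardyCoeff_le_sub_sq hn)
  simp only [Pi.one_apply, div_one, mul_one, mul_zero]
  linarith

lemma isRiccatiSubsolution_outer_log {m : ℤ} (hm : m ≠ 0) {ρ : ℝ} (hρ : 0 < ρ) (S : ℝ) :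
    IsRiccatiSubsolution 0 1 (radialWeight m ρ)
      (fun r => 1 / (2 * (Real.log (r / ρ) + 1 / (2 * |(m : ℝ)|)))) ρ S := by
  set s := 1 / (2 * |(m : ℝ)|)
  have : 0 < s := by positivity
  have hlog {r : ℝ} (hr : ρ ≤ r) : 0 < 2 * (Real.log (r / ρ) + s) := by
    have := Real.log_nonneg ((one_le_div hρ).2 hr)
    positivity
  have hderiv {r : ℝ} (hr : ρ ≤ r) : HasDerivAt (fun r => 1 / (2 * (Real.log (r / ρ) + s)))
      (-(2 * (1 / r)) / (2 * (Real.log (r / ρ) + s)) ^ 2) r := by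
    have hr0 : 0 < r := hρ.trans_le hr
    have h := ((((hasDerivAt_id' r).div_const ρ).log (div_pos hr0 hρ).ne').add_const s
      |>.const_mul 2).fun_inv (hlog hr).ne'
    rw [div_div_div_cancel_right₀ hρ.ne'] at h
    simpa only [one_div] using h
  refine ⟨fun r hr => (hderiv hr.1).continuousAt.continuousWithinAt, fun r hr =>
    ⟨_, hderiv hr.1.le, ?_⟩⟩
  have hr0 : 0 < r := hρ.trans hr.1
  have hW := radialWeight_intCast_mul_sq_le hm hρ hr.1.le
  have hmul : r * (-(2 * (1 / r)) / (2 * (Real.log (r / ρ) + s)) ^ 2) =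
      -2 * (1 / (2 * (Real.log (r / ρ) + s))) ^ 2 := by
    field_simp
  rw [hmul]
  simp only [Pi.one_apply, div_one, mul_one, mul_zero, zero_mul, zero_sub]
  linarith

lemma exists_isRiccatiSubsolution_inner (α : ℝ) {ρ : ℝ} (hρ : 0 < ρ) (n : ℤ) :
    ∃ P, IsRiccatiSubsolution n (fun r => growth |α| ρ r ^ 2) (radialWeight α ρ) P 0 ρ ∧
      (n = 0 → P 0 = 0) ∧ n - |α| ≤ P ρ ∧ (n ≠ 0 → P ρ = n) := by
  rcases eq_or_ne n 0 with rfl | hn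
  · refine ⟨_, by simpa using isRiccatiSubsolution_inner_zero α hρ, by simp, ?_, by simp⟩
    simpa [div_self hρ.ne'] using hardyCoeff_le_abs α
  · exact ⟨_, isRiccatiSubsolution_inner_const α hρ hn, fun h => absurd h hn, by simp, fun _ => rfl⟩

lemma exists_isRiccatiSubsolution_outer {α ρ : ℝ} (hα : α ≠ 0) (hρ : 0 < ρ) (n : ℤ) (S : ℝ) :
    ∃ Q, IsRiccatiSubsolution n (fun r => growth |α| ρ r ^ 2) (radialWeight α ρ) Q ρ S ∧
      (Q ρ = n - |α| ∨ n ≠ 0 ∧ Q ρ = n) := by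
  have hg : growth |α| ρ ρ = 1 := growth_of_le hρ le_rfl
  by_cases hn : (n : ℝ) = |α|
  · have hn0 : n ≠ 0 := fun h => hα (abs_eq_zero.1 (by rw [← hn, h, Int.cast_zero]))
    obtain ⟨m, rfl⟩ : ∃ m : ℤ, (m : ℝ) = α := by
      rcases abs_choice α with h | h
      · exact ⟨n, hn.trans h⟩
      · exact ⟨-n, by rw [Int.cast_neg, hn, h, neg_neg]⟩
    have hm : m ≠ 0 := by exact_mod_cast hα
    refine ⟨_, IsRiccatiSubsolution.growth_sq_mul hρ
      (by simpa [hn] using isRiccatiSubsolution_outer_log hm hρ S), Or.inr ⟨hn0, ?_⟩⟩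
    rw [hg, div_self hρ.ne', Real.log_one, hn]
    field_simp
    norm_num
  · exact ⟨_, (isRiccatiSubsolution_outer_const hn ρ S).growth_sq_mul hρ, Or.inl (by simp [hg])⟩

lemma lintegral_radialWeight_le_mode {E : Type*} [NormedAddCommGroup E] [InnerProductSpace ℝ E]
    {α ρ : ℝ} (hα : α ≠ 0) (hρ : 0 < ρ) (n : ℤ) {c c' : ℝ → E} (hc : ∀ r, HasDerivAt c (c' r) r)
    (hc' : Continuous c') (h0 : n ≠ 0 → c 0 = 0) {R : ℝ} (hR : ∀ r, R ≤ r → c r = 0) :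
    ∫⁻ r in Ioi 0, ENNReal.ofReal
        (radialWeight α ρ r * growth |α| ρ r ^ 2 * r * ‖c r‖ ^ 2) ≤
      ∫⁻ r in Ioi 0, ENNReal.ofReal
        (growth |α| ρ r ^ 2 * r * ‖c' r + ((n : ℝ) / r) • c r‖ ^ 2) := by
  obtain ⟨P, hP, hP0, hPsub, hPn⟩ := exists_isRiccatiSubsolution_inner α hρ n
  obtain ⟨Q, hQ, hQρ⟩ := exists_isRiccatiSubsolution_outer hα hρ n (max ρ R)
  refine lintegral_le_of_isRiccatiSubsolution hρ (le_max_left ρ R)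
    ((continuous_growth |α| ρ).pow 2) (fun r => pow_pos (growth_pos _ _ r) 2)
    (continuous_radialWeight α hρ) (radialWeight_nonneg α ρ) hP hQ ?_ hc hc' ?_
    fun r hr => hR r ((le_max_right ρ R).trans hr)
  · rcases hQρ with hQρ | ⟨hn, hQρ⟩ <;> rw [hQρ]
    · exact hPsub
    · exact (hPn hn).ge
  · rcases eq_or_ne n 0 with hn | hn
    · rw [hP0 hn, zero_mul]
    · rw [h0 hn, norm_zero, zero_pow two_ne_zero, mul_zero]

/-! ### Angular modes of the Cauchy–Riemann operator -/

/-- The radial unit vector `(cos θ, sin θ)`. -/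
def radialVec (θ : ℝ) : Plane := !₂[Real.cos θ, Real.sin θ]

/-- The angular unit vector `(-sin θ, cos θ)`. -/
def angularVec (θ : ℝ) : Plane := !₂[-Real.sin θ, Real.cos θ]

lemma norm_radialVec (θ : ℝ) : ‖radialVec θ‖ = 1 := by
  simp [radialVec, EuclideanSpace.norm_eq]

lemma norm_smul_radialVec {r : ℝ} (hr : 0 ≤ r) (θ : ℝ) : ‖r • radialVec θ‖ = r := by
  rw [norm_smul, norm_radialVec, mul_one, Real.norm_of_nonneg hr]

@[fun_prop]
lemma continuous_radialVec : Continuous radialVec := by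
  refine (PiLp.continuous_toLp 2 _).comp (continuous_pi fun i => ?_)
  fin_cases i
  exacts [Real.continuous_cos, Real.continuous_sin]

@[fun_prop]
lemma continuous_angularVec : Continuous angularVec := by
  refine (PiLp.continuous_toLp 2 _).comp (continuous_pi fun i => ?_)
  fin_cases i
  exacts [Real.continuous_sin.neg, Real.continuous_cos]

lemma hasDerivAt_radialVec (θ : ℝ) : HasDerivAt radialVec (angularVec θ) θ := by
  have h : HasDerivAt (fun θ => ![Real.cos θ, Real.sin θ]) ![-Real.sin θ, Real.cos θ] θ := by
    refine hasDerivAt_pi.2 fun i => ?_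
    fin_cases i
    exacts [Real.hasDerivAt_cos θ, Real.hasDerivAt_sin θ]
  exact (PiLp.continuousLinearEquiv 2 ℝ
    (fun _ : Fin 2 => ℝ)).symm.hasFDerivAt.comp_hasDerivAt θ h

lemma lintegral_polar {f : Plane → ℝ≥0∞} (hf : Measurable f) :
    ∫⁻ x, f x = ∫⁻ r in Ioi 0, ∫⁻ θ in Ioc (-Real.pi) Real.pi,
      ENNReal.ofReal r * f (r • radialVec θ) := by
  have hpair : ∫⁻ x, f x = ∫⁻ p : ℝ × ℝ, f !₂[p.1, p.2] := by
    rw [← (PiLp.volume_preserving_toLp (Fin 2)).lintegral_comp hf,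
      ← (volume_preserving_finTwoArrow ℝ).symm.lintegral_comp
        (f := fun a : Fin 2 → ℝ => f (WithLp.toLp 2 a))
        (hf.comp (PiLp.volume_preserving_toLp (Fin 2)).measurable)]
    rfl
  have hvec (p : ℝ × ℝ) : !₂[(polarCoord.symm p).1, (polarCoord.symm p).2] =
      p.1 • radialVec p.2 := by
    ext i
    fin_cases i <;> rfl
  rw [hpair, ← lintegral_comp_polarCoord_symm, polarCoord_target, Measure.volume_eq_prod,
    ← Measure.prod_restrict]
  simp only [hvec, smul_eq_mul]
  rw [lintegral_prod]
  · simp only [restrict_Ioo_eq_restrict_Ioc]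
  · have hpolar : Continuous fun p : ℝ × ℝ => p.1 • radialVec p.2 := by fun_prop
    exact (measurable_fst.ennreal_ofReal.mul (hf.comp hpolar.measurable)).aemeasurable

/-- The `m`-th Fourier coefficient on `[-π, π]`. -/
def angularCoeff (f : ℝ → ℂ) (m : ℤ) : ℂ :=
  fourierCoeffOn (neg_lt_self Real.pi_pos) f m

lemma angularCoeff_eq (f : ℝ → ℂ) (m : ℤ) : angularCoeff f m =
    (1 / (2 * Real.pi) : ℝ) •
      ∫ θ in -Real.pi..Real.pi, Complex.exp (-(m * θ * Complex.I)) * f θ := by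
  rw [angularCoeff, fourierCoeffOn_eq_integral]
  congr 1
  · rw [sub_neg_eq_add, two_mul]
  · refine intervalIntegral.integral_congr fun θ _ => ?_
    simp only [smul_eq_mul]
    rw [fourier_coe_apply]
    congr 2
    have : (Real.pi : ℂ) ≠ 0 := by exact_mod_cast Real.pi_ne_zero
    push_cast
    field_simp
    ring

lemma angularCoeff_add {f g : ℝ → ℂ} (hf : Continuous f) (hg : Continuous g) (m : ℤ) :
    angularCoeff (fun θ => f θ + g θ) m = angularCoeff f m + angularCoeff g m := by
  simp only [angularCoeff_eq, mul_add]
  rw [intervalIntegral.integral_add, smul_add] <;>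
  · apply Continuous.intervalIntegrable
    fun_prop

lemma angularCoeff_const_mul (f : ℝ → ℂ) (c : ℂ) (m : ℤ) :
    angularCoeff (fun θ => c * f θ) m = c * angularCoeff f m :=
  fourierCoeffOn.const_mul _ _ _ _

lemma angularCoeff_zero (m : ℤ) : angularCoeff (fun _ => 0) m = 0 := by
  simp only [angularCoeff_eq, mul_zero, intervalIntegral.integral_zero, smul_zero]

lemma angularCoeff_deriv {f f' : ℝ → ℂ} (hf : ∀ θ, HasDerivAt f (f' θ) θ) (hf' : Continuous f')
    (hper : f (-Real.pi) = f Real.pi) (m : ℤ) :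
    angularCoeff f' m = Complex.I * m * angularCoeff f m := by
  have hf'i := hf'.intervalIntegrable (μ := volume) (-Real.pi) Real.pi
  have hπ : (Real.pi : ℂ) ≠ 0 := by exact_mod_cast Real.pi_ne_zero
  rcases eq_or_ne m 0 with rfl | hm
  · rw [angularCoeff_eq]
    simp only [Int.cast_zero, zero_mul, neg_zero, Complex.exp_zero, one_mul, mul_zero]
    rw [intervalIntegral.integral_eq_sub_of_hasDerivAt (fun θ _ => hf θ) hf'i, hper, sub_self,
      smul_zero]
  · unfold angularCoeff
    rw [fourierCoeffOn_of_hasDerivAt _ hm (fun θ _ => hf θ) hf'i, hper, sub_self, mul_zero,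
      zero_sub]
    have hm' : (m : ℂ) ≠ 0 := by exact_mod_cast hm
    push_cast
    field_simp
    ring

lemma angularCoeff_const (z : ℂ) {m : ℤ} (hm : m ≠ 0) : angularCoeff (fun _ => z) m = 0 := by
  have h := angularCoeff_deriv (fun θ => hasDerivAt_const θ z) continuous_const rfl m
  rw [angularCoeff_zero] at h
  exact (mul_eq_zero.1 h.symm).resolve_left
    (mul_ne_zero Complex.I_ne_zero (by exact_mod_cast hm))

lemma continuous_angularCoeff {F : ℝ → ℝ → ℂ} (hF : Continuous fun p : ℝ × ℝ => F p.1 p.2)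
    (m : ℤ) : Continuous fun r => angularCoeff (F r) m := by
  simp only [angularCoeff_eq]
  have hint := intervalIntegral.continuous_parametric_intervalIntegral_of_continuous'
    (f := fun r (θ : ℝ) => Complex.exp (-(m * θ * Complex.I)) * F r θ) (μ := volume)
    (by unfold Function.uncurry; fun_prop) (-Real.pi) Real.pi
  exact hint.const_smul (1 / (2 * Real.pi) : ℝ)

lemma hasDerivAt_angularCoeff {F F' : ℝ → ℝ → ℂ} (hF : ∀ r, Continuous (F r))
    (hF' : ∀ r, Continuous (F' r)) (h : ∀ r θ, HasDerivAt (fun r => F r θ) (F' r θ) r) {C : ℝ}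
    (hC : ∀ r θ, ‖F' r θ‖ ≤ C) (m : ℤ) (r : ℝ) :
    HasDerivAt (fun r => angularCoeff (F r) m) (angularCoeff (F' r) m) r := by
  simp only [angularCoeff_eq]
  have hcont {f : ℝ → ℂ} (hf : Continuous f) :
      Continuous fun θ : ℝ => Complex.exp (-(m * θ * Complex.I)) * f θ := by fun_prop
  have hnorm (θ : ℝ) : ‖Complex.exp (-(m * θ * Complex.I))‖ = 1 := by
    rw [show -((m : ℂ) * θ * Complex.I) = ((-(m * θ) : ℝ) : ℂ) * Complex.I by push_cast; ring,
      Complex.norm_exp_ofReal_mul_I]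
  refine (intervalIntegral.hasDerivAt_integral_of_dominated_loc_of_deriv_le
    (F' := fun r θ => Complex.exp (-(m * θ * Complex.I)) * F' r θ) (bound := fun _ => C) univ_mem
    (.of_forall fun r => (hcont (hF r)).aestronglyMeasurable)
    ((hcont (hF r)).intervalIntegrable _ _) (hcont (hF' r)).aestronglyMeasurable
    (ae_of_all _ fun θ _ r _ => ?_) (continuous_const.intervalIntegrable _ _)
    (ae_of_all _ fun θ _ r _ => (h r θ).const_mul _)).2.const_smul (1 / (2 * Real.pi))
  rw [norm_mul, hnorm, one_mul]
  exact hC r θ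

lemma lintegral_angular {f : ℝ → ℂ}
    (hf : MemLp f 2 (volume.restrict (Ioc (-Real.pi) Real.pi))) :
    ∫⁻ θ in Ioc (-Real.pi) Real.pi, ENNReal.ofReal (‖f θ‖ ^ 2) =
      ENNReal.ofReal (2 * Real.pi) * ∑' m : ℤ, ENNReal.ofReal (‖angularCoeff f m‖ ^ 2) := by
  have hπ := neg_lt_self Real.pi_pos
  have hsq : Integrable (fun θ => ‖f θ‖ ^ 2) (volume.restrict (Ioc (-Real.pi) Real.pi)) :=
    (memLp_two_iff_integrable_sq_norm hf.1).1 hf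
  have hparseval : HasSum (fun m => ‖angularCoeff f m‖ ^ 2) _ := hasSum_sq_fourierCoeffOn hπ hf
  rw [← ENNReal.ofReal_tsum_of_nonneg (fun _ => sq_nonneg _) hparseval.summable, hparseval.tsum_eq,
    smul_eq_mul, ← ENNReal.ofReal_mul Real.two_pi_pos.le, sub_neg_eq_add, ← two_mul,
    mul_inv_cancel_left₀ Real.two_pi_pos.ne', intervalIntegral.integral_of_le hπ.le,
    ofReal_integral_eq_lintegral_ofReal hsq (ae_of_all _ fun _ => sq_nonneg _)]

lemma lintegral_polar_parseval {w : ℝ → ℝ} (hwm : Measurable w) (hw0 : ∀ r, 0 ≤ w r)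
    {f : Plane → ℂ} (hf : Continuous f) {F : ℝ → ℝ → ℂ}
    (hF : Continuous fun p : ℝ × ℝ => F p.1 p.2)
    (hfF : ∀ r θ, ‖f (r • radialVec θ)‖ = ‖F r θ‖) :
    ∫⁻ x, ENNReal.ofReal (w ‖x‖ * ‖f x‖ ^ 2) = ENNReal.ofReal (2 * Real.pi) *
      ∑' m : ℤ, ∫⁻ r in Ioi 0, ENNReal.ofReal (w r * r * ‖angularCoeff (F r) m‖ ^ 2) := by
  have : Measurable fun x : Plane => w ‖x‖ := hwm.comp measurable_norm
  have hL2 (r : ℝ) : MemLp (F r) 2 (volume.restrict (Ioc (-Real.pi) Real.pi)) := by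
    have hFr : Continuous (F r) := hF.comp (Continuous.prodMk_right r)
    obtain ⟨C, hC⟩ := isCompact_Icc.exists_bound_of_continuousOn hFr.continuousOn
    exact .of_bound hFr.aestronglyMeasurable C
      (ae_restrict_of_forall_mem measurableSet_Ioc fun θ hθ => hC θ (Ioc_subset_Icc_self hθ))
  rw [lintegral_polar (by fun_prop), ← lintegral_tsum fun m => by
      have := (continuous_angularCoeff hF m).measurable
      fun_prop,
    ← lintegral_const_mul' _ _ ENNReal.ofReal_ne_top]
  refine setLIntegral_congr_fun measurableSet_Ioi fun r (hr : 0 < r) => ?_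
  have hwr : 0 ≤ w r * r := mul_nonneg (hw0 r) hr.le
  have hfactor (θ : ℝ) : ENNReal.ofReal r * ENNReal.ofReal (w r * ‖F r θ‖ ^ 2) =
      ENNReal.ofReal (w r * r) * ENNReal.ofReal (‖F r θ‖ ^ 2) := by
    rw [← ENNReal.ofReal_mul hr.le, ← ENNReal.ofReal_mul hwr, mul_left_comm, mul_assoc]
  simp only [norm_smul_radialVec hr.le, hfF, hfactor, ENNReal.ofReal_mul hwr]
  rw [lintegral_const_mul' _ _ ENNReal.ofReal_ne_top, lintegral_angular (hL2 r), mul_left_comm,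
    ENNReal.tsum_mul_left]

/-- The Cauchy–Riemann type operator `∂₁ + i s ∂₂`. -/
def dbar (s : ℤ) (v : Plane → ℂ) (x : Plane) : ℂ :=
  partialDeriv 0 v x + Complex.I * s * partialDeriv 1 v x

lemma continuous_partialDeriv {F : Type*} [NormedAddCommGroup F] [NormedSpace ℝ F]
    {v : Plane → F} (hv : ContDiff ℝ 1 v) (j : Fin 2) : Continuous (partialDeriv j v) :=
  (hv.continuous_fderiv one_ne_zero).clm_apply continuous_const

lemma continuous_dbar (s : ℤ) {v : Plane → ℂ} (hv : ContDiff ℝ 1 v) : Continuous (dbar s v) :=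
  (continuous_partialDeriv hv 0).add (continuous_const.mul (continuous_partialDeriv hv 1))

lemma fderiv_apply_eq_partialDeriv {F : Type*} [NormedAddCommGroup F] [NormedSpace ℝ F]
    (v : Plane → F) (x y : Plane) :
    fderiv ℝ v x y = y 0 • partialDeriv 0 v x + y 1 • partialDeriv 1 v x := by
  have : y = y 0 • EuclideanSpace.single 0 1 + y 1 • EuclideanSpace.single 1 1 := by
    ext i
    fin_cases i <;> simp
  nth_rw 1 [this]
  rw [map_add, map_smul, map_smul]
  rfl

/-- The operator `∂₁ + i s ∂₂` in polar coordinates with its phase `e^{isθ}` removed, i.e.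
`∂ᵣ + (i s / r) ∂_θ`. -/
def polarDbar (s : ℤ) (v : Plane → ℂ) (r θ : ℝ) : ℂ :=
  fderiv ℝ v (r • radialVec θ) (radialVec θ) +
    Complex.I * s * fderiv ℝ v (r • radialVec θ) (angularVec θ)

lemma norm_dbar_smul_radialVec {s : ℤ} (hs : s = 1 ∨ s = -1) (v : Plane → ℂ) (r θ : ℝ) :
    ‖dbar s v (r • radialVec θ)‖ = ‖polarDbar s v r θ‖ := by
  have hs2 : (s : ℂ) ^ 2 = 1 := by rcases hs with rfl | rfl <;> norm_num
  have hcs := Complex.sin_sq_add_cos_sq θ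
  have hphase : dbar s v (r • radialVec θ) =
      Complex.exp ((s * θ : ℝ) * Complex.I) * polarDbar s v r θ := by
    have hexp : Complex.exp ((s * θ : ℝ) * Complex.I) =
        Complex.cos θ + s * Complex.sin θ * Complex.I := by
      rw [Complex.exp_mul_I]
      rcases hs with rfl | rfl <;> simp
    simp only [hexp, polarDbar, fderiv_apply_eq_partialDeriv, dbar, radialVec, angularVec,
      Complex.real_smul, Matrix.cons_val_zero, Matrix.cons_val_one,
      Complex.ofReal_neg, Complex.ofReal_cos, Complex.ofReal_sin]
    generalize partialDeriv 0 v _ = a, partialDeriv 1 v _ = b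
    generalize Complex.cos θ = c, Complex.sin θ = d at hcs ⊢
    linear_combination (-a - Complex.I * s * b) * hcs +
      (-d * s ^ 2 * (c * b - d * a)) * Complex.I_sq + (d * (c * b - d * a)) * hs2
  rw [hphase, norm_mul, Complex.norm_exp_ofReal_mul_I, one_mul]

section PolarDerivatives

variable {F : Type*} [NormedAddCommGroup F] [NormedSpace ℝ F] {v : Plane → F}

lemma continuous_fderiv_smul_radialVec (hv : ContDiff ℝ 1 v) {e : ℝ → Plane} (he : Continuous e) :
    Continuous fun p : ℝ × ℝ => fderiv ℝ v (p.1 • radialVec p.2) (e p.2) :=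
  ((hv.continuous_fderiv one_ne_zero).comp (by fun_prop)).clm_apply (by fun_prop)

lemma hasDerivAt_smul_radialVec_left (hv : Differentiable ℝ v) (r θ : ℝ) :
    HasDerivAt (fun r => v (r • radialVec θ)) (fderiv ℝ v (r • radialVec θ) (radialVec θ)) r := by
  have h := (hv (r • radialVec θ)).hasFDerivAt.comp_hasDerivAt r
    ((hasDerivAt_id' r).smul_const (radialVec θ))
  rwa [one_smul] at h

lemma hasDerivAt_smul_radialVec_right (hv : Differentiable ℝ v) (r θ : ℝ) :
    HasDerivAt (fun θ => v (r • radialVec θ))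
      (r • fderiv ℝ v (r • radialVec θ) (angularVec θ)) θ := by
  have h := (hv (r • radialVec θ)).hasFDerivAt.comp_hasDerivAt θ
    ((hasDerivAt_radialVec θ).const_smul r)
  rwa [map_smul] at h

end PolarDerivatives

section PolarModes

variable {v : Plane → ℂ}

lemma continuous_polarDbar (s : ℤ) (hv : ContDiff ℝ 1 v) :
    Continuous fun p : ℝ × ℝ => polarDbar s v p.1 p.2 :=
  (continuous_fderiv_smul_radialVec hv continuous_radialVec).add
    (continuous_const.mul (continuous_fderiv_smul_radialVec hv continuous_angularVec))

lemma angularCoeff_polarDbar (hv : ContDiff ℝ 1 v) (s m : ℤ) {r : ℝ} (hr : 0 < r) :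
    angularCoeff (polarDbar s v r) m =
      angularCoeff (fun θ => fderiv ℝ v (r • radialVec θ) (radialVec θ)) m +
        (((-s * m : ℤ) : ℝ) / r) • angularCoeff (fun θ => v (r • radialVec θ)) m := by
  have hdiff : Differentiable ℝ v := hv.differentiable one_ne_zero
  have hrad : Continuous fun θ => fderiv ℝ v (r • radialVec θ) (radialVec θ) :=
    (continuous_fderiv_smul_radialVec hv continuous_radialVec).comp (Continuous.prodMk_right r)
  have hang : Continuous fun θ => fderiv ℝ v (r • radialVec θ) (angularVec θ) :=
    (continuous_fderiv_smul_radialVec hv continuous_angularVec).comp (Continuous.prodMk_right r)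
  have hper : v (r • radialVec (-Real.pi)) = v (r • radialVec Real.pi) := by
    simp only [radialVec, Real.cos_neg, Real.sin_neg, Real.sin_pi, neg_zero]
  have hcoeff := angularCoeff_deriv (hasDerivAt_smul_radialVec_right hdiff r)
    (hang.const_smul r) hper m
  simp only [Complex.real_smul] at hcoeff
  rw [angularCoeff_const_mul] at hcoeff
  have hr' : (r : ℂ) ≠ 0 := by exact_mod_cast hr.ne'
  have hang' : Continuous fun θ =>
      Complex.I * s * fderiv ℝ v (r • radialVec θ) (angularVec θ) := continuous_const.mul hang
  unfold polarDbar
  rw [angularCoeff_add hrad hang', angularCoeff_const_mul,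
    eq_div_of_mul_eq hr' ((mul_comm _ _).trans hcoeff), Complex.real_smul]
  push_cast
  linear_combination (s * m / r * angularCoeff (fun θ => v (r • radialVec θ)) m : ℂ) * Complex.I_sq

lemma exists_smul_radialVec_eq_zero (hsupp : HasCompactSupport v) :
    ∃ R : ℝ, ∀ r, R ≤ r → ∀ θ, v (r • radialVec θ) = 0 := by
  obtain ⟨R, hR⟩ := hsupp.isCompact.isBounded.subset_ball (0 : Plane)
  refine ⟨max 0 R, fun r hr θ => image_eq_zero_of_notMem_tsupport fun hmem => ?_⟩
  have h := hR hmem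
  rw [mem_ball_zero_iff, norm_smul_radialVec ((le_max_left 0 R).trans hr)] at h
  exact (((le_max_right 0 R).trans hr).trans_lt h).false

theorem lintegral_radialWeight_le_dbar {α ρ : ℝ} (hα : α ≠ 0) (hρ : 0 < ρ) {s : ℤ}
    (hs : s = 1 ∨ s = -1) (hv : ContDiff ℝ 1 v) (hsupp : HasCompactSupport v) :
    ∫⁻ x, ENNReal.ofReal (radialWeight α ρ ‖x‖ * growth |α| ρ ‖x‖ ^ 2 * ‖v x‖ ^ 2) ≤
      ∫⁻ x, ENNReal.ofReal (growth |α| ρ ‖x‖ ^ 2 * ‖dbar s v x‖ ^ 2) := by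
  have hW := (continuous_radialWeight α hρ).measurable
  have hg := (continuous_growth |α| ρ).measurable
  have hV : Continuous fun p : ℝ × ℝ => v (p.1 • radialVec p.2) := hv.continuous.comp (by fun_prop)
  have hVr := continuous_fderiv_smul_radialVec hv continuous_radialVec
  obtain ⟨C, hC⟩ := (hsupp.fderiv ℝ).exists_bound_of_continuous
    (hv.continuous_fderiv one_ne_zero)
  have hVrC (r θ : ℝ) : ‖fderiv ℝ v (r • radialVec θ) (radialVec θ)‖ ≤ C :=
    ((fderiv ℝ v _).unit_le_opNorm _ (norm_radialVec θ).le).trans (hC _)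
  obtain ⟨R, hR⟩ := exists_smul_radialVec_eq_zero hsupp
  rw [lintegral_polar_parseval (w := fun r => radialWeight α ρ r * growth |α| ρ r ^ 2)
      (hW.mul (hg.pow_const 2)) (fun r => mul_nonneg (radialWeight_nonneg α ρ r) (sq_nonneg _))
      hv.continuous hV fun _ _ => rfl,
    lintegral_polar_parseval (w := fun r => growth |α| ρ r ^ 2) (hg.pow_const 2)
      (fun r => sq_nonneg _) (continuous_dbar s hv) (continuous_polarDbar s hv)
      (norm_dbar_smul_radialVec hs v)]
  refine mul_le_mul_right (ENNReal.tsum_le_tsum fun m => ?_) _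
  refine (lintegral_radialWeight_le_mode hα hρ (-s * m)
    (hasDerivAt_angularCoeff (F := fun r θ => v (r • radialVec θ))
      (F' := fun r θ => fderiv ℝ v (r • radialVec θ) (radialVec θ))
      (fun r => hV.comp (Continuous.prodMk_right r))
      (fun r => hVr.comp (Continuous.prodMk_right r))
      (hasDerivAt_smul_radialVec_left (hv.differentiable one_ne_zero)) hVrC m)
    (continuous_angularCoeff hVr m) (fun hm => ?_) (R := R) fun r hr => ?_).trans_eq
    (setLIntegral_congr_fun measurableSet_Ioi fun r hr => ?_)
  · simp only [zero_smul]
    exact angularCoeff_const _ (right_ne_zero_of_mul hm)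
  · simp only [hR r hr, angularCoeff_zero]
  · simp only [angularCoeff_polarDbar hv s m hr]

end PolarModes

/-! ### The logarithm as fundamental solution of the Laplacian -/

lemma contDiff_partialDeriv {F : Type*} [NormedAddCommGroup F] [NormedSpace ℝ F] {f : Plane → F}
    {n : WithTop ℕ∞} (hf : ContDiff ℝ (n + 1) f) (j : Fin 2) : ContDiff ℝ n (partialDeriv j f) :=
  (hf.fderiv_right le_rfl).clm_apply contDiff_const

lemma IsTestFunction.partialDeriv {φ : Plane → ℝ} (hφ : IsTestFunction φ) (j : Fin 2) :
    IsTestFunction (partialDeriv j φ) :=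
  ⟨contDiff_partialDeriv hφ.1 j, hφ.2.fderiv_apply ℝ _⟩

lemma IsTestFunction.continuous {φ : Plane → ℝ} (hφ : IsTestFunction φ) : Continuous φ :=
  hφ.1.continuous

lemma integral_partialDeriv_smul {F : Type*} [NormedAddCommGroup F] [NormedSpace ℝ F]
    {φ : Plane → ℝ} {f : Plane → F} (hφ : ContDiff ℝ 1 φ) (hs : HasCompactSupport φ)
    (hf : ContDiff ℝ 1 f) (j : Fin 2) :
    ∫ x, partialDeriv j φ x • f x = -∫ x, φ x • partialDeriv j f x := by
  have hsj : HasCompactSupport (partialDeriv j φ) := hs.fderiv_apply ℝ _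
  exact neg_eq_iff_eq_neg.1 (integral_smul_fderiv_eq_neg_fderiv_smul_of_integrable
    (((continuous_partialDeriv hφ j).smul hf.continuous).integrable_of_hasCompactSupport
      hsj.smul_right)
    ((hφ.continuous.smul (continuous_partialDeriv hf j)).integrable_of_hasCompactSupport
      hs.smul_right)
    ((hφ.continuous.smul hf.continuous).integrable_of_hasCompactSupport hs.smul_right)
    (fun x _ => hφ.differentiable one_ne_zero x) fun x _ => hf.differentiable one_ne_zero x).symm

/-- The Laplacian `Δf = ∂₁²f + ∂₂²f`, expressed through `partialDeriv`. -/
def laplacian (f : Plane → ℝ) (x : Plane) : ℝ :=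
  partialDeriv 0 (partialDeriv 0 f) x + partialDeriv 1 (partialDeriv 1 f) x

lemma continuous_laplacian {f : Plane → ℝ} (hf : ContDiff ℝ 2 f) : Continuous (laplacian f) :=
  (continuous_partialDeriv (contDiff_partialDeriv hf 0) 0).add
    (continuous_partialDeriv (contDiff_partialDeriv hf 1) 1)

lemma hasCompactSupport_laplacian {f : Plane → ℝ} (hf : HasCompactSupport f) :
    HasCompactSupport (laplacian f) :=
  ((hf.fderiv_apply ℝ _).fderiv_apply ℝ _).add ((hf.fderiv_apply ℝ _).fderiv_apply ℝ _)

lemma integral_mul_laplacian_comm {f φ : Plane → ℝ} (hf : ContDiff ℝ 2 f) (hφ : ContDiff ℝ 2 φ)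
    (hs : HasCompactSupport φ) :
    ∫ x, f x * laplacian φ x = ∫ x, laplacian f x * φ x := by
  have hs' (j : Fin 2) : HasCompactSupport (partialDeriv j φ) := hs.fderiv_apply ℝ _
  have hf' (j : Fin 2) : ContDiff ℝ 1 (partialDeriv j f) := contDiff_partialDeriv hf j
  have hφ' (j : Fin 2) : ContDiff ℝ 1 (partialDeriv j φ) := contDiff_partialDeriv hφ j
  have hparts (j : Fin 2) : ∫ x, f x * partialDeriv j (partialDeriv j φ) x =
      ∫ x, partialDeriv j (partialDeriv j f) x * φ x := by
    have h := integral_partialDeriv_smul (hφ' j) (hs' j) (hf.of_le one_le_two) j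
    rw [integral_partialDeriv_smul (hφ.of_le one_le_two) hs (hf' j), neg_neg] at h
    simpa only [smul_eq_mul, mul_comm] using h
  have hint (j : Fin 2) : Integrable fun x => f x * partialDeriv j (partialDeriv j φ) x :=
    (hf.continuous.mul (continuous_partialDeriv (hφ' j) j)).integrable_of_hasCompactSupport
      ((hs' j).fderiv_apply ℝ _).mul_left
  have hint' (j : Fin 2) : Integrable fun x => partialDeriv j (partialDeriv j f) x * φ x :=
    ((continuous_partialDeriv (hf' j) j).mul hφ.continuous).integrable_of_hasCompactSupport
      hs.mul_left
  simp only [laplacian, mul_add, add_mul]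
  rw [integral_add (hint 0) (hint 1), integral_add (hint' 0) (hint' 1), hparts, hparts]

/-- The regularization `(1/2) log(e + |x|²)` of `log |x|`. -/
def regLog (e : ℝ) (x : Plane) : ℝ := Real.log (e + ‖x‖ ^ 2) / 2

lemma contDiff_regLog {e : ℝ} (he : 0 < e) {n : WithTop ℕ∞} : ContDiff ℝ n (regLog e) :=
  ((contDiff_const.add (contDiff_norm_sq ℝ)).log fun x => by positivity).div_const 2

lemma hasFDerivAt_add_norm_sq (e : ℝ) (x : Plane) :
    HasFDerivAt (fun x : Plane => e + ‖x‖ ^ 2) (2 • innerSL ℝ x) x :=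
  (hasStrictFDerivAt_norm_sq x).hasFDerivAt.const_add e

lemma partialDeriv_regLog {e : ℝ} (he : 0 < e) (j : Fin 2) :
    partialDeriv j (regLog e) = fun x => x j / (e + ‖x‖ ^ 2) := by
  funext x
  have hpos : e + ‖x‖ ^ 2 ≠ 0 := by positivity
  have h : HasFDerivAt (regLog e) _ x :=
    ((hasFDerivAt_add_norm_sq e x).log hpos).mul_const (2⁻¹ : ℝ)
  rw [partialDeriv, h.fderiv]
  simp [innerSL_apply_apply, EuclideanSpace.inner_single_right]
  field_simp

lemma partialDeriv_partialDeriv_regLog {e : ℝ} (he : 0 < e) (j : Fin 2) (x : Plane) :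
    partialDeriv j (partialDeriv j (regLog e)) x =
      1 / (e + ‖x‖ ^ 2) - 2 * x j ^ 2 / (e + ‖x‖ ^ 2) ^ 2 := by
  have hpos : e + ‖x‖ ^ 2 ≠ 0 := by positivity
  have hcoord : HasFDerivAt (fun x : Plane => x j) (EuclideanSpace.proj j : Plane →L[ℝ] ℝ) x :=
    (EuclideanSpace.proj j : Plane →L[ℝ] ℝ).hasFDerivAt
  have h : HasFDerivAt (fun x : Plane => x j / (e + ‖x‖ ^ 2)) _ x :=
    hcoord.mul ((hasDerivAt_inv hpos).comp_hasFDerivAt x (hasFDerivAt_add_norm_sq e x))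
  rw [partialDeriv_regLog he j, partialDeriv, h.fderiv]
  simp [innerSL_apply_apply, EuclideanSpace.inner_single_right]
  field_simp
  ring

lemma laplacian_regLog {e : ℝ} (he : 0 < e) (x : Plane) :
    laplacian (regLog e) x = 2 * e / (e + ‖x‖ ^ 2) ^ 2 := by
  have hpos : e + ‖x‖ ^ 2 ≠ 0 := by positivity
  have hnorm : ‖x‖ ^ 2 = x 0 ^ 2 + x 1 ^ 2 := by
    rw [EuclideanSpace.real_norm_sq_eq, Fin.sum_univ_two]
  have he' : 2 * e = 2 * (e + ‖x‖ ^ 2) - 2 * (x 0 ^ 2 + x 1 ^ 2) := by rw [hnorm]; ring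
  rw [laplacian, partialDeriv_partialDeriv_regLog he, partialDeriv_partialDeriv_regLog he, he']
  field_simp
  ring

lemma integral_one_add_norm_sq_inv_sq : ∫ x : Plane, 1 / (Real.pi * (1 + ‖x‖ ^ 2) ^ 2) = 1 := by
  have hπ := Real.pi_pos
  have hvol : volume.real (Metric.ball (0 : Plane) 1) = Real.pi := by
    rw [Measure.real, EuclideanSpace.volume_ball_fin_two]
    simp [hπ.le]
  have hderiv : ∀ r ∈ Ici (0 : ℝ),
      HasDerivAt (fun r : ℝ => -(1 / (2 * Real.pi)) * (1 + r ^ 2)⁻¹)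
        (r * (1 / (Real.pi * (1 + r ^ 2) ^ 2))) r := fun r _ => by
    have h := (((hasDerivAt_pow 2 r).const_add 1).fun_inv (by positivity)).const_mul
      (-(1 / (2 * Real.pi)))
    refine h.congr_deriv ?_
    push_cast
    field_simp
  have hlim : Tendsto (fun r : ℝ => -(1 / (2 * Real.pi)) * (1 + r ^ 2)⁻¹) atTop (𝓝 0) := by
    have h : Tendsto (fun r : ℝ => 1 + r ^ 2) atTop atTop :=
      tendsto_atTop_add_const_left _ _ (tendsto_pow_atTop two_ne_zero)
    simpa using h.inv_tendsto_atTop.const_mul (-(1 / (2 * Real.pi)))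
  rw [integral_fun_norm_addHaar volume (fun r : ℝ => 1 / (Real.pi * (1 + r ^ 2) ^ 2)), hvol]
  simp only [finrank_euclideanSpace, Fintype.card_fin, Nat.add_one_sub_one, pow_one, smul_eq_mul]
  rw [integral_Ioi_of_hasDerivAt_of_nonneg' hderiv (fun r (hr : 0 < r) => by positivity) hlim]
  field_simp
  norm_num

lemma tendsto_norm_sq_mul_one_add_norm_sq_inv_sq :
    Tendsto (fun x : Plane => ‖x‖ ^ 2 * (1 / (Real.pi * (1 + ‖x‖ ^ 2) ^ 2)))
      (Bornology.cobounded Plane) (𝓝 0) := by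
  have hπ := Real.pi_pos
  have hlim : Tendsto (fun r : ℝ => (Real.pi * (1 + r ^ 2))⁻¹) atTop (𝓝 0) :=
    (Tendsto.const_mul_atTop hπ
      (tendsto_atTop_add_const_left _ _ (tendsto_pow_atTop two_ne_zero))).inv_tendsto_atTop
  refine squeeze_zero (fun x => by positivity) (fun x => ?_)
    (hlim.comp tendsto_norm_cobounded_atTop)
  simp only [Function.comp]
  rw [mul_one_div, ← one_div, div_le_div_iff₀ (by positivity) (by positivity)]
  nlinarith [sq_nonneg ‖x‖, mul_pos hπ (show 0 < 1 + ‖x‖ ^ 2 by positivity)]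

/-- The Laplacians of the regularized logarithms are `2π` times an approximate identity. -/
lemma tendsto_integral_regLog_mul_laplacian {φ : Plane → ℝ} (hφ : IsTestFunction φ) :
    Tendsto (fun c : ℝ => ∫ x, regLog (c ^ 2)⁻¹ x * laplacian φ x) atTop
      (𝓝 (2 * Real.pi * φ 0)) := by
  have hpeak := tendsto_integral_comp_smul_smul_of_integrable (μ := (volume : Measure Plane))
    (φ := fun x => 1 / (Real.pi * (1 + ‖x‖ ^ 2) ^ 2)) (fun x => by positivity)
    integral_one_add_norm_sq_inv_sq
    (by simpa using tendsto_norm_sq_mul_one_add_norm_sq_inv_sq)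
    (hφ.continuous.integrable_of_hasCompactSupport hφ.2) hφ.continuous.continuousAt
  refine (hpeak.const_mul (2 * Real.pi)).congr' ?_
  filter_upwards [eventually_gt_atTop 0] with c hc
  have hφ2 : ContDiff ℝ 2 φ := hφ.1.of_le ENat.LEInfty.out
  rw [integral_mul_laplacian_comm (contDiff_regLog (by positivity)) hφ2 hφ.2,
    ← integral_const_mul]
  refine integral_congr_ae (ae_of_all _ fun x => ?_)
  simp only [laplacian_regLog (inv_pos.2 (pow_pos hc 2)), finrank_euclideanSpace, Fintype.card_fin,
    norm_smul, Real.norm_of_nonneg hc.le, smul_eq_mul]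
  field_simp

lemma abs_log_eq_posLog_add (r : ℝ) : |Real.log r| = Real.posLog r + Real.posLog r⁻¹ := by
  rw [← Real.half_mul_log_add_log_abs, ← Real.half_mul_log_add_log_abs, Real.log_inv, abs_neg]
  ring

lemma integrable_posLog_norm_inv : Integrable fun x : Plane => Real.posLog ‖x‖⁻¹ := by
  rw [integrable_fun_norm_addHaar (volume : Measure Plane) (f := fun r => Real.posLog r⁻¹)]
  simp only [finrank_euclideanSpace, Fintype.card_fin, Nat.add_one_sub_one, pow_one, smul_eq_mul]
  have hbound : IntegrableOn ((Iic (1 : ℝ)).indicator fun _ => (1 : ℝ)) (Ioi 0) := by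
    rw [integrableOn_indicator_iff measurableSet_Iic, Iic_inter_Ioi]
    exact integrableOn_const (by simp)
  refine hbound.mono' (by fun_prop) ?_
  refine ae_restrict_of_forall_mem measurableSet_Ioi fun r (hr : 0 < r) => ?_
  have hinv := inv_pos.2 hr
  rw [Real.norm_of_nonneg (mul_nonneg hr.le Real.posLog_nonneg), indicator_apply]
  split_ifs with h1
  · rw [Real.posLog_eq_log (by rw [abs_of_pos hinv]; exact (one_le_inv₀ hr).2 h1)]
    calc r * Real.log r⁻¹ ≤ r * r⁻¹ :=
          mul_le_mul_of_nonneg_left (Real.log_le_self hinv.le) hr.le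
      _ = 1 := mul_inv_cancel₀ hr.ne'
  · rw [(Real.posLog_eq_zero_iff _).2, mul_zero]
    rw [abs_of_pos hinv]
    exact inv_le_one_of_one_le₀ (le_of_not_ge h1)

lemma locallyIntegrable_log_norm : LocallyIntegrable fun x : Plane => Real.log ‖x‖ := by
  have hcont : Continuous fun x : Plane => Real.posLog ‖x‖ := by fun_prop
  refine (hcont.locallyIntegrable.add integrable_posLog_norm_inv.locallyIntegrable).mono
    (Real.measurable_log.comp measurable_norm).aestronglyMeasurable (ae_of_all _ fun x => ?_)
  rw [Real.norm_eq_abs, abs_log_eq_posLog_add]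
  exact le_abs_self _

lemma abs_regLog_le {e : ℝ} (he : 0 < e) (he1 : e ≤ 1) {x : Plane} (hx : x ≠ 0) :
    |regLog e x| ≤ |Real.log ‖x‖| + ‖x‖ ^ 2 := by
  have : 0 < ‖x‖ := norm_pos_iff.2 hx
  have hlow : Real.log ‖x‖ ≤ regLog e x := by
    have h : Real.log (‖x‖ ^ 2) ≤ Real.log (e + ‖x‖ ^ 2) :=
      Real.log_le_log (by positivity) (by linarith)
    rw [Real.log_pow] at h
    unfold regLog
    push_cast at h
    linarith
  have hup : regLog e x ≤ ‖x‖ ^ 2 := by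
    have h := Real.log_le_sub_one_of_pos (show 0 < e + ‖x‖ ^ 2 by positivity)
    unfold regLog
    linarith [sq_nonneg ‖x‖]
  rw [abs_le]
  constructor
  · linarith [neg_abs_le (Real.log ‖x‖), sq_nonneg ‖x‖]
  · linarith [abs_nonneg (Real.log ‖x‖)]

lemma tendsto_regLog {x : Plane} (hx : x ≠ 0) :
    Tendsto (fun c : ℝ => regLog (c ^ 2)⁻¹ x) atTop (𝓝 (Real.log ‖x‖)) := by
  have : 0 < ‖x‖ := norm_pos_iff.2 hx
  have h : Tendsto (fun c : ℝ => (c ^ 2)⁻¹ + ‖x‖ ^ 2) atTop (𝓝 (0 + ‖x‖ ^ 2)) :=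
    (tendsto_pow_atTop two_ne_zero).inv_tendsto_atTop.add_const _
  have hlog := (h.log (by positivity)).div_const 2
  rwa [zero_add, Real.log_pow, Nat.cast_two, mul_div_cancel_left₀ _ two_ne_zero] at hlog

lemma integral_log_norm_mul_laplacian {φ : Plane → ℝ} (hφ : IsTestFunction φ) :
    ∫ x, Real.log ‖x‖ * laplacian φ x = 2 * Real.pi * φ 0 := by
  refine tendsto_nhds_unique ?_ (tendsto_integral_regLog_mul_laplacian hφ)
  have hΔ : Continuous (laplacian φ) := continuous_laplacian (hφ.1.of_le ENat.LEInfty.out)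
  have hΔs := hasCompactSupport_laplacian hφ.2
  have hne : ∀ᵐ x : Plane, x ≠ 0 := Measure.ae_ne volume 0
  refine tendsto_integral_filter_of_dominated_convergence
    (fun x => |Real.log ‖x‖ * laplacian φ x| + |‖x‖ ^ 2 * laplacian φ x|) ?_ ?_ ?_ ?_
  · filter_upwards [eventually_gt_atTop 0] with c hc
    exact ((contDiff_regLog (n := 0) (by positivity)).continuous.mul hΔ).aestronglyMeasurable
  · filter_upwards [eventually_ge_atTop 1] with c hc
    filter_upwards [hne] with x hx
    have hreg := abs_regLog_le (by positivity) (inv_le_one_of_one_le₀ (one_le_pow₀ (n := 2) hc)) hx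
    rw [Real.norm_eq_abs, abs_mul, abs_mul, abs_mul, ← add_mul, abs_of_nonneg (sq_nonneg ‖x‖)]
    exact mul_le_mul_of_nonneg_right hreg (abs_nonneg _)
  · refine Integrable.add (Integrable.abs ?_) (Integrable.abs ?_)
    · exact locallyIntegrable_log_norm.integrable_smul_right_of_hasCompactSupport hΔ hΔs
    · exact Continuous.integrable_of_hasCompactSupport (by fun_prop) hΔs.mul_left
  · filter_upwards [hne] with x hx using (tendsto_regLog hx).mul_const _

/-! ### The scalar potential -/

lemma MemLpLoc.integrableOn {F : Type*} [NormedAddCommGroup F] {f : Plane → F} {p : ℝ≥0∞}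
    (hf : MemLpLoc f p) (hp : 1 ≤ p) {K : Set Plane} (hK : IsCompact K) : IntegrableOn f K := by
  have : IsFiniteMeasure (volume.restrict K) := ⟨by simpa using hK.measure_lt_top⟩
  exact (hf K hK).integrable hp

lemma MemLpLoc.locallyIntegrable {F : Type*} [NormedAddCommGroup F] {f : Plane → F} {p : ℝ≥0∞}
    (hf : MemLpLoc f p) (hp : 1 ≤ p) : LocallyIntegrable f :=
  locallyIntegrable_iff.2 fun _ hK => hf.integrableOn hp hK

lemma continuous_log_two_add_norm : Continuous fun x : Plane => Real.log (2 + ‖x‖) :=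
  Continuous.log (by fun_prop) fun x => by positivity

lemma exists_log_mul_rpow_le {τ R : ℝ} (hτ : 2 < τ) (hR : 0 < R) :
    ∃ C, ∀ r, R ≤ r → Real.log (2 + r) * r ^ (-τ) ≤ C * (1 + r) ^ (-(1 + τ / 2)) := by
  have hδ : 0 < τ / 2 - 1 := by linarith
  refine ⟨(R / (2 + R)) ^ (-τ) / (τ / 2 - 1), fun r hr => ?_⟩
  have hr0 : 0 < r := hR.trans_le hr
  have hlog : Real.log (2 + r) ≤ (2 + r) ^ (τ / 2 - 1) / (τ / 2 - 1) :=
    Real.log_le_rpow_div (by positivity) hδ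
  have hlin : R / (2 + R) * (2 + r) ≤ r := by
    rw [div_mul_eq_mul_div, div_le_iff₀ (by positivity)]
    nlinarith
  have hpow : r ^ (-τ) ≤ (R / (2 + R)) ^ (-τ) * (2 + r) ^ (-τ) := by
    rw [← Real.mul_rpow (by positivity) (by positivity)]
    exact Real.rpow_le_rpow_of_nonpos (by positivity) hlin (by linarith)
  calc Real.log (2 + r) * r ^ (-τ)
      ≤ (2 + r) ^ (τ / 2 - 1) / (τ / 2 - 1) * ((R / (2 + R)) ^ (-τ) * (2 + r) ^ (-τ)) := by
        gcongr
    _ = (R / (2 + R)) ^ (-τ) / (τ / 2 - 1) * (2 + r) ^ (-(1 + τ / 2)) := by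
        rw [show -(1 + τ / 2) = τ / 2 - 1 + -τ by ring, Real.rpow_add (by positivity)]
        ring
    _ ≤ (R / (2 + R)) ^ (-τ) / (τ / 2 - 1) * (1 + r) ^ (-(1 + τ / 2)) := by
        gcongr _ * ?_
        exact Real.rpow_le_rpow_of_nonpos (by positivity) (by linarith) (by linarith)

lemma IsAdmissibleField.integrable_log_mul {B : Plane → ℝ} (hB : IsAdmissibleField B) :
    Integrable fun x => Real.log (2 + ‖x‖) * B x := by
  obtain ⟨p, hp, hBp⟩ := hB.memLpLoc
  obtain ⟨τ, hτ, C, R, hR, hdecay⟩ := hB.decay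
  obtain ⟨D, hD⟩ := exists_log_mul_rpow_le hτ hR
  have hloc : LocallyIntegrable B := hBp.locallyIntegrable (one_le_two.trans hp.le)
  have hK : IsCompact (Metric.closedBall (0 : Plane) R) := isCompact_closedBall _ _
  rw [← integrableOn_univ, ← Set.union_compl_self (Metric.closedBall (0 : Plane) R)]
  refine IntegrableOn.union ((hloc.integrableOn_isCompact hK).continuousOn_mul
    continuous_log_two_add_norm.continuousOn hK) ?_
  have hmajorant : Integrable fun x : Plane => |C| * (D * (1 + ‖x‖) ^ (-(1 + τ / 2))) := by
    refine ((integrable_one_add_norm ?_).const_mul D).const_mul |C|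
    simp only [finrank_euclideanSpace, Fintype.card_fin, Nat.cast_ofNat]
    linarith
  refine hmajorant.integrableOn.mono'
    (continuous_log_two_add_norm.aestronglyMeasurable.mul hloc.aestronglyMeasurable).restrict
    ((ae_restrict_iff' hK.measurableSet.compl).2 ?_)
  filter_upwards [hdecay] with x hx hxR
  have hxR : R ≤ ‖x‖ := by
    rw [mem_compl_iff, mem_closedBall_zero_iff, not_le] at hxR
    exact hxR.le
  have hlog : 0 ≤ Real.log (2 + ‖x‖) := Real.log_nonneg (by linarith [norm_nonneg x])
  rw [norm_mul, Real.norm_of_nonneg hlog, Real.norm_eq_abs]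
  calc Real.log (2 + ‖x‖) * |B x|
      ≤ Real.log (2 + ‖x‖) * (|C| * ‖x‖ ^ (-τ)) := by
        gcongr
        exact (hx hxR).trans (mul_le_mul_of_nonneg_right (le_abs_self C) (by positivity))
    _ = |C| * (Real.log (2 + ‖x‖) * ‖x‖ ^ (-τ)) := by ring
    _ ≤ |C| * (D * (1 + ‖x‖) ^ (-(1 + τ / 2))) :=
        mul_le_mul_of_nonneg_left (hD _ hxR) (abs_nonneg C)

lemma integrable_of_integrable_log_mul {f : Plane → ℝ}
    (hf : Integrable fun x => Real.log (2 + ‖x‖) * f x) : Integrable f := by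
  have hlog : ∀ x : Plane, Real.log 2 ≤ Real.log (2 + ‖x‖) := fun x =>
    Real.log_le_log two_pos (by linarith [norm_nonneg x])
  have hlog2 : 0 < Real.log 2 := Real.log_pos one_lt_two
  have hne : ∀ x : Plane, Real.log (2 + ‖x‖) ≠ 0 := fun x => (hlog2.trans_le (hlog x)).ne'
  refine (hf.bdd_mul (c := (Real.log 2)⁻¹)
    (continuous_log_two_add_norm.inv₀ hne).aestronglyMeasurable (ae_of_all _ fun x => ?_)).congr
    (ae_of_all _ fun x => inv_mul_cancel_left₀ (hne x) (f x))
  rw [Pi.inv_apply, norm_inv, Real.norm_of_nonneg (hlog2.le.trans (hlog x))]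
  exact inv_anti₀ hlog2 (hlog x)

lemma abs_log_norm_sub_le (x y : Plane) :
    |Real.log ‖x - y‖| ≤
      Real.posLog ‖x - y‖⁻¹ + (Real.log (2 + ‖x‖) + Real.log (2 + ‖y‖)) := by
  have h : Real.posLog ‖x - y‖ ≤ Real.log (2 + ‖x‖) + Real.log (2 + ‖y‖) := by
    rw [← Real.log_mul (by positivity) (by positivity), Real.posLog_def]
    refine max_le (Real.log_nonneg ?_) ?_
    · nlinarith [norm_nonneg x, norm_nonneg y]
    · rcases eq_or_ne x y with rfl | hxy
      · simp only [sub_self, norm_zero, Real.log_zero]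
        exact Real.log_nonneg (by nlinarith [norm_nonneg x])
      · refine Real.log_le_log (norm_pos_iff.2 (sub_ne_zero.2 hxy)) ?_
        nlinarith [norm_sub_le x y, norm_nonneg x, norm_nonneg y]
  rw [abs_log_eq_posLog_add]
  linarith

lemma integrable_mul_mul_log_norm_sub {f g : Plane → ℝ} {M : ℝ} (hM : ∀ x, |f x| ≤ M)
    (hf : Integrable fun x => Real.log (2 + ‖x‖) * f x)
    (hg : Integrable fun x => Real.log (2 + ‖x‖) * g x) :
    Integrable (fun p : Plane × Plane => f p.1 * (g p.2 * Real.log ‖p.1 - p.2‖))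
      (volume.prod volume) := by
  have hf' := integrable_of_integrable_log_mul hf
  have hg' := integrable_of_integrable_log_mul hg
  have hnear : Integrable (fun p : Plane × Plane => M * (g p.2 * Real.posLog ‖p.1 - p.2‖⁻¹))
      (volume.prod volume) :=
    (hg'.convolution_integrand (ContinuousLinearMap.mul ℝ ℝ) integrable_posLog_norm_inv).const_mul M
  refine ((hnear.norm.add (hf.mul_prod hg').norm).add (hf'.mul_prod hg).norm).mono' ?_
    (ae_of_all _ fun p => ?_)
  · exact hf'.aestronglyMeasurable.comp_fst.mul (hg'.aestronglyMeasurable.comp_snd.mul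
      (Real.measurable_log.comp (by fun_prop)).aestronglyMeasurable)
  · obtain ⟨x, y⟩ := p
    have hlog (z : Plane) : 0 ≤ Real.log (2 + ‖z‖) := Real.log_nonneg (by linarith [norm_nonneg z])
    simp only [Pi.add_apply, norm_mul, Real.norm_eq_abs, abs_of_nonneg (hlog _),
      abs_of_nonneg Real.posLog_nonneg, abs_of_nonneg ((abs_nonneg _).trans (hM 0))]
    calc |f x| * (|g y| * |Real.log ‖x - y‖|)
        ≤ |f x| * (|g y| *
            (Real.posLog ‖x - y‖⁻¹ + (Real.log (2 + ‖x‖) + Real.log (2 + ‖y‖)))) := by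
          gcongr
          exact abs_log_norm_sub_le x y
      _ = |f x| * (|g y| * Real.posLog ‖x - y‖⁻¹) + Real.log (2 + ‖x‖) * |f x| * |g y| +
            |f x| * (Real.log (2 + ‖y‖) * |g y|) := by ring
      _ ≤ _ := by
          gcongr
          · exact mul_nonneg (abs_nonneg _) Real.posLog_nonneg
          · exact hM x

lemma locallyIntegrable_scalarPotential {B : Plane → ℝ}
    (hB : Integrable fun x => Real.log (2 + ‖x‖) * B x) :
    LocallyIntegrable (scalarPotential B) := by
  refine locallyIntegrable_iff.2 fun K hK => ?_
  have hK' : Integrable fun x => Real.log (2 + ‖x‖) * K.indicator (fun _ => (1 : ℝ)) x := by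
    refine ((continuous_log_two_add_norm.continuousOn.integrableOn_compact hK).integrable_indicator
      hK.measurableSet).congr (ae_of_all _ fun x => ?_)
    by_cases hx : x ∈ K <;> simp [hx]
  have hprod := integrable_mul_mul_log_norm_sub (f := K.indicator fun _ => 1) (M := 1)
    (fun x => by by_cases hx : x ∈ K <;> simp [hx]) hK' hB
  rw [← integrable_indicator_iff hK.measurableSet]
  refine (hprod.integral_prod_left.const_mul (-(1 / (2 * Real.pi)))).congr
    (ae_of_all _ fun x => ?_)
  by_cases hx : x ∈ K <;> simp [hx, scalarPotential]

lemma partialDeriv_comp_add_right {F : Type*} [NormedAddCommGroup F] [NormedSpace ℝ F]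
    (f : Plane → F) (j : Fin 2) (y : Plane) :
    partialDeriv j (fun x => f (x + y)) = fun x => partialDeriv j f (x + y) := by
  funext x
  simp only [partialDeriv, fderiv_comp_add_right]

lemma laplacian_comp_add_right (f : Plane → ℝ) (y : Plane) :
    laplacian (fun x => f (x + y)) = fun x => laplacian f (x + y) := by
  funext x
  simp only [laplacian, partialDeriv_comp_add_right]

lemma integral_laplacian_mul_log_norm_sub {φ : Plane → ℝ} (hφ : IsTestFunction φ) (y : Plane) :
    ∫ x, laplacian φ x * Real.log ‖x - y‖ = 2 * Real.pi * φ y := by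
  have hφ' : IsTestFunction fun x => φ (x + y) :=
    ⟨hφ.1.comp (contDiff_id.add contDiff_const), hφ.2.comp_homeomorph (Homeomorph.addRight y)⟩
  have h := integral_log_norm_mul_laplacian hφ'
  rw [laplacian_comp_add_right, zero_add] at h
  rw [← h, ← integral_sub_right_eq_self (fun x => Real.log ‖x‖ * laplacian φ (x + y)) y]
  simp only [sub_add_cancel, mul_comm]

lemma integral_scalarPotential_mul_laplacian {B : Plane → ℝ}
    (hB : Integrable fun x => Real.log (2 + ‖x‖) * B x) {φ : Plane → ℝ} (hφ : IsTestFunction φ) :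
    ∫ x, scalarPotential B x * laplacian φ x = -∫ x, B x * φ x := by
  have hΔ : Continuous (laplacian φ) := continuous_laplacian (hφ.1.of_le ENat.LEInfty.out)
  have hΔs := hasCompactSupport_laplacian hφ.2
  obtain ⟨M, hM⟩ := hΔs.exists_bound_of_continuous hΔ
  have hΔi : Integrable fun x => Real.log (2 + ‖x‖) * laplacian φ x :=
    (continuous_log_two_add_norm.mul hΔ).integrable_of_hasCompactSupport hΔs.mul_left
  have hinner (y : Plane) : ∫ x, laplacian φ x * (B y * Real.log ‖x - y‖) =
      2 * Real.pi * (B y * φ y) := by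
    simp only [mul_left_comm _ (B y)]
    rw [integral_const_mul, integral_laplacian_mul_log_norm_sub hφ]
  calc ∫ x, scalarPotential B x * laplacian φ x
      = ∫ x, -(1 / (2 * Real.pi)) * ∫ y, laplacian φ x * (B y * Real.log ‖x - y‖) := by
        refine integral_congr_ae (ae_of_all _ fun x => ?_)
        simp only [scalarPotential, integral_const_mul]
        ring
    _ = -(1 / (2 * Real.pi)) * ∫ y, ∫ x, laplacian φ x * (B y * Real.log ‖x - y‖) := by
        rw [integral_const_mul, integral_integral_swap (integrable_mul_mul_log_norm_sub hM hΔi hB)]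
    _ = -∫ x, B x * φ x := by
        simp only [hinner, integral_const_mul]
        field_simp

/-! ### Mollification and gauge -/

/-- The convolution of `f` with the scalar kernel `η`. -/
def mollify {F : Type*} [NormedAddCommGroup F] [NormedSpace ℝ F] (η : Plane → ℝ) (f : Plane → F)
    (x : Plane) : F := ∫ t, η (x - t) • f t

section Mollify

variable {F : Type*} [NormedAddCommGroup F] [NormedSpace ℝ F] {η : Plane → ℝ} {f : Plane → F}

lemma mollify_eq_convolution (η : Plane → ℝ) (f : Plane → F) :
    mollify η f = convolution f η (ContinuousLinearMap.lsmul ℝ ℝ).flip volume := rfl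

lemma integrable_mollify (hη : IsTestFunction η) (hf : LocallyIntegrable f) (x : Plane) :
    Integrable fun t => η (x - t) • f t :=
  hη.2.convolutionExists_right (ContinuousLinearMap.lsmul ℝ ℝ).flip hf hη.continuous x

lemma contDiff_mollify (hη : IsTestFunction η) (hf : LocallyIntegrable f) :
    ContDiff ℝ ∞ (mollify η f) := by
  rw [mollify_eq_convolution]
  exact hη.2.contDiff_convolution_right _ hf hη.1

lemma partialDeriv_mollify (hη : IsTestFunction η) (hf : LocallyIntegrable f) (j : Fin 2) :
    partialDeriv j (mollify η f) = mollify (partialDeriv j η) f := by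
  funext x
  have hη1 : ContDiff ℝ 1 η := hη.1.of_le ENat.LEInfty.out
  have h := hη.2.hasFDerivAt_convolution_right (ContinuousLinearMap.lsmul ℝ ℝ).flip hf hη1 x
  rw [partialDeriv, mollify_eq_convolution, h.fderiv,
    convolution_precompR_apply _ hf (hη.2.fderiv ℝ) (hη1.continuous_fderiv one_ne_zero)]
  rfl

end Mollify

lemma laplacian_mollify {η f : Plane → ℝ} (hη : IsTestFunction η) (hf : LocallyIntegrable f) :
    laplacian (mollify η f) = mollify (laplacian η) f := by
  funext x
  have hη' (j : Fin 2) := hη.partialDeriv j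
  simp only [laplacian, partialDeriv_mollify hη hf, partialDeriv_mollify (hη' _) hf, mollify,
    add_smul]
  exact (integral_add (integrable_mollify ((hη' 0).partialDeriv 0) hf x)
    (integrable_mollify ((hη' 1).partialDeriv 1) hf x)).symm

lemma IsTestFunction.reflect {η : Plane → ℝ} (hη : IsTestFunction η) (x : Plane) :
    IsTestFunction fun t => η (x - t) :=
  ⟨hη.1.comp (contDiff_const.sub contDiff_id), hη.2.comp_homeomorph (Homeomorph.subLeft x)⟩

lemma partialDeriv_reflect (f : Plane → ℝ) (x : Plane) (j : Fin 2) :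
    partialDeriv j (fun t => f (x - t)) = fun t => -partialDeriv j f (x - t) := by
  funext t
  have h := fderiv_comp_smul (𝕜 := ℝ) (f := fun z : Plane => f (z + x)) (x := t) (-1)
  simp only [neg_smul, one_smul, neg_add_eq_sub, fderiv_comp_add_right] at h
  rw [partialDeriv, h]
  rfl

lemma partialDeriv_neg (f : Plane → ℝ) (j : Fin 2) :
    partialDeriv j (fun t => -f t) = fun t => -partialDeriv j f t := by
  funext t
  rw [partialDeriv, fderiv_fun_neg]
  rfl

lemma laplacian_reflect (f : Plane → ℝ) (x : Plane) :
    laplacian (fun t => f (x - t)) = fun t => laplacian f (x - t) := by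
  funext t
  simp only [laplacian, partialDeriv_reflect, partialDeriv_neg, neg_neg]

lemma laplacian_mollify_scalarPotential {B : Plane → ℝ}
    (hB : Integrable fun x => Real.log (2 + ‖x‖) * B x) {η : Plane → ℝ} (hη : IsTestFunction η)
    (x : Plane) : laplacian (mollify η (scalarPotential B)) x = -mollify η B x := by
  have h := integral_scalarPotential_mul_laplacian hB (hη.reflect x)
  rw [laplacian_reflect] at h
  simp only [laplacian_mollify hη (locallyIntegrable_scalarPotential hB), mollify, smul_eq_mul,
    mul_comm (laplacian η _), mul_comm (η _), h]

lemma MemLpLoc.locallyIntegrable_apply {A : Plane → Plane} {p : ℝ≥0∞} (hA : MemLpLoc A p)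
    (hp : 1 ≤ p) (j : Fin 2) : LocallyIntegrable fun x => A x j := by
  have h := hA.locallyIntegrable hp
  exact h.mono ((EuclideanSpace.proj j : Plane →L[ℝ] ℝ).continuous.comp_aestronglyMeasurable
    h.aestronglyMeasurable) (ae_of_all _ fun x => PiLp.norm_apply_le (A x) j)

lemma IsVectorPotential.locallyIntegrable {A : Plane → Plane} {B : Plane → ℝ}
    (hA : IsVectorPotential A B) (j : Fin 2) : LocallyIntegrable fun x => A x j :=
  hA.memLpLoc.locallyIntegrable_apply one_le_two j

lemma IsVectorPotential.curl_mollify {A : Plane → Plane} {B : Plane → ℝ}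
    (hA : IsVectorPotential A B) {η : Plane → ℝ} (hη : IsTestFunction η) (x : Plane) :
    partialDeriv 0 (mollify η fun t => A t 1) x - partialDeriv 1 (mollify η fun t => A t 0) x =
      mollify η B x := by
  have h := hA.curl_eq _ (hη.reflect x)
  simp only [partialDeriv_reflect] at h
  rw [partialDeriv_mollify hη (hA.locallyIntegrable 1),
    partialDeriv_mollify hη (hA.locallyIntegrable 0), mollify, mollify,
    ← integral_sub (integrable_mollify (hη.partialDeriv 0) (hA.locallyIntegrable 1) x)
      (integrable_mollify (hη.partialDeriv 1) (hA.locallyIntegrable 0) x), mollify]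
  simp only [smul_eq_mul, mul_comm (η _)]
  rw [← h]
  congr 1
  funext t
  ring

lemma exists_potential {a : Fin 2 → Plane → ℝ} (ha : ∀ j, ContDiff ℝ 1 (a j))
    (hcurl : ∀ x, partialDeriv 0 (a 1) x = partialDeriv 1 (a 0) x) :
    ∃ χ : Plane → ℝ, ContDiff ℝ 1 χ ∧ ∀ j x, partialDeriv j χ x = a j x := by
  let P (j : Fin 2) : Plane →L[ℝ] ℝ := EuclideanSpace.proj j
  let θ (x : Plane) : Plane →L[ℝ] ℝ := a 0 x • P 0 + a 1 x • P 1
  have hθ (x : Plane) : HasFDerivAt θ ((fderiv ℝ (a 0) x).smulRight (P 0) +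
      (fderiv ℝ (a 1) x).smulRight (P 1)) x :=
    (((ha 0).differentiable one_ne_zero x).hasFDerivAt.smul_const (P 0)).add
      (((ha 1).differentiable one_ne_zero x).hasFDerivAt.smul_const (P 1))
  have hsymm (x v w : Plane) : fderiv ℝ θ x v w = fderiv ℝ θ x w v := by
    have hP (j : Fin 2) (v : Plane) : P j v = v j := rfl
    rw [(hθ x).fderiv]
    simp only [add_apply, ContinuousLinearMap.smulRight_apply, smul_apply, smul_eq_mul,
      fderiv_apply_eq_partialDeriv _ x, hcurl x, hP]
    ring
  obtain ⟨χ, hχ⟩ := (convex_univ (𝕜 := ℝ)).exists_forall_hasFDerivAt_of_fderiv_symmetric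
    isOpen_univ (fun x _ => (hθ x).differentiableAt.differentiableWithinAt) fun x _ => hsymm x
  have hfderiv : fderiv ℝ χ = θ := funext fun x => (hχ x trivial).fderiv
  refine ⟨χ, contDiff_one_iff_fderiv.2 ⟨fun x => (hχ x trivial).differentiableAt, ?_⟩,
    fun j x => ?_⟩
  · rw [hfderiv]
    exact ((ha 0).continuous.smul continuous_const).add ((ha 1).continuous.smul continuous_const)
  · rw [partialDeriv, hfderiv]
    fin_cases j <;> simp [θ, P]

lemma exists_gauge {a : Fin 2 → Plane → ℝ} {h : Plane → ℝ} (ha : ∀ j, ContDiff ℝ 1 (a j))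
    (hh : ContDiff ℝ 2 h)
    (hcurl : ∀ x, partialDeriv 0 (a 1) x - partialDeriv 1 (a 0) x = -laplacian h x) :
    ∃ χ : Plane → ℝ, ContDiff ℝ 1 χ ∧
      (∀ x, a 0 x = partialDeriv 0 χ x + partialDeriv 1 h x) ∧
      ∀ x, a 1 x = partialDeriv 1 χ x - partialDeriv 0 h x := by
  have hh' (j : Fin 2) : ContDiff ℝ 1 (partialDeriv j h) := contDiff_partialDeriv hh j
  have hd {f : Plane → ℝ} (hf : ContDiff ℝ 1 f) (x : Plane) : DifferentiableAt ℝ f x :=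
    hf.differentiable one_ne_zero x
  obtain ⟨χ, hχ, hdχ⟩ := exists_potential
    (a := ![fun x => a 0 x - partialDeriv 1 h x, fun x => a 1 x + partialDeriv 0 h x])
    (Fin.forall_fin_two.2 ⟨(ha 0).sub (hh' 1), (ha 1).add (hh' 0)⟩) fun x => by
      have h0 : partialDeriv 0 (fun x => a 1 x + partialDeriv 0 h x) x =
          partialDeriv 0 (a 1) x + partialDeriv 0 (partialDeriv 0 h) x := by
        rw [partialDeriv, fderiv_fun_add (hd (ha 1) x) (hd (hh' 0) x)]
        rfl
      have h1 : partialDeriv 1 (fun x => a 0 x - partialDeriv 1 h x) x =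
          partialDeriv 1 (a 0) x - partialDeriv 1 (partialDeriv 1 h) x := by
        rw [partialDeriv, fderiv_fun_sub (hd (ha 0) x) (hd (hh' 1) x)]
        rfl
      have hx := hcurl x
      simp only [Matrix.cons_val_zero, Matrix.cons_val_one]
      rw [h0, h1]
      rw [laplacian] at hx
      linarith
  exact ⟨χ, hχ, fun x => by simp [hdχ 0 x], fun x => by simp [hdχ 1 x]⟩

lemma contDiff_cexp_mul {χ h : Plane → ℝ} {u : Plane → ℂ} {n : WithTop ℕ∞} (hχ : ContDiff ℝ n χ)
    (hh : ContDiff ℝ n h) (hu : ContDiff ℝ n u) (s : ℤ) :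
    ContDiff ℝ n fun x => Complex.exp (-(Complex.I * χ x + s * h x)) * u x :=
  ((contDiff_const.mul (Complex.ofRealCLM.contDiff.comp hχ)).add
    (contDiff_const.mul (Complex.ofRealCLM.contDiff.comp hh))).neg.cexp.mul hu

lemma partialDeriv_cexp_mul {χ h : Plane → ℝ} {u : Plane → ℂ} (hχ : ContDiff ℝ 1 χ)
    (hh : ContDiff ℝ 1 h) (hu : ContDiff ℝ 1 u) (s : ℤ) (j : Fin 2) (x : Plane) :
    partialDeriv j (fun x => Complex.exp (-(Complex.I * χ x + s * h x)) * u x) x =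
      Complex.exp (-(Complex.I * χ x + s * h x)) * (partialDeriv j u x -
        (Complex.I * partialDeriv j χ x + s * partialDeriv j h x) * u x) := by
  have hχ' : HasFDerivAt (fun x => (χ x : ℂ)) _ x :=
    Complex.ofRealCLM.hasFDerivAt.comp x (hχ.differentiable one_ne_zero x).hasFDerivAt
  have hh' : HasFDerivAt (fun x => (h x : ℂ)) _ x :=
    Complex.ofRealCLM.hasFDerivAt.comp x (hh.differentiable one_ne_zero x).hasFDerivAt
  have hprod : HasFDerivAt (fun x => Complex.exp (-(Complex.I * χ x + s * h x)) * u x) _ x :=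
    (((hχ'.const_mul Complex.I).add (hh'.const_mul (s : ℂ))).fun_neg.cexp).mul
      (hu.differentiable one_ne_zero x).hasFDerivAt
  rw [partialDeriv, hprod.fderiv]
  simp [partialDeriv]
  ring

/-- The substitution `v = e^{-(iχ + sh)} u` removes the potential from the Pauli operator. -/
lemma dbar_cexp_mul {χ h : Plane → ℝ} {u : Plane → ℂ} (hχ : ContDiff ℝ 1 χ)
    (hh : ContDiff ℝ 1 h) (hu : ContDiff ℝ 1 u) {s : ℤ} (hs : s = 1 ∨ s = -1) (x : Plane) :
    dbar s (fun x => Complex.exp (-(Complex.I * χ x + s * h x)) * u x) x =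
      Complex.exp (-(Complex.I * χ x + s * h x)) * (-Complex.I * (Complex.I * dbar s u x +
        (((partialDeriv 0 χ x + partialDeriv 1 h x : ℝ) : ℂ) +
          Complex.I * s * (partialDeriv 1 χ x - partialDeriv 0 h x : ℝ)) * u x)) := by
  have hs2 : (s : ℂ) ^ 2 = 1 := by rcases hs with rfl | rfl <;> norm_num
  rw [dbar, dbar, partialDeriv_cexp_mul hχ hh hu, partialDeriv_cexp_mul hχ hh hu]
  push_cast
  linear_combination Complex.exp (-(Complex.I * χ x + s * h x)) *
    ((partialDeriv 0 u x + Complex.I * s * partialDeriv 1 u x -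
      s * u x * (partialDeriv 0 h x : ℝ)) * Complex.I_sq -
        Complex.I * (partialDeriv 1 h x : ℝ) * u x * hs2)

lemma norm_cexp_mul_exp (s : ℤ) (a b : ℝ) :
    Real.exp (s * b) * ‖Complex.exp (-(Complex.I * a + s * b))‖ = 1 := by
  rw [Complex.norm_exp, ← Real.exp_add]
  simp

lemma ofReal_mul_lintegral_ofReal {X : Type*} [MeasurableSpace X] {μ : Measure X} {c : ℝ}
    (hc : 0 ≤ c) (f : X → ℝ) :
    ENNReal.ofReal c * ∫⁻ x, ENNReal.ofReal (f x) ∂μ = ∫⁻ x, ENNReal.ofReal (c * f x) ∂μ := by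
  simp only [← lintegral_const_mul' _ _ ENNReal.ofReal_ne_top, ← ENNReal.ofReal_mul hc]

lemma lintegral_radialWeight_le_gauge {α ρ : ℝ} (hα : α ≠ 0) (hρ : 0 < ρ) {s : ℤ}
    (hs : s = 1 ∨ s = -1) {χ h : Plane → ℝ} (hχ : ContDiff ℝ 1 χ) (hh : ContDiff ℝ 1 h) {k K : ℝ}
    (hk : 0 < k) (hK : 0 < K) (hlow : ∀ x, k * growth |α| ρ ‖x‖ ≤ Real.exp (s * h x))
    (hupp : ∀ x, Real.exp (s * h x) ≤ K * growth |α| ρ ‖x‖) {u : Plane → ℂ}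
    (hu : ContDiff ℝ 1 u) (hsupp : HasCompactSupport u) :
    ENNReal.ofReal ((k / K) ^ 2) * ∫⁻ x, ENNReal.ofReal (radialWeight α ρ ‖x‖ * ‖u x‖ ^ 2) ≤
      ∫⁻ x, ENNReal.ofReal (‖Complex.I * dbar s u x +
        (((partialDeriv 0 χ x + partialDeriv 1 h x : ℝ) : ℂ) +
          Complex.I * s * (partialDeriv 1 χ x - partialDeriv 0 h x : ℝ)) * u x‖ ^ 2) := by
  set v : Plane → ℂ := fun x => Complex.exp (-(Complex.I * χ x + s * h x)) * u x with hv
  have hu_norm (x : Plane) : ‖u x‖ = Real.exp (s * h x) * ‖v x‖ := by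
    rw [hv, norm_mul, ← mul_assoc, norm_cexp_mul_exp, one_mul]
  have hdbar_norm (x : Plane) : ‖Complex.I * dbar s u x +
        (((partialDeriv 0 χ x + partialDeriv 1 h x : ℝ) : ℂ) +
          Complex.I * s * (partialDeriv 1 χ x - partialDeriv 0 h x : ℝ)) * u x‖ =
      Real.exp (s * h x) * ‖dbar s v x‖ := by
    rw [hv, dbar_cexp_mul hχ hh hu hs, norm_mul, ← mul_assoc, norm_cexp_mul_exp, one_mul, norm_mul,
      norm_neg, Complex.norm_I, one_mul]
  have hW := radialWeight_nonneg α ρ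
  have hg (x : Plane) := growth_pos |α| ρ ‖x‖
  have hv_hardy := lintegral_radialWeight_le_dbar hα hρ hs (contDiff_cexp_mul hχ hh hu s)
    (hsupp.mul_left (f := fun x => Complex.exp (-(Complex.I * χ x + s * h x))))
  rw [ofReal_mul_lintegral_ofReal (sq_nonneg _)]
  calc ∫⁻ x, ENNReal.ofReal ((k / K) ^ 2 * (radialWeight α ρ ‖x‖ * ‖u x‖ ^ 2))
      ≤ ∫⁻ x, ENNReal.ofReal (k ^ 2 *
          (radialWeight α ρ ‖x‖ * growth |α| ρ ‖x‖ ^ 2 * ‖v x‖ ^ 2)) := by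
        refine lintegral_mono fun x => ENNReal.ofReal_le_ofReal ?_
        calc (k / K) ^ 2 * (radialWeight α ρ ‖x‖ * ‖u x‖ ^ 2)
            ≤ (k / K) ^ 2 * (radialWeight α ρ ‖x‖ * (K * growth |α| ρ ‖x‖ * ‖v x‖) ^ 2) := by
              rw [hu_norm]
              gcongr
              exacts [hW _, hupp x]
          _ = _ := by field_simp
    _ ≤ ∫⁻ x, ENNReal.ofReal (k ^ 2 * (growth |α| ρ ‖x‖ ^ 2 * ‖dbar s v x‖ ^ 2)) := by
        simp only [← ofReal_mul_lintegral_ofReal (sq_nonneg k)]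
        gcongr
    _ ≤ _ := by
        refine lintegral_mono fun x => ENNReal.ofReal_le_ofReal ?_
        rw [hdbar_norm, ← mul_pow, ← mul_pow, ← mul_assoc]
        have := (hg x).le
        gcongr
        exact hlow x

/-- The complexified combination `A₁ + i s A₂` of the components of a vector potential. -/
def complexPotential (s : ℤ) (A : Plane → Plane) (x : Plane) : ℂ :=
  (A x 0 : ℂ) + Complex.I * s * (A x 1 : ℂ)

lemma mollify_complexPotential {A : Plane → Plane} {η : Plane → ℝ} (hη : IsTestFunction η)
    (hA : ∀ j, LocallyIntegrable fun x => A x j) (s : ℤ) (x : Plane) :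
    mollify η (complexPotential s A) x = ((mollify η (fun t => A t 0) x : ℝ) : ℂ) +
      Complex.I * s * (mollify η (fun t => A t 1) x : ℝ) := by
  simp only [mollify]
  rw [← integral_complex_ofReal, ← integral_complex_ofReal, ← integral_const_mul, ← integral_add
    (integrable_mollify hη (hA 0) x).ofReal
    ((integrable_mollify hη (hA 1) x).ofReal.const_mul _)]
  congr 1
  funext t
  simp only [complexPotential, Complex.real_smul, smul_eq_mul]
  push_cast
  ring

lemma lintegral_radialWeight_le_mollify {B : Plane → ℝ}
    (hB : Integrable fun x => Real.log (2 + ‖x‖) * B x) {A : Plane → Plane}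
    (hA : IsVectorPotential A B) {α ρ : ℝ} (hα : α ≠ 0) (hρ : 0 < ρ) {s : ℤ} (hs : s = 1 ∨ s = -1)
    {η : Plane → ℝ} (hη : IsTestFunction η) {k K : ℝ} (hk : 0 < k) (hK : 0 < K)
    (hlow : ∀ x, k * growth |α| ρ ‖x‖ ≤ Real.exp (s * mollify η (scalarPotential B) x))
    (hupp : ∀ x, Real.exp (s * mollify η (scalarPotential B) x) ≤ K * growth |α| ρ ‖x‖)
    {u : Plane → ℂ} (hu : ContDiff ℝ 1 u) (hsupp : HasCompactSupport u) :
    ENNReal.ofReal ((k / K) ^ 2) * ∫⁻ x, ENNReal.ofReal (radialWeight α ρ ‖x‖ * ‖u x‖ ^ 2) ≤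
      ∫⁻ x, ENNReal.ofReal (‖Complex.I * dbar s u x +
        mollify η (complexPotential s A) x * u x‖ ^ 2) := by
  have hh : ContDiff ℝ 2 (mollify η (scalarPotential B)) :=
    (contDiff_mollify hη (locallyIntegrable_scalarPotential hB)).of_le ENat.LEInfty.out
  obtain ⟨χ, hχ, hχ0, hχ1⟩ := exists_gauge (a := fun j => mollify η fun t => A t j)
    (fun j => (contDiff_mollify hη (hA.locallyIntegrable j)).of_le ENat.LEInfty.out) hh fun x => by
      rw [hA.curl_mollify hη, laplacian_mollify_scalarPotential hB hη, neg_neg]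
  simp only [mollify_complexPotential hη hA.locallyIntegrable, hχ0, hχ1]
  exact lintegral_radialWeight_le_gauge hα hρ hs hχ (hh.of_le one_le_two) hk hK hlow hupp hu hsupp

/-! ### Approximation by mollification -/

lemma ofReal_norm_sq {E : Type*} [SeminormedAddCommGroup E] (z : E) :
    ENNReal.ofReal (‖z‖ ^ 2) = ‖z‖ₑ ^ 2 := by
  rw [ENNReal.ofReal_pow (norm_nonneg _), ofReal_norm]

lemma eLpNorm_two_sq {X E : Type*} [MeasurableSpace X] [NormedAddCommGroup E] (f : X → E)
    (μ : Measure X) : eLpNorm f 2 μ ^ 2 = ∫⁻ x, ‖f x‖ₑ ^ 2 ∂μ := by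
  have h := eLpNorm_nnreal_pow_eq_lintegral (f := f) (μ := μ) (p := 2) two_ne_zero
  norm_num at h
  exact_mod_cast h

/-- A smooth probability density supported in the ball of radius `ε` about the origin, used to
regularize by convolution. -/
structure IsMollifier (η : Plane → ℝ) (ε : ℝ) : Prop where
  test : IsTestFunction η
  nonneg : ∀ x, 0 ≤ η x
  integral_eq : ∫ x, η x = 1
  eq_zero : ∀ x, ε ≤ ‖x‖ → η x = 0

lemma exists_isMollifier {ε : ℝ} (hε : 0 < ε) : ∃ η, IsMollifier η ε := by
  let b : ContDiffBump (0 : Plane) := ⟨ε / 2, ε, by positivity, by linarith⟩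
  refine ⟨b.normed volume, ⟨b.contDiff_normed, b.hasCompactSupport_normed⟩, b.nonneg_normed,
    b.integral_normed, fun x hx => Function.notMem_support.1 ?_⟩
  rwa [b.support_normed_eq, mem_ball_zero_iff, not_lt]

namespace IsMollifier

variable {η : Plane → ℝ} {ε : ℝ}

lemma integrable (h : IsMollifier η ε) : Integrable η :=
  h.test.continuous.integrable_of_hasCompactSupport h.test.2

lemma integral_reflect (h : IsMollifier η ε) (x : Plane) : ∫ t, η (x - t) = 1 := by
  rw [integral_sub_left_eq_self, h.integral_eq]

lemma lintegral_eq (h : IsMollifier η ε) : ∫⁻ x, ENNReal.ofReal (η x) = 1 := by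
  rw [← ofReal_integral_eq_lintegral_ofReal h.integrable (ae_of_all _ h.nonneg), h.integral_eq,
    ENNReal.ofReal_one]

lemma mollify_le (h : IsMollifier η ε) {f g : Plane → ℝ} (hf : LocallyIntegrable f) {C : ℝ≥0}
    (hg : LipschitzWith C g) (hfg : ∀ x, f x ≤ g x) (x : Plane) :
    mollify η f x ≤ g x + C * ε := by
  have hη : Integrable fun t => η (x - t) := h.integrable.comp_sub_left x
  calc mollify η f x ≤ ∫ t, η (x - t) * (g x + C * ε) := by
        refine integral_mono (integrable_mollify h.test hf x) (hη.mul_const _) fun t => ?_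
        rcases le_or_gt ε ‖x - t‖ with ht | ht
        · simp [h.eq_zero _ ht]
        · refine mul_le_mul_of_nonneg_left ?_ (h.nonneg _)
          have hlip := hg.dist_le_mul t x
          rw [Real.dist_eq, dist_comm, dist_eq_norm] at hlip
          have : C * ‖x - t‖ ≤ C * ε := by gcongr
          linarith [hfg t, le_abs_self (g t - g x)]
    _ = g x + C * ε := by rw [integral_mul_const, h.integral_reflect, one_mul]

end IsMollifier

lemma log_growth (a ρ r : ℝ) : Real.log (growth a ρ r) = a * Real.log (max 1 (r / ρ)) := by
  rw [growth, Real.log_rpow (one_pos.trans_le (le_max_left _ _))]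

lemma growth_neg (a ρ r : ℝ) : growth (-a) ρ r = (growth a ρ r)⁻¹ :=
  Real.rpow_neg (zero_le_one.trans (le_max_left _ _)) a

lemma abs_log_max_one_sub_le (s t : ℝ) :
    |Real.log (max 1 s) - Real.log (max 1 t)| ≤ |s - t| := by
  wlog hst : t ≤ s generalizing s t
  · rw [abs_sub_comm, abs_sub_comm s]
    exact this t s (le_of_not_ge hst)
  have ht : (1 : ℝ) ≤ max 1 t := le_max_left _ _
  have hmax : max 1 t ≤ max 1 s := max_le_max_left 1 hst
  rw [abs_of_nonneg (sub_nonneg.2 (Real.log_le_log (by positivity) hmax)),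
    ← Real.log_div (by positivity) (by positivity)]
  calc Real.log (max 1 s / max 1 t) ≤ max 1 s / max 1 t - 1 :=
        Real.log_le_sub_one_of_pos (by positivity)
    _ = (max 1 s - max 1 t) / max 1 t := by rw [sub_div, div_self (by positivity)]
    _ ≤ max 1 s - max 1 t := div_le_self (sub_nonneg.2 hmax) ht
    _ ≤ |s - t| := by
        simpa only [max_comm (1 : ℝ)] using (le_abs_self _).trans (abs_max_sub_max_le_abs s t 1)

lemma lipschitzWith_log_growth_norm (a : ℝ) {ρ : ℝ} (hρ : 0 < ρ) :
    LipschitzWith (Real.toNNReal (|a| / ρ)) fun x : Plane => Real.log (growth a ρ ‖x‖) := by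
  refine LipschitzWith.of_dist_le' fun x y => ?_
  rw [Real.dist_eq, log_growth, log_growth, ← mul_sub, abs_mul, dist_eq_norm, div_mul_eq_mul_div,
    mul_div_assoc]
  gcongr
  refine (abs_log_max_one_sub_le _ _).trans ?_
  rw [← sub_div, abs_div, abs_of_pos hρ]
  gcongr
  exact abs_norm_sub_norm_le x y

namespace IsMollifier

variable {η : Plane → ℝ} {ε : ℝ}

lemma exp_mollify_le (h : IsMollifier η ε) {f : Plane → ℝ} (hf : LocallyIntegrable f)
    {a ρ K c : ℝ} (hρ : 0 < ρ) (hK : 0 < K)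
    (hupp : ∀ x, Real.exp (c * f x) ≤ K * growth a ρ ‖x‖) (x : Plane) :
    Real.exp (c * mollify η f x) ≤ K * Real.exp (|a| / ρ * ε) * growth a ρ ‖x‖ := by
  have hle : c * mollify η f x ≤ Real.log K + Real.log (growth a ρ ‖x‖) + |a| / ρ * ε := by
    have hmul : c * mollify η f x = mollify η (fun t => c * f t) x := by
      simp only [mollify, smul_eq_mul, ← integral_const_mul, mul_left_comm c]
    have hbound := h.mollify_le (hf.smul c)
      ((LipschitzWith.const (Real.log K)).add (lipschitzWith_log_growth_norm a hρ)) (fun x => by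
        rw [← Real.log_mul hK.ne' (growth_pos _ _ _).ne']
        exact (Real.le_log_iff_exp_le (mul_pos hK (growth_pos _ _ _))).2 (hupp x)) x
    rw [zero_add, Real.coe_toNNReal _ (by positivity)] at hbound
    exact hmul.trans_le hbound
  calc Real.exp (c * mollify η f x)
      ≤ Real.exp (Real.log K + Real.log (growth a ρ ‖x‖) + |a| / ρ * ε) := Real.exp_le_exp.2 hle
    _ = _ := by
      rw [Real.exp_add, Real.exp_add, Real.exp_log hK, Real.exp_log (growth_pos _ _ _)]
      ring

lemma le_exp_mollify (h : IsMollifier η ε) {f : Plane → ℝ} (hf : LocallyIntegrable f)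
    {a ρ k c : ℝ} (hρ : 0 < ρ) (hk : 0 < k)
    (hlow : ∀ x, k * growth a ρ ‖x‖ ≤ Real.exp (c * f x)) (x : Plane) :
    k * Real.exp (-(|a| / ρ * ε)) * growth a ρ ‖x‖ ≤ Real.exp (c * mollify η f x) := by
  have hg (x : Plane) := growth_pos a ρ ‖x‖
  have hinv := h.exp_mollify_le (a := -a) (K := k⁻¹) (c := -c) hf hρ (by positivity) (fun x => by
    rw [neg_mul, Real.exp_neg, growth_neg, ← mul_inv]
    exact inv_anti₀ (mul_pos hk (hg x)) (hlow x)) x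
  rw [neg_mul, Real.exp_neg, growth_neg, abs_neg] at hinv
  refine (inv_le_inv₀ (Real.exp_pos _) (mul_pos (by positivity) (hg x))).1 (hinv.trans_eq ?_)
  rw [Real.exp_neg, mul_inv, mul_inv, inv_inv]

end IsMollifier

section LTwo

variable {F : Type*} [NormedAddCommGroup F] [NormedSpace ℝ F] {f : Plane → F} {η : Plane → ℝ}
  {ε : ℝ}

lemma IsMollifier.enorm_integral_smul_sq_le (h : IsMollifier η ε)
    (hf : AEStronglyMeasurable f) :
    ‖∫ y, η y • f y‖ₑ ^ 2 ≤ ∫⁻ y, ENNReal.ofReal (η y) * ‖f y‖ₑ ^ 2 := by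
  have hη : AEMeasurable fun y => ENNReal.ofReal (η y) :=
    h.test.continuous.aemeasurable.ennreal_ofReal
  set μ : Measure Plane := volume.withDensity fun y => ENNReal.ofReal (η y)
  have hμ : IsProbabilityMeasure μ :=
    ⟨by rw [withDensity_apply _ .univ, setLIntegral_univ, h.lintegral_eq]⟩
  calc ‖∫ y, η y • f y‖ₑ ^ 2 ≤ (∫⁻ y, ‖η y • f y‖ₑ) ^ 2 := by
        gcongr
        exact enorm_integral_le_lintegral_enorm _
    _ = eLpNorm f 1 μ ^ 2 := by
        rw [eLpNorm_one_eq_lintegral_enorm, lintegral_withDensity_eq_lintegral_mul₀ hη hf.enorm]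
        simp only [enorm_smul, Real.enorm_eq_ofReal (h.nonneg _), Pi.mul_apply]
    _ ≤ eLpNorm f 2 μ ^ 2 := by
        gcongr
        exact eLpNorm_le_eLpNorm_of_exponent_le one_le_two
          (hf.mono_ac (withDensity_absolutelyContinuous _ _))
    _ = _ := by
        rw [eLpNorm_two_sq, lintegral_withDensity_eq_lintegral_mul₀ hη (hf.enorm.pow_const 2)]
        rfl

lemma IsMollifier.mollify_sub_eq [CompleteSpace F] (h : IsMollifier η ε)
    (hf : LocallyIntegrable f) (x : Plane) :
    mollify η f x - f x = ∫ y, η y • (f (x - y) - f x) := by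
  have hint : Integrable fun y => η y • f (x - y) := by
    simpa using (integrable_mollify h.test hf x).comp_sub_left x
  simp only [smul_sub]
  rw [integral_sub hint (h.integrable.smul_const _), integral_smul_const, h.integral_eq, one_smul,
    mollify, ← integral_sub_left_eq_self (fun y => η y • f (x - y)) volume x]
  simp only [sub_sub_cancel]

lemma IsMollifier.eLpNorm_mollify_sub_le [CompleteSpace F] (h : IsMollifier η ε)
    (hf : LocallyIntegrable f) {δ : ℝ≥0∞}
    (hδ : ∀ y, ‖y‖ < ε → eLpNorm (fun x => f (x - y) - f x) 2 volume ≤ δ) :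
    eLpNorm (mollify η f - f) 2 volume ≤ δ := by
  have hm : AEStronglyMeasurable fun p : Plane × Plane => f (p.1 - p.2) - f p.1 :=
    (hf.aestronglyMeasurable.comp_quasiMeasurePreserving
      (quasiMeasurePreserving_sub_of_right_invariant volume volume)).sub
      hf.aestronglyMeasurable.comp_fst
  have hmx (x : Plane) : AEStronglyMeasurable fun y => f (x - y) - f x :=
    (hf.aestronglyMeasurable.comp_quasiMeasurePreserving
      (quasiMeasurePreserving_sub_left_of_right_invariant volume x)).sub
      aestronglyMeasurable_const
  have hη : Measurable fun y => ENNReal.ofReal (η y) := h.test.continuous.measurable.ennreal_ofReal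
  refine (ENNReal.pow_le_pow_left_iff two_ne_zero).1 ?_
  calc eLpNorm (mollify η f - f) 2 volume ^ 2
      = ∫⁻ x, ‖∫ y, η y • (f (x - y) - f x)‖ₑ ^ 2 := by
        simp only [eLpNorm_two_sq, Pi.sub_apply, h.mollify_sub_eq hf]
    _ ≤ ∫⁻ x, ∫⁻ y, ENNReal.ofReal (η y) * ‖f (x - y) - f x‖ₑ ^ 2 :=
        lintegral_mono fun x => h.enorm_integral_smul_sq_le (hmx x)
    _ = ∫⁻ y, ENNReal.ofReal (η y) * ∫⁻ x, ‖f (x - y) - f x‖ₑ ^ 2 := by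
        rw [lintegral_lintegral_swap
          ((hη.comp measurable_snd).aemeasurable.mul (hm.enorm.pow_const 2))]
        simp only [lintegral_const_mul' _ _ ENNReal.ofReal_ne_top]
    _ ≤ ∫⁻ y, ENNReal.ofReal (η y) * δ ^ 2 := by
        refine lintegral_mono fun y => ?_
        rcases le_or_gt ε ‖y‖ with hy | hy
        · simp [h.eq_zero y hy]
        · rw [← eLpNorm_two_sq]
          gcongr
          exact hδ y hy
    _ = δ ^ 2 := by rw [lintegral_mul_const _ hη, h.lintegral_eq, one_mul]

lemma tendsto_eLpNorm_translate_sub {F : Type*} [NormedAddCommGroup F] {f : Plane → F}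
    (hf : MemLp f 2 volume) :
    Tendsto (fun y => eLpNorm (fun x => f (x - y) - f x) 2 volume) (𝓝 0) (𝓝 0) := by
  let g : C(Plane, C(Plane, Plane)) :=
    (ContinuousMap.mk (fun a : Plane × Plane => a.2 - a.1) (by fun_prop)).curry
  have hg (y : Plane) : MeasurePreserving (g y) volume volume :=
    measurePreserving_sub_right volume y
  have h := (tendsto_const_nhds (x := hf.toLp f) (f := 𝓝 (0 : Plane))).compMeasurePreservingLp
    (g.continuous.tendsto 0) hg (hg 0) (by simp)
  rw [Lp.tendsto_Lp_iff_tendsto_eLpNorm'] at h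
  have hcomp (y : Plane) :
      Lp.compMeasurePreserving (g y) (hg y) (hf.toLp f) =ᵐ[volume] fun x => f (x - y) :=
    (Lp.coeFn_compMeasurePreserving (hf.toLp f) (hg y)).trans
      ((hg y).quasiMeasurePreserving.ae_eq_comp hf.coeFn_toLp)
  refine h.congr fun y => eLpNorm_congr_ae ?_
  filter_upwards [hcomp y, hcomp 0] with x hy h0
  rw [Pi.sub_apply, hy, h0, sub_zero]

variable {ηs : ℕ → Plane → ℝ} {εs : ℕ → ℝ}

lemma tendsto_eLpNorm_mollify_sub [CompleteSpace F] (hf : MemLp f 2 volume)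
    (hη : ∀ n, IsMollifier (ηs n) (εs n)) (hε : Tendsto εs atTop (𝓝 0)) :
    Tendsto (fun n => eLpNorm (mollify (ηs n) f - f) 2 volume) atTop (𝓝 0) := by
  refine ENNReal.tendsto_nhds_zero.2 fun δ hδ => ?_
  obtain ⟨r, hr, hball⟩ := Metric.eventually_nhds_iff.1
    (ENNReal.tendsto_nhds_zero.1 (tendsto_eLpNorm_translate_sub hf) δ hδ)
  filter_upwards [hε.eventually (gt_mem_nhds hr)] with n hn
  exact (hη n).eLpNorm_mollify_sub_le (hf.locallyIntegrable one_le_two) fun y hy =>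
    hball (by rw [dist_zero_right]; exact hy.trans hn)

lemma IsMollifier.mollify_indicator_closedBall (h : IsMollifier η ε) (f : Plane → F) {R : ℝ}
    {x : Plane} (hx : ‖x‖ + ε ≤ R) :
    mollify η ((Metric.closedBall 0 R).indicator f) x = mollify η f x := by
  refine integral_congr_ae (ae_of_all _ fun t => ?_)
  rcases le_or_gt ε ‖x - t‖ with ht | ht
  · simp [h.eq_zero _ ht]
  · have htR : t ∈ Metric.closedBall (0 : Plane) R := by
      rw [mem_closedBall_zero_iff]
      linarith [norm_le_norm_add_norm_sub x t]
    simp only [indicator_of_mem htR]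

lemma tendsto_eLpNorm_mollify_sub_mul {f c : Plane → ℂ} (hf : MemLpLoc f 2) (hc : Continuous c)
    (hcs : HasCompactSupport c) (hη : ∀ n, IsMollifier (ηs n) (εs n))
    (hε : Tendsto εs atTop (𝓝 0)) :
    Tendsto (fun n => eLpNorm (fun x => (mollify (ηs n) f x - f x) * c x) 2 volume) atTop
      (𝓝 0) := by
  obtain ⟨M, hM⟩ := hcs.exists_bound_of_continuous hc
  obtain ⟨R, hR⟩ := hcs.isCompact.isBounded.subset_closedBall (0 : Plane)
  set f' := (Metric.closedBall (0 : Plane) (R + 1)).indicator f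
  have hf' : MemLp f' 2 volume :=
    (memLp_indicator_iff_restrict measurableSet_closedBall).2 (hf _ (isCompact_closedBall 0 _))
  have hlim := ENNReal.Tendsto.const_mul (a := ENNReal.ofReal M)
    (tendsto_eLpNorm_mollify_sub hf' hη hε) (Or.inr ENNReal.ofReal_ne_top)
  rw [mul_zero] at hlim
  refine tendsto_of_tendsto_of_tendsto_of_le_of_le' tendsto_const_nhds hlim
    (Eventually.of_forall fun _ => zero_le) ?_
  filter_upwards [hε.eventually (gt_mem_nhds one_pos)] with n hn
  refine eLpNorm_le_mul_eLpNorm_of_ae_le_mul (ae_of_all _ fun x => ?_) 2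
  by_cases hx : x ∈ tsupport c
  · have hxR : ‖x‖ ≤ R := mem_closedBall_zero_iff.1 (hR hx)
    have hfx : f' x = f x := indicator_of_mem (mem_closedBall_zero_iff.2 (by linarith)) f
    rw [norm_mul, mul_comm, Pi.sub_apply, hfx,
      (hη n).mollify_indicator_closedBall f (by linarith)]
    gcongr
    exact hM x
  · rw [image_eq_zero_of_notMem_tsupport hx, mul_zero, norm_zero]
    exact mul_nonneg ((norm_nonneg _).trans (hM 0)) (norm_nonneg _)

end LTwo

lemma memLpLoc_complexPotential {A : Plane → Plane} {p : ℝ≥0∞} (hA : MemLpLoc A p) (s : ℤ) :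
    MemLpLoc (complexPotential s A) p := fun K hK => by
  have hcoord (j : Fin 2) : MemLp (fun x => (A x j : ℂ)) p (volume.restrict K) :=
    ((hA K hK).eval_piLp j).ofReal
  exact (hcoord 0).add ((hcoord 1).const_mul _)

/-- The factor `i(∂₁ + i s ∂₂) + (A₁ + i s A₂)` of the Pauli operator, applied to a function `u`
with weak gradient `G`. -/
def pauliOp (s : ℤ) (A : Plane → Plane) (u : Plane → ℂ) (G : Fin 2 → Plane → ℂ) (x : Plane) : ℂ :=
  Complex.I * (G 0 x + Complex.I * s * G 1 x) + complexPotential s A x * u x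

lemma MemLpLoc.aestronglyMeasurable_complexPotential {A : Plane → Plane} {p : ℝ≥0∞}
    (hA : MemLpLoc A p) (hp : 1 ≤ p) (s : ℤ) : AEStronglyMeasurable (complexPotential s A) :=
  ((memLpLoc_complexPotential hA s).locallyIntegrable hp).aestronglyMeasurable

lemma tendsto_ofReal_sq_div_exp (k K c : ℝ) (hK : 0 < K) {ε : ℕ → ℝ}
    (hε : Tendsto ε atTop (𝓝 0)) :
    Tendsto (fun n => ENNReal.ofReal ((k * Real.exp (-(c * ε n)) / (K * Real.exp (c * ε n))) ^ 2))
      atTop (𝓝 (ENNReal.ofReal ((k / K) ^ 2))) := by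
  have hcont : Continuous fun t : ℝ =>
      ENNReal.ofReal ((k * Real.exp (-(c * t)) / (K * Real.exp (c * t))) ^ 2) := by
    refine ENNReal.continuous_ofReal.comp (Continuous.pow (Continuous.div ?_ ?_ fun t => ?_) 2)
    · fun_prop
    · fun_prop
    · positivity
  simpa [Function.comp_def] using (hcont.tendsto 0).comp hε

lemma lintegral_radialWeight_le_add_mollify {B : Plane → ℝ}
    (hB : Integrable fun x => Real.log (2 + ‖x‖) * B x) {A : Plane → Plane}
    (hA : IsVectorPotential A B) {α ρ : ℝ} (hα : α ≠ 0) (hρ : 0 < ρ) {s : ℤ} (hs : s = 1 ∨ s = -1)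
    {k K : ℝ} (hk : 0 < k) (hK : 0 < K)
    (hlow : ∀ x, k * growth |α| ρ ‖x‖ ≤ Real.exp (s * scalarPotential B x))
    (hupp : ∀ x, Real.exp (s * scalarPotential B x) ≤ K * growth |α| ρ ‖x‖)
    {u : Plane → ℂ} (hu : ContDiff ℝ 1 u) (hsupp : HasCompactSupport u) {η : Plane → ℝ} {ε : ℝ}
    (hη : IsMollifier η ε) :
    ENNReal.ofReal ((k * Real.exp (-(|(|α|)| / ρ * ε)) / (K * Real.exp (|(|α|)| / ρ * ε))) ^ 2) *
        ∫⁻ x, ENNReal.ofReal (radialWeight α ρ ‖x‖ * ‖u x‖ ^ 2) ≤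
      (eLpNorm (pauliOp s A u fun j => partialDeriv j u) 2 volume +
        eLpNorm (fun x => (mollify η (complexPotential s A) x - complexPotential s A x) * u x) 2
          volume) ^ 2 := by
  have hP : LocallyIntegrable (complexPotential s A) :=
    (memLpLoc_complexPotential hA.memLpLoc s).locallyIntegrable one_le_two
  have hum := hu.continuous.aestronglyMeasurable (μ := (volume : Measure Plane))
  have hh := locallyIntegrable_scalarPotential hB
  have hDm : AEStronglyMeasurable (pauliOp s A u fun j => partialDeriv j u) :=
    ((continuous_dbar s hu).const_smul Complex.I).aestronglyMeasurable.add
      (hP.aestronglyMeasurable.mul hum)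
  have hm : AEStronglyMeasurable fun x =>
      (mollify η (complexPotential s A) x - complexPotential s A x) * u x :=
    ((contDiff_mollify hη.test hP).continuous.aestronglyMeasurable.sub
      hP.aestronglyMeasurable).mul hum
  refine (lintegral_radialWeight_le_mollify hB hA hα hρ hs hη.test (by positivity)
    (by positivity) (hη.le_exp_mollify hh hρ hk hlow) (hη.exp_mollify_le hh hρ hK hupp) hu
    hsupp).trans ?_
  simp only [ofReal_norm_sq, ← eLpNorm_two_sq]
  gcongr
  refine le_trans (eLpNorm_congr_ae (ae_of_all _ fun x => ?_)).le
    (eLpNorm_add_le hDm hm one_le_two)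
  simp only [Pi.add_apply, pauliOp, dbar]
  ring

theorem lintegral_radialWeight_le_pauliOp_of_contDiff {B : Plane → ℝ}
    (hB : Integrable fun x => Real.log (2 + ‖x‖) * B x) {A : Plane → Plane}
    (hA : IsVectorPotential A B) {α ρ : ℝ} (hα : α ≠ 0) (hρ : 0 < ρ) {s : ℤ} (hs : s = 1 ∨ s = -1)
    {k K : ℝ} (hk : 0 < k) (hK : 0 < K)
    (hlow : ∀ x, k * growth |α| ρ ‖x‖ ≤ Real.exp (s * scalarPotential B x))
    (hupp : ∀ x, Real.exp (s * scalarPotential B x) ≤ K * growth |α| ρ ‖x‖)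
    {u : Plane → ℂ} (hu : ContDiff ℝ 1 u) (hsupp : HasCompactSupport u) :
    ∫⁻ x, ENNReal.ofReal ((k / K) ^ 2 * radialWeight α ρ ‖x‖) * ‖u x‖ₑ ^ 2 ≤
      eLpNorm (pauliOp s A u fun j => partialDeriv j u) 2 volume ^ 2 := by
  have hε : Tendsto (fun n : ℕ => 1 / ((n : ℝ) + 1)) atTop (𝓝 0) :=
    tendsto_one_div_add_atTop_nhds_zero_nat
  choose η hη using fun n : ℕ => exists_isMollifier (Nat.one_div_pos_of_nat (α := ℝ) (n := n))
  have hvanish := tendsto_eLpNorm_mollify_sub_mul (memLpLoc_complexPotential hA.memLpLoc s)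
    hu.continuous hsupp hη hε
  have hlim := ((ENNReal.continuous_pow 2).tendsto _).comp
    (hvanish.const_add (eLpNorm (pauliOp s A u fun j => partialDeriv j u) 2 volume))
  rw [add_zero] at hlim
  have hpos : ENNReal.ofReal ((k / K) ^ 2) ≠ 0 := by
    rw [ne_eq, ENNReal.ofReal_eq_zero, not_le]
    positivity
  calc ∫⁻ x, ENNReal.ofReal ((k / K) ^ 2 * radialWeight α ρ ‖x‖) * ‖u x‖ₑ ^ 2
      = ENNReal.ofReal ((k / K) ^ 2) *
          ∫⁻ x, ENNReal.ofReal (radialWeight α ρ ‖x‖ * ‖u x‖ ^ 2) := by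
        simp only [ofReal_mul_lintegral_ofReal (sq_nonneg (k / K)), ← mul_assoc,
          ENNReal.ofReal_mul (mul_nonneg (sq_nonneg (k / K)) (radialWeight_nonneg α ρ _)),
          ofReal_norm_sq]
    _ ≤ eLpNorm (pauliOp s A u fun j => partialDeriv j u) 2 volume ^ 2 :=
        le_of_tendsto_of_tendsto'
          (ENNReal.Tendsto.mul_const (tendsto_ofReal_sq_div_exp k K _ hK hε) (Or.inl hpos)) hlim
          fun n => lintegral_radialWeight_le_add_mollify hB hA hα hρ hs hk hK hlow hupp hu hsupp
            (hη n)

/-! ### Passage from smooth functions to `H¹` -/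

section LpConvergence

variable {X E : Type*} [MeasurableSpace X] {μ : Measure X} [NormedAddCommGroup E]

lemma tendsto_eLpNorm_sub_of_dominated {f : ℕ → X → E} {g : X → E} {b : X → ℝ}
    (hf : ∀ n, AEStronglyMeasurable (f n) μ) (hb : MemLp b 2 μ) (hfb : ∀ n x, ‖f n x‖ ≤ b x)
    (hfg : ∀ᵐ x ∂μ, Tendsto (fun n => f n x) atTop (𝓝 (g x))) :
    Tendsto (fun n => eLpNorm (f n - g) 2 μ) atTop (𝓝 0) := by
  have hg : AEStronglyMeasurable g μ := aestronglyMeasurable_of_tendsto_ae atTop hf hfg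
  have hgb : ∀ᵐ x ∂μ, ‖g x‖ ≤ b x := by
    filter_upwards [hfg] with x hx using le_of_tendsto' hx.norm fun n => hfb n x
  have hlim : Tendsto (fun n => ∫⁻ x, ‖f n x - g x‖ₑ ^ 2 ∂μ) atTop (𝓝 (∫⁻ _, 0 ∂μ)) := by
    refine tendsto_lintegral_of_dominated_convergence' (fun x => ‖2 * b x‖ₑ ^ 2)
      (fun n => ((hf n).sub hg).enorm.pow_const 2) (fun n => ?_) ?_ ?_
    · filter_upwards [hgb] with x hx
      gcongr
      rw [enorm_le_iff_norm_le]
      calc ‖f n x - g x‖ ≤ ‖f n x‖ + ‖g x‖ := norm_sub_le _ _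
        _ ≤ 2 * b x := by linarith [hfb n x]
        _ ≤ ‖2 * b x‖ := le_abs_self _
    · rw [← eLpNorm_two_sq]
      exact ENNReal.pow_ne_top (hb.const_mul 2).2.ne
    · filter_upwards [hfg] with x hx
      have h := ((ENNReal.continuous_pow 2).tendsto _).comp (hx.sub_const (g x)).enorm
      simpa [Function.comp_def] using h
  simp only [lintegral_zero, ← Pi.sub_apply, ← eLpNorm_two_sq] at hlim
  have h := ((ENNReal.continuous_rpow_const (y := 1 / 2)).tendsto _).comp hlim
  simpa [Function.comp_def, ← ENNReal.rpow_natCast_mul] using h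

lemma lintegral_mul_enorm_sq_le_of_tendsto {W : X → ℝ≥0∞} (hW : AEMeasurable W μ)
    {v T : ℕ → X → E} {v' T' : X → E} (hv : ∀ n, AEStronglyMeasurable (v n) μ)
    (hT : ∀ n, AEStronglyMeasurable (T n) μ) (hT' : AEStronglyMeasurable T' μ)
    (hvv' : ∀ᵐ x ∂μ, Tendsto (fun n => v n x) atTop (𝓝 (v' x)))
    (hTT' : Tendsto (fun n => eLpNorm (T n - T') 2 μ) atTop (𝓝 0))
    (hle : ∀ n, ∫⁻ x, W x * ‖v n x‖ₑ ^ 2 ∂μ ≤ eLpNorm (T n) 2 μ ^ 2) :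
    ∫⁻ x, W x * ‖v' x‖ₑ ^ 2 ∂μ ≤ eLpNorm T' 2 μ ^ 2 := by
  have hlim := ((ENNReal.continuous_pow 2).tendsto _).comp (hTT'.const_add (eLpNorm T' 2 μ))
  rw [add_zero] at hlim
  calc ∫⁻ x, W x * ‖v' x‖ₑ ^ 2 ∂μ
      ≤ ∫⁻ x, liminf (fun n => W x * ‖v n x‖ₑ ^ 2) atTop ∂μ := by
        refine lintegral_mono_ae ?_
        filter_upwards [hvv'] with x hx
        have hx2 := ((ENNReal.continuous_pow 2).tendsto _).comp hx.enorm
        rcases eq_or_ne (v' x) 0 with h0 | h0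
        · simp [h0]
        · exact (ENNReal.Tendsto.const_mul hx2 (Or.inl (by simpa using h0))).liminf_eq.ge
    _ ≤ liminf (fun n => ∫⁻ x, W x * ‖v n x‖ₑ ^ 2 ∂μ) atTop :=
        lintegral_liminf_le' fun n => hW.mul ((hv n).enorm.pow_const 2)
    _ ≤ liminf (fun n => (eLpNorm T' 2 μ + eLpNorm (T n - T') 2 μ) ^ 2) atTop := by
        refine liminf_le_liminf (Eventually.of_forall fun n => (hle n).trans ?_)
        gcongr
        simpa using eLpNorm_add_le hT' ((hT n).sub hT') one_le_two
    _ = eLpNorm T' 2 μ ^ 2 := hlim.liminf_eq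

lemma tendsto_integral_mul_of_tendsto_eLpNorm {f : ℕ → X → ℂ} {g φ : X → ℂ}
    (hf : ∀ n, MemLp (f n) 2 μ) (hg : MemLp g 2 μ) (hφ : MemLp φ 2 μ)
    (hfg : Tendsto (fun n => eLpNorm (f n - g) 2 μ) atTop (𝓝 0)) :
    Tendsto (fun n => ∫ x, f n x * φ x ∂μ) atTop (𝓝 (∫ x, g x * φ x ∂μ)) := by
  refine tendsto_integral_of_L1' _ (hg.integrable_mul hφ).1
    (Eventually.of_forall fun n => (hf n).integrable_mul hφ) ?_
  have hlim := ENNReal.Tendsto.mul_const hfg (Or.inr hφ.2.ne)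
  rw [zero_mul] at hlim
  refine tendsto_of_tendsto_of_tendsto_of_le_of_le tendsto_const_nhds hlim (fun _ => zero_le)
    fun n => ?_
  refine le_trans (eLpNorm_congr_ae (ae_of_all _ fun x => ?_)).le
    (eLpNorm_smul_le_mul_eLpNorm hφ.1 ((hf n).1.sub hg.1))
  simp [sub_mul]

end LpConvergence

lemma aestronglyMeasurable_fderiv_apply {F : ℂ → ℂ} (hF : ContDiff ℝ 1 F) {z w : Plane → ℂ}
    (hz : AEStronglyMeasurable z) (hw : AEStronglyMeasurable w) :
    AEStronglyMeasurable fun x => fderiv ℝ F (z x) (w x) :=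
  (ContinuousLinearMap.id ℝ (ℂ →L[ℝ] ℂ)).aestronglyMeasurable_comp₂
    ((hF.continuous_fderiv one_ne_zero).comp_aestronglyMeasurable hz) hw

lemma tendsto_eLpNorm_fderiv_apply_sub {F : ℂ → ℂ} (hF : ContDiff ℝ 1 F) {C : ℝ}
    (hC : ∀ z, ‖fderiv ℝ F z‖ ≤ C) {w q : ℕ → Plane → ℂ} {u g : Plane → ℂ}
    (hw : ∀ n, AEStronglyMeasurable (w n)) (hu : AEStronglyMeasurable u)
    (hq : ∀ n, AEStronglyMeasurable (q n)) (hg : MemLp g 2)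
    (hwu : ∀ᵐ x, Tendsto (fun n => w n x) atTop (𝓝 (u x)))
    (hqg : Tendsto (fun n => eLpNorm (q n - g) 2) atTop (𝓝 0)) :
    Tendsto (fun n => eLpNorm ((fun x => fderiv ℝ F (w n x) (q n x)) -
      fun x => fderiv ℝ F (u x) (g x)) 2) atTop (𝓝 0) := by
  have hfrozen : Tendsto (fun n => eLpNorm ((fun x => fderiv ℝ F (w n x) (g x)) -
      fun x => fderiv ℝ F (u x) (g x)) 2) atTop (𝓝 0) := by
    refine tendsto_eLpNorm_sub_of_dominated
      (fun n => aestronglyMeasurable_fderiv_apply hF (hw n) hg.1) (hg.norm.const_mul C)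
      (fun n x => (fderiv ℝ F (w n x)).le_of_opNorm_le (hC _) _) ?_
    filter_upwards [hwu] with x hx
    have hL := ((hF.continuous_fderiv one_ne_zero).tendsto _).comp hx
    exact ((ContinuousLinearMap.apply ℝ ℂ (g x)).continuous.tendsto _).comp hL
  have hlim := (ENNReal.Tendsto.const_mul (a := ENNReal.ofReal C) hqg
    (Or.inr ENNReal.ofReal_ne_top)).add hfrozen
  rw [mul_zero, zero_add] at hlim
  refine tendsto_of_tendsto_of_tendsto_of_le_of_le tendsto_const_nhds hlim (fun _ => zero_le)
    fun n => ?_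
  have hsplit : ((fun x => fderiv ℝ F (w n x) (q n x)) - fun x => fderiv ℝ F (u x) (g x)) =
      (fun x => fderiv ℝ F (w n x) ((q n - g) x)) +
        ((fun x => fderiv ℝ F (w n x) (g x)) - fun x => fderiv ℝ F (u x) (g x)) := by
    ext x
    simp
  rw [hsplit]
  refine (eLpNorm_add_le (aestronglyMeasurable_fderiv_apply hF (hw n) ((hq n).sub hg.1))
    ((aestronglyMeasurable_fderiv_apply hF (hw n) hg.1).sub
      (aestronglyMeasurable_fderiv_apply hF hu hg.1)) one_le_two).trans ?_
  gcongr
  exact eLpNorm_le_mul_eLpNorm_of_ae_le_mul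
    (ae_of_all _ fun x => (fderiv ℝ F (w n x)).le_of_opNorm_le (hC _) _) 2

lemma IsTestFunction.mul {φ ψ : Plane → ℝ} (hφ : IsTestFunction φ) (hψ : IsTestFunction ψ) :
    IsTestFunction fun x => φ x * ψ x :=
  ⟨hφ.1.mul hψ.1, hφ.2.mul_right⟩

lemma IsTestFunction.memLp_ofReal {φ : Plane → ℝ} (hφ : IsTestFunction φ) (p : ℝ≥0∞) :
    MemLp (fun x => (φ x : ℂ)) p :=
  (hφ.continuous.memLp_of_hasCompactSupport hφ.2).ofReal

lemma IsTestFunction.memLp_smul {φ : Plane → ℝ} (hφ : IsTestFunction φ) {f : Plane → ℂ}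
    {p : ℝ≥0∞} (hf : MemLp f p) : MemLp (fun x => φ x • f x) p :=
  hf.smul (hφ.continuous.memLp_of_hasCompactSupport hφ.2 : MemLp φ ∞)

lemma partialDeriv_mul {φ ψ : Plane → ℝ} (hφ : Differentiable ℝ φ) (hψ : Differentiable ℝ ψ)
    (j : Fin 2) (x : Plane) :
    partialDeriv j (fun x => φ x * ψ x) x =
      φ x * partialDeriv j ψ x + ψ x * partialDeriv j φ x := by
  rw [partialDeriv, fderiv_fun_mul (hφ x) (hψ x)]
  rfl

lemma isH1WithGradient_of_contDiff {u : Plane → ℂ} (hu : ContDiff ℝ 1 u) (hu2 : MemLp u 2)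
    (hgrad : ∀ j, MemLp (partialDeriv j u) 2) : IsH1WithGradient u fun j => partialDeriv j u where
  memLp := hu2
  memLp_grad := hgrad
  weak_grad j φ hφ := by
    simpa only [Complex.real_smul, mul_comm] using
      integral_partialDeriv_smul (hφ.1.of_le ENat.LEInfty.out) hφ.2 hu j

lemma exists_isMollifier_tendsto_ae {u : Plane → ℂ} (hu : MemLp u 2) :
    ∃ (η : ℕ → Plane → ℝ) (ε : ℕ → ℝ), (∀ n, IsMollifier (η n) (ε n)) ∧ (∀ n, ε n ≤ 1) ∧
      Tendsto ε atTop (𝓝 0) ∧ ∀ᵐ x, Tendsto (fun n => mollify (η n) u x) atTop (𝓝 (u x)) := by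
  have hε : Tendsto (fun n : ℕ => 1 / ((n : ℝ) + 1)) atTop (𝓝 0) :=
    tendsto_one_div_add_atTop_nhds_zero_nat
  choose η hη using fun n : ℕ => exists_isMollifier (Nat.one_div_pos_of_nat (α := ℝ) (n := n))
  obtain ⟨ns, hns, hae⟩ := (tendstoInMeasure_of_tendsto_eLpNorm two_ne_zero
    (fun n => (contDiff_mollify (hη n).test
      (hu.locallyIntegrable one_le_two)).continuous.aestronglyMeasurable) hu.1
    (tendsto_eLpNorm_mollify_sub hu hη hε)).exists_seq_tendsto_ae
  refine ⟨fun n => η (ns n), fun n => 1 / ((ns n : ℝ) + 1), fun n => hη _, fun n => ?_,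
    hε.comp hns.tendsto_atTop, hae⟩
  exact div_le_one_of_le₀ (by simp) (by positivity)

namespace IsH1WithGradient

variable {u : Plane → ℂ} {G : Fin 2 → Plane → ℂ}

lemma of_tendsto {w : ℕ → Plane → ℂ} {q : ℕ → Fin 2 → Plane → ℂ}
    (hw : ∀ n, IsH1WithGradient (w n) (q n)) (hu : MemLp u 2) (hG : ∀ j, MemLp (G j) 2)
    (hwu : Tendsto (fun n => eLpNorm (w n - u) 2) atTop (𝓝 0))
    (hqG : ∀ j, Tendsto (fun n => eLpNorm (q n j - G j) 2) atTop (𝓝 0)) :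
    IsH1WithGradient u G where
  memLp := hu
  memLp_grad := hG
  weak_grad j φ hφ := by
    have hl := tendsto_integral_mul_of_tendsto_eLpNorm (fun n => (hw n).memLp) hu
      ((hφ.partialDeriv j).memLp_ofReal 2) hwu
    have hr := (tendsto_integral_mul_of_tendsto_eLpNorm (fun n => (hw n).memLp_grad j) (hG j)
      (hφ.memLp_ofReal 2) (hqG j)).neg
    simp only [(hw _).weak_grad j φ hφ] at hl
    exact tendsto_nhds_unique hl hr

lemma smul_testFunction (hu : IsH1WithGradient u G) {χ : Plane → ℝ} (hχ : IsTestFunction χ) :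
    IsH1WithGradient (fun x => χ x • u x)
      fun j x => χ x • G j x + partialDeriv j χ x • u x where
  memLp := hχ.memLp_smul hu.memLp
  memLp_grad j := (hχ.memLp_smul (hu.memLp_grad j)).add ((hχ.partialDeriv j).memLp_smul hu.memLp)
  weak_grad j φ hφ := by
    have hweak := hu.weak_grad j _ (hχ.mul hφ)
    have hd {ψ : Plane → ℝ} (hψ : IsTestFunction ψ) : Differentiable ℝ ψ :=
      hψ.1.differentiable (by simp)
    simp only [partialDeriv_mul (hd hχ) (hd hφ)] at hweak
    have h1 : Integrable fun x => χ x • u x * ((partialDeriv j φ x : ℝ) : ℂ) :=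
      (hχ.memLp_smul hu.memLp).integrable_mul ((hφ.partialDeriv j).memLp_ofReal 2)
    have h2 : Integrable fun x => partialDeriv j χ x • u x * (φ x : ℂ) :=
      ((hχ.partialDeriv j).memLp_smul hu.memLp).integrable_mul (hφ.memLp_ofReal 2)
    have h3 : Integrable fun x => χ x • G j x * (φ x : ℂ) :=
      (hχ.memLp_smul (hu.memLp_grad j)).integrable_mul (hφ.memLp_ofReal 2)
    have hsum : (∫ x, χ x • u x * ((partialDeriv j φ x : ℝ) : ℂ)) +
        ∫ x, partialDeriv j χ x • u x * (φ x : ℂ) = -∫ x, χ x • G j x * (φ x : ℂ) := by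
      rw [← integral_add h1 h2]
      refine Eq.trans (integral_congr_ae (ae_of_all _ fun x => ?_)) (hweak.trans (congrArg _
        (integral_congr_ae (ae_of_all _ fun x => ?_))))
      · simp only [Complex.real_smul]
        push_cast
        ring
      · simp only [Complex.real_smul]
        push_cast
        ring
    simp only [add_mul]
    rw [integral_add h3 h2, neg_add, ← hsum]
    ring

lemma partialDeriv_mollify (hu : IsH1WithGradient u G) {η : Plane → ℝ} (hη : IsTestFunction η)
    (j : Fin 2) : partialDeriv j (mollify η u) = mollify η (G j) := by
  rw [MagneticHardy.partialDeriv_mollify hη (hu.memLp.locallyIntegrable one_le_two)]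
  funext x
  have hweak := hu.weak_grad j _ (hη.reflect x)
  simp only [partialDeriv_reflect, Complex.ofReal_neg, mul_neg, integral_neg, neg_inj] at hweak
  simpa only [mollify, Complex.real_smul, mul_comm] using hweak

end IsH1WithGradient

lemma IsMollifier.memLp_mollify {η : Plane → ℝ} {ε : ℝ} (h : IsMollifier η ε) {f : Plane → ℂ}
    (hf : MemLp f 2) : MemLp (mollify η f) 2 := by
  have hloc := hf.locallyIntegrable one_le_two
  have hm := (contDiff_mollify h.test hloc).continuous.aestronglyMeasurable (μ := volume)
  have hdiff : eLpNorm (mollify η f - f) 2 ≤ eLpNorm f 2 + eLpNorm f 2 := by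
    refine h.eLpNorm_mollify_sub_le hloc fun y _ => ?_
    have hy := measurePreserving_sub_right (volume : Measure Plane) y
    refine (eLpNorm_sub_le (hf.1.comp_measurePreserving hy) hf.1 one_le_two).trans_eq ?_
    rw [eLpNorm_comp_measurePreserving hf.1 hy]
  have hsub : MemLp (mollify η f - f) 2 :=
    ⟨hm.sub hf.1, hdiff.trans_lt (ENNReal.add_lt_top.2 ⟨hf.2, hf.2⟩)⟩
  simpa using hsub.add hf

lemma norm_sub_le_of_norm_fderiv_le {F : ℂ → ℂ} (hF : ContDiff ℝ 1 F) {C : ℝ}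
    (hC : ∀ z, ‖fderiv ℝ F z‖ ≤ C) (z w : ℂ) : ‖F z - F w‖ ≤ C * ‖z - w‖ :=
  convex_univ.norm_image_sub_le_of_norm_fderiv_le (fun x _ => hF.differentiable one_ne_zero x)
    (fun x _ => hC x) trivial trivial

lemma norm_le_of_norm_fderiv_le {F : ℂ → ℂ} (hF : ContDiff ℝ 1 F) (hF0 : F 0 = 0) {C : ℝ}
    (hC : ∀ z, ‖fderiv ℝ F z‖ ≤ C) (z : ℂ) : ‖F z‖ ≤ C * ‖z‖ := by
  simpa [hF0] using norm_sub_le_of_norm_fderiv_le hF hC z 0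

lemma partialDeriv_comp {F : ℂ → ℂ} (hF : ContDiff ℝ 1 F) {u : Plane → ℂ} (hu : ContDiff ℝ 1 u)
    (j : Fin 2) (x : Plane) :
    partialDeriv j (fun x => F (u x)) x = fderiv ℝ F (u x) (partialDeriv j u x) := by
  rw [partialDeriv, fderiv_fun_comp x (hF.differentiable one_ne_zero _)
    (hu.differentiable one_ne_zero x)]
  rfl

lemma IsH1WithGradient.comp {u : Plane → ℂ} {G : Fin 2 → Plane → ℂ} (hu : IsH1WithGradient u G)
    {F : ℂ → ℂ} (hF : ContDiff ℝ 1 F) (hF0 : F 0 = 0) {C : ℝ} (hC : ∀ z, ‖fderiv ℝ F z‖ ≤ C) :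
    IsH1WithGradient (fun x => F (u x)) fun j x => fderiv ℝ F (u x) (G j x) := by
  have hcomp {v : Plane → ℂ} (hv : MemLp v 2) : MemLp (fun x => F (v x)) 2 :=
    hv.of_le_mul (hF.continuous.comp_aestronglyMeasurable hv.1)
      (ae_of_all _ fun x => norm_le_of_norm_fderiv_le hF hF0 hC (v x))
  have hderiv {v g : Plane → ℂ} (hv : AEStronglyMeasurable v) (hg : MemLp g 2) :
      MemLp (fun x => fderiv ℝ F (v x) (g x)) 2 :=
    hg.of_le_mul (aestronglyMeasurable_fderiv_apply hF hv hg.1)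
      (ae_of_all _ fun x => (fderiv ℝ F (v x)).le_of_opNorm_le (hC _) _)
  obtain ⟨η, ε, hη, -, hε, hae⟩ := exists_isMollifier_tendsto_ae hu.memLp
  have hw (n : ℕ) : ContDiff ℝ 1 (mollify (η n) u) :=
    (contDiff_mollify (hη n).test (hu.memLp.locallyIntegrable one_le_two)).of_le ENat.LEInfty.out
  have hw2 (n : ℕ) : MemLp (mollify (η n) u) 2 := (hη n).memLp_mollify hu.memLp
  have hq2 (n : ℕ) (j : Fin 2) : MemLp (mollify (η n) (G j)) 2 :=
    (hη n).memLp_mollify (hu.memLp_grad j)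
  refine IsH1WithGradient.of_tendsto (w := fun n x => F (mollify (η n) u x))
    (q := fun n j x => fderiv ℝ F (mollify (η n) u x) (mollify (η n) (G j) x)) (fun n => ?_)
    (hcomp hu.memLp) (fun j => hderiv hu.memLp.1 (hu.memLp_grad j)) ?_ fun j => ?_
  · have hchain (j : Fin 2) : partialDeriv j (fun x => F (mollify (η n) u x)) =
        fun x => fderiv ℝ F (mollify (η n) u x) (mollify (η n) (G j) x) := by
      ext x
      rw [partialDeriv_comp hF (hw n), hu.partialDeriv_mollify (hη n).test]
    have hFw : ContDiff ℝ 1 fun x => F (mollify (η n) u x) := hF.comp (hw n)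
    simpa only [hchain] using isH1WithGradient_of_contDiff hFw (hcomp (hw2 n)) fun j =>
      (hchain j).symm ▸ hderiv (hw2 n).1 (hq2 n j)
  · have hlim := ENNReal.Tendsto.const_mul (a := ENNReal.ofReal C)
      (tendsto_eLpNorm_mollify_sub hu.memLp hη hε) (Or.inr ENNReal.ofReal_ne_top)
    rw [mul_zero] at hlim
    exact tendsto_of_tendsto_of_tendsto_of_le_of_le tendsto_const_nhds hlim (fun _ => zero_le)
      fun n => eLpNorm_le_mul_eLpNorm_of_ae_le_mul
        (ae_of_all _ fun x => norm_sub_le_of_norm_fderiv_le hF hC _ _) 2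
  · exact tendsto_eLpNorm_fderiv_apply_sub hF hC (fun n => (hw2 n).1) hu.memLp.1
      (fun n => (hq2 n j).1) (hu.memLp_grad j) hae
      (tendsto_eLpNorm_mollify_sub (hu.memLp_grad j) hη hε)

/-- The `L²` bound of `√W u` by the Pauli factor applied to `u`, where `G` is the weak gradient of
`u`. -/
def PauliHardyBound (s : ℤ) (A : Plane → Plane) (W : Plane → ℝ≥0∞) (u : Plane → ℂ)
    (G : Fin 2 → Plane → ℂ) : Prop :=
  ∫⁻ x, W x * ‖u x‖ₑ ^ 2 ≤ eLpNorm (pauliOp s A u G) 2 volume ^ 2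

section Density

variable {s : ℤ} {A : Plane → Plane} {u : Plane → ℂ} {G : Fin 2 → Plane → ℂ}

lemma IsMollifier.norm_mollify_le {η : Plane → ℝ} {ε : ℝ} (h : IsMollifier η ε) {M : ℝ}
    (hM : ∀ x, ‖u x‖ ≤ M) (x : Plane) : ‖mollify η u x‖ ≤ M := by
  calc ‖mollify η u x‖ ≤ ∫ t, η (x - t) * M := by
        refine norm_integral_le_of_norm_le ((h.integrable.comp_sub_left x).mul_const M)
          (ae_of_all _ fun t => ?_)
        rw [norm_smul, Real.norm_of_nonneg (h.nonneg _)]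
        exact mul_le_mul_of_nonneg_left (hM t) (h.nonneg _)
    _ = M := by rw [integral_mul_const, h.integral_reflect, one_mul]

lemma IsMollifier.mollify_eq_zero {η : Plane → ℝ} {ε : ℝ} (h : IsMollifier η ε) {R : ℝ}
    (hR : tsupport u ⊆ Metric.closedBall 0 R) {x : Plane} (hx : R + ε < ‖x‖) :
    mollify η u x = 0 := by
  refine integral_eq_zero_of_ae (ae_of_all _ fun t => ?_)
  rcases le_or_gt ε ‖x - t‖ with ht | ht
  · simp [h.eq_zero _ ht]
  · have hout : t ∉ tsupport u := fun hmem => by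
      have htR := mem_closedBall_zero_iff.1 (hR hmem)
      linarith [norm_le_norm_add_norm_sub' x t]
    simp [image_eq_zero_of_notMem_tsupport hout]

lemma aestronglyMeasurable_pauliOp (hA : MemLpLoc A 2) (hu : AEStronglyMeasurable u)
    (hG : ∀ j, AEStronglyMeasurable (G j)) : AEStronglyMeasurable (pauliOp s A u G) :=
  (((hG 0).add ((hG 1).const_mul _)).const_mul _).add
    ((hA.aestronglyMeasurable_complexPotential one_le_two s).mul hu)

lemma tendsto_eLpNorm_pauliOp_sub (hA : MemLpLoc A 2) {w : ℕ → Plane → ℂ}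
    {q : ℕ → Fin 2 → Plane → ℂ} (hw : ∀ n, AEStronglyMeasurable (w n))
    (hu : AEStronglyMeasurable u) (hq : ∀ n j, AEStronglyMeasurable (q n j))
    (hG : ∀ j, AEStronglyMeasurable (G j))
    (hqG : ∀ j, Tendsto (fun n => eLpNorm (q n j - G j) 2) atTop (𝓝 0))
    (hwu : Tendsto (fun n => eLpNorm ((fun x => complexPotential s A x * w n x) -
      fun x => complexPotential s A x * u x) 2) atTop (𝓝 0)) :
    Tendsto (fun n => eLpNorm (pauliOp s A (w n) (q n) - pauliOp s A u G) 2) atTop (𝓝 0) := by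
  have hP := hA.aestronglyMeasurable_complexPotential one_le_two s
  have hlim := ((hqG 0).add (ENNReal.Tendsto.const_mul (a := ‖Complex.I * s‖ₑ) (hqG 1)
    (Or.inr enorm_ne_top))).add hwu
  simp only [mul_zero, add_zero] at hlim
  refine tendsto_of_tendsto_of_tendsto_of_le_of_le tendsto_const_nhds hlim (fun _ => zero_le)
    fun n => ?_
  have hd (j : Fin 2) : AEStronglyMeasurable (q n j - G j) := (hq n j).sub (hG j)
  have hsplit : pauliOp s A (w n) (q n) - pauliOp s A u G =
      Complex.I • ((q n 0 - G 0) + (Complex.I * s) • (q n 1 - G 1)) +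
        ((fun x => complexPotential s A x * w n x) - fun x => complexPotential s A x * u x) := by
    ext x
    simp only [pauliOp, Pi.sub_apply, Pi.add_apply, Pi.smul_apply, smul_eq_mul]
    ring
  rw [hsplit]
  refine (eLpNorm_add_le (((hd 0).add ((hd 1).const_smul _)).const_smul _)
    ((hP.mul (hw n)).sub (hP.mul hu)) one_le_two).trans ?_
  refine add_le_add ?_ le_rfl
  rw [eLpNorm_const_smul, enorm_eq_nnnorm Complex.I, Complex.nnnorm_I, ENNReal.coe_one, one_mul,
    ← eLpNorm_const_smul]
  exact eLpNorm_add_le (hd 0) ((hd 1).const_smul _) one_le_two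

lemma memLp_complexPotential_mul (hu : IsH1WithGradient u G)
    (hT : MemLp (pauliOp s A u G) 2) : MemLp (fun x => complexPotential s A x * u x) 2 := by
  have h := hT.sub (((hu.memLp_grad 0).add ((hu.memLp_grad 1).const_mul
    (Complex.I * s))).const_mul Complex.I)
  refine h.ae_eq (ae_of_all _ fun x => ?_)
  simp [pauliOp]

variable {W : Plane → ℝ≥0∞}

lemma PauliHardyBound.of_tendsto (hA : MemLpLoc A 2) (hW : Measurable W) {w : ℕ → Plane → ℂ}
    {q : ℕ → Fin 2 → Plane → ℂ} (hbound : ∀ n, PauliHardyBound s A W (w n) (q n))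
    (hw : ∀ n, IsH1WithGradient (w n) (q n)) (hu : IsH1WithGradient u G)
    (hwu : ∀ᵐ x, Tendsto (fun n => w n x) atTop (𝓝 (u x)))
    (hqG : ∀ j, Tendsto (fun n => eLpNorm (q n j - G j) 2) atTop (𝓝 0)) {b : Plane → ℝ}
    (hb : MemLp b 2) (hwb : ∀ n x, ‖complexPotential s A x * w n x‖ ≤ b x) :
    PauliHardyBound s A W u G := by
  have hP := hA.aestronglyMeasurable_complexPotential one_le_two s
  have hT {v : Plane → ℂ} {H : Fin 2 → Plane → ℂ} (hv : IsH1WithGradient v H) :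
      AEStronglyMeasurable (pauliOp s A v H) :=
    aestronglyMeasurable_pauliOp hA hv.memLp.1 fun j => (hv.memLp_grad j).1
  have hpot := tendsto_eLpNorm_sub_of_dominated (fun n => hP.mul (hw n).memLp.1) hb hwb
    (hwu.mono fun x hx => hx.const_mul (complexPotential s A x))
  exact lintegral_mul_enorm_sq_le_of_tendsto hW.aemeasurable (fun n => (hw n).memLp.1)
    (fun n => hT (hw n)) (hT hu) hwu (tendsto_eLpNorm_pauliOp_sub hA (fun n => (hw n).memLp.1)
      hu.memLp.1 (fun n j => ((hw n).memLp_grad j).1) (fun j => (hu.memLp_grad j).1) hqG hpot)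
    hbound

end Density

section Density

variable {s : ℤ} {A : Plane → Plane} {W : Plane → ℝ≥0∞}

lemma IsMollifier.hasCompactSupport_mollify {η : Plane → ℝ} {ε : ℝ} (h : IsMollifier η ε)
    {u : Plane → ℂ} (hu : HasCompactSupport u) : HasCompactSupport (mollify η u) := by
  obtain ⟨R, hR⟩ := hu.isCompact.isBounded.subset_closedBall 0
  refine HasCompactSupport.intro (isCompact_closedBall 0 (R + ε)) fun x hx => ?_
  exact h.mollify_eq_zero hR (not_le.1 (mem_closedBall_zero_iff.not.1 hx))

lemma memLp_indicator_complexPotential_mul (hA : MemLpLoc A 2) (s : ℤ) (R M : ℝ) :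
    MemLp (fun x => ‖(Metric.closedBall 0 R).indicator (complexPotential s A) x‖ * M) 2 :=
  ((memLp_indicator_iff_restrict Metric.isClosed_closedBall.measurableSet).2
    (memLpLoc_complexPotential hA s _ (isCompact_closedBall 0 R))).norm.mul_const M

lemma pauliHardyBound_of_bounded (hA : MemLpLoc A 2) (hW : Measurable W)
    (h : ∀ v : Plane → ℂ, ContDiff ℝ 1 v → HasCompactSupport v →
      PauliHardyBound s A W v fun j => partialDeriv j v) {u : Plane → ℂ} {G : Fin 2 → Plane → ℂ}
    (hu : IsH1WithGradient u G) (hs : HasCompactSupport u) {M : ℝ} (hM : ∀ x, ‖u x‖ ≤ M) :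
    PauliHardyBound s A W u G := by
  obtain ⟨η, ε, hη, hε1, hε, hae⟩ := exists_isMollifier_tendsto_ae hu.memLp
  obtain ⟨R, hR⟩ := hs.isCompact.isBounded.subset_closedBall 0
  have hgrad (n : ℕ) (j : Fin 2) : partialDeriv j (mollify (η n) u) = mollify (η n) (G j) :=
    hu.partialDeriv_mollify (hη n).test j
  have hsmooth (n : ℕ) : ContDiff ℝ 1 (mollify (η n) u) :=
    (contDiff_mollify (hη n).test (hu.memLp.locallyIntegrable one_le_two)).of_le
      (by exact_mod_cast le_top)
  refine PauliHardyBound.of_tendsto hA hW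
    (fun n => h _ (hsmooth n) ((hη n).hasCompactSupport_mollify hs))
    (fun n => isH1WithGradient_of_contDiff (hsmooth n) ((hη n).memLp_mollify hu.memLp)
      fun j => hgrad n j ▸ (hη n).memLp_mollify (hu.memLp_grad j))
    hu hae (fun j => ?_) (memLp_indicator_complexPotential_mul hA s (R + 1) M) fun n x => ?_
  · simpa only [hgrad] using tendsto_eLpNorm_mollify_sub (hu.memLp_grad j) hη hε
  · by_cases hx : ‖x‖ ≤ R + 1
    · rw [indicator_of_mem (mem_closedBall_zero_iff.2 hx), norm_mul]
      exact mul_le_mul_of_nonneg_left ((hη n).norm_mollify_le hM x) (norm_nonneg _)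
    · rw [(hη n).mollify_eq_zero hR (by linarith [hε1 n])]
      simp [indicator_of_notMem (mem_closedBall_zero_iff.not.2 hx)]

lemma eventually_eventually_smul {E : Type*} [NormedAddCommGroup E] [NormedSpace ℝ E]
    {p : E → Prop} (hp : ∀ᶠ y in 𝓝 0, p y) {c : ℕ → ℝ} (hc : Tendsto c atTop (𝓝 0)) (x : E) :
    ∀ᶠ n in atTop, ∀ᶠ y in 𝓝 x, p (c n • y) := by
  have hx : Tendsto (fun n => c n • x) atTop (𝓝 0) := by simpa using hc.smul_const x
  filter_upwards [hx.eventually (eventually_eventually_nhds.2 hp)] with n hn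
  exact (continuous_const_smul (c n)).continuousAt.eventually hn

lemma exists_truncation_seq : ∃ (F : ℕ → ℂ → ℂ) (C : ℝ), (∀ n, ContDiff ℝ 1 (F n)) ∧
    (∀ n, F n 0 = 0) ∧ (∀ n, ∃ M, ∀ z, ‖F n z‖ ≤ M) ∧ (∀ n z, ‖fderiv ℝ (F n) z‖ ≤ C) ∧
    ∀ z, ∀ᶠ n in atTop, F n =ᶠ[𝓝 z] id := by
  let b : ContDiffBump (0 : ℂ) := default
  let f (z : ℂ) : ℂ := b z • z
  have hf : ContDiff ℝ 1 f := b.contDiff.smul contDiff_id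
  have hfs : HasCompactSupport f := b.hasCompactSupport.smul_right
  obtain ⟨M, hM⟩ := hfs.exists_bound_of_continuous hf.continuous
  obtain ⟨C, hC⟩ := (hfs.fderiv ℝ).exists_bound_of_continuous (hf.continuous_fderiv one_ne_zero)
  let c (n : ℕ) : ℝ := 1 / (n + 1)
  have hc (n : ℕ) : c n ≠ 0 := Nat.one_div_pos_of_nat.ne'
  refine ⟨fun n z => (c n)⁻¹ • f (c n • z), C,
    fun n => (hf.comp (contDiff_id.const_smul (c n))).const_smul _, fun n => by simp [f],
    fun n => ⟨|(c n)⁻¹| * M, fun z => ?_⟩, fun n z => ?_, fun z => ?_⟩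
  · rw [norm_smul, Real.norm_eq_abs]
    exact mul_le_mul_of_nonneg_left (hM _) (abs_nonneg _)
  · have hd : Differentiable ℝ fun z => f (c n • z) :=
      (hf.differentiable one_ne_zero).comp (differentiable_id.const_smul (c n))
    rw [fderiv_fun_const_smul hd.differentiableAt, fderiv_comp_smul, inv_smul_smul₀ (hc n)]
    exact hC _
  · filter_upwards [eventually_eventually_smul b.eventuallyEq_one
      tendsto_one_div_add_atTop_nhds_zero_nat z] with n hn
    filter_upwards [hn] with y hy
    simp only [f, c, hy, Pi.one_apply, one_smul, id]
    exact inv_smul_smul₀ (hc n) y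

lemma pauliHardyBound_of_hasCompactSupport (hA : MemLpLoc A 2) (hW : Measurable W)
    (h : ∀ v : Plane → ℂ, ContDiff ℝ 1 v → HasCompactSupport v →
      PauliHardyBound s A W v fun j => partialDeriv j v) {u : Plane → ℂ} {G : Fin 2 → Plane → ℂ}
    (hu : IsH1WithGradient u G) (hs : HasCompactSupport u)
    (hP : MemLp (fun x => complexPotential s A x * u x) 2) : PauliHardyBound s A W u G := by
  obtain ⟨F, C, hF, hF0, hFM, hC, hFid⟩ := exists_truncation_seq
  choose M hM using hFM
  have hcomp (n : ℕ) := hu.comp (hF n) (hF0 n) (hC n)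
  refine PauliHardyBound.of_tendsto hA hW (fun n => pauliHardyBound_of_bounded hA hW h (hcomp n)
    (hs.comp_left (hF0 n)) fun x => hM n (u x)) hcomp hu (ae_of_all _ fun x => ?_)
    (fun j => tendsto_eLpNorm_sub_of_dominated (fun n => ((hcomp n).memLp_grad j).1)
      ((hu.memLp_grad j).norm.const_mul C) (fun n x => ?_) (ae_of_all _ fun x => ?_))
    (hP.norm.const_mul C) fun n x => ?_
  · exact tendsto_const_nhds.congr' ((hFid (u x)).mono fun n hn => hn.self_of_nhds.symm)
  · exact ((fderiv ℝ (F n) (u x)).le_opNorm _).trans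
      (mul_le_mul_of_nonneg_right (hC n _) (norm_nonneg _))
  · refine tendsto_const_nhds.congr' ((hFid (u x)).mono fun n hn => ?_)
    dsimp only
    rw [hn.fderiv_eq, fderiv_id]
    rfl
  · rw [norm_mul, norm_mul, mul_left_comm]
    exact mul_le_mul_of_nonneg_left (norm_le_of_norm_fderiv_le (hF n) (hF0 n) (hC n) _)
      (norm_nonneg _)

lemma exists_cutoff_seq : ∃ (χ : ℕ → Plane → ℝ) (C : ℝ), (∀ n, IsTestFunction (χ n)) ∧
    (∀ n x, |χ n x| ≤ 1) ∧ (∀ n j x, |partialDeriv j (χ n) x| ≤ C) ∧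
    ∀ x, ∀ᶠ n in atTop, χ n =ᶠ[𝓝 x] 1 := by
  let b : ContDiffBump (0 : Plane) := default
  have hb : IsTestFunction b := ⟨b.contDiff, b.hasCompactSupport⟩
  choose C hC using fun j => (hb.partialDeriv j).2.exists_bound_of_continuous
    (hb.partialDeriv j).continuous
  have hC0 (j : Fin 2) : 0 ≤ C j := (norm_nonneg _).trans (hC j 0)
  let c (n : ℕ) : ℝ := 1 / (n + 1)
  have hc (n : ℕ) : 0 < c n := Nat.one_div_pos_of_nat
  have hc1 (n : ℕ) : c n ≤ 1 := div_le_one_of_le₀ (by simp) (by positivity)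
  refine ⟨fun n x => b (c n • x), C 0 + C 1, fun n => ⟨b.contDiff.comp (contDiff_const_smul (c n)),
    b.hasCompactSupport.comp_smul (hc n).ne'⟩, fun n x => ?_, fun n j x => ?_, fun x =>
    eventually_eventually_smul b.eventuallyEq_one tendsto_one_div_add_atTop_nhds_zero_nat x⟩
  · rw [abs_of_nonneg b.nonneg]
    exact b.le_one
  · have hd : partialDeriv j (fun x => b (c n • x)) x = c n * partialDeriv j b (c n • x) := by
      rw [partialDeriv, fderiv_comp_smul]
      rfl
    rw [hd, abs_mul, abs_of_pos (hc n)]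
    calc c n * |partialDeriv j b (c n • x)| ≤ 1 * C j :=
          mul_le_mul (hc1 n) (hC j _) (abs_nonneg _) zero_le_one
      _ ≤ C 0 + C 1 := by fin_cases j <;> simp [hC0]

lemma pauliHardyBound_of_memLp_mul (hA : MemLpLoc A 2) (hW : Measurable W)
    (h : ∀ v : Plane → ℂ, ContDiff ℝ 1 v → HasCompactSupport v →
      PauliHardyBound s A W v fun j => partialDeriv j v) {u : Plane → ℂ} {G : Fin 2 → Plane → ℂ}
    (hu : IsH1WithGradient u G) (hP : MemLp (fun x => complexPotential s A x * u x) 2) :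
    PauliHardyBound s A W u G := by
  obtain ⟨χ, C, hχ, hχ1, hC, hχone⟩ := exists_cutoff_seq
  have hmul (n : ℕ) (x : Plane) (z : ℂ) : ‖χ n x • z‖ ≤ ‖z‖ := by
    rw [norm_smul]
    exact mul_le_of_le_one_left (norm_nonneg _) (hχ1 n x)
  have hcut (n : ℕ) := hu.smul_testFunction (hχ n)
  have hpot (n : ℕ) (x : Plane) : ‖complexPotential s A x * χ n x • u x‖ ≤
      ‖complexPotential s A x * u x‖ := by
    rw [mul_smul_comm]
    exact hmul n x _
  have hPcut (n : ℕ) : MemLp (fun x => complexPotential s A x * χ n x • u x) 2 :=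
    hP.mono ((hA.aestronglyMeasurable_complexPotential one_le_two s).mul (hcut n).memLp.1)
      (ae_of_all _ (hpot n))
  refine PauliHardyBound.of_tendsto hA hW (fun n => pauliHardyBound_of_hasCompactSupport hA hW h
    (hcut n) (hχ n).2.smul_right (hPcut n)) hcut hu (ae_of_all _ fun x => ?_)
    (fun j => tendsto_eLpNorm_sub_of_dominated (fun n => ((hcut n).memLp_grad j).1)
      ((hu.memLp_grad j).norm.add (hu.memLp.norm.const_mul C)) (fun n x => ?_)
      (ae_of_all _ fun x => ?_)) hP.norm hpot
  · refine tendsto_const_nhds.congr' ((hχone x).mono fun n hn => ?_)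
    simp only [hn.self_of_nhds, Pi.one_apply, one_smul]
  · refine (norm_add_le _ _).trans (add_le_add (hmul n x _) ?_)
    rw [norm_smul]
    exact mul_le_mul_of_nonneg_right (hC n j x) (norm_nonneg _)
  · refine tendsto_const_nhds.congr' ((hχone x).mono fun n hn => ?_)
    have hd : partialDeriv j (χ n) x = 0 := by
      rw [partialDeriv, hn.fderiv_eq]
      simp
    simp only [hn.self_of_nhds, hd, Pi.one_apply, one_smul, zero_smul, add_zero]

theorem pauliHardyBound_of_contDiff (hA : MemLpLoc A 2) (hW : Measurable W)
    (h : ∀ v : Plane → ℂ, ContDiff ℝ 1 v → HasCompactSupport v →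
      PauliHardyBound s A W v fun j => partialDeriv j v) {u : Plane → ℂ} {G : Fin 2 → Plane → ℂ}
    (hu : IsH1WithGradient u G) : PauliHardyBound s A W u G := by
  by_cases htop : eLpNorm (pauliOp s A u G) 2 = ⊤
  · simp [PauliHardyBound, htop]
  · have hT : MemLp (pauliOp s A u G) 2 := ⟨aestronglyMeasurable_pauliOp hA hu.memLp.1
      fun j => (hu.memLp_grad j).1, lt_top_iff_ne_top.2 htop⟩
    exact pauliHardyBound_of_memLp_mul hA hW h hu (memLp_complexPotential_mul hu hT)

end Density

/-! ### The comparison constants of the potential -/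

lemma comparison_sign {B : Plane → ℝ} (hα : flux B ≠ 0) {ρ : ℝ} (hρ : 0 < ρ) (r : ℝ) :
    comparison B (SignType.sign (flux B)) ρ r = growth |flux B| ρ r := by
  unfold comparison
  split_ifs with h
  · rw [growth_of_le hρ h]
  · have hr : 0 < r := hρ.trans (not_le.1 h)
    have hdiv : ρ ^ (-flux B) * r ^ flux B = (r / ρ) ^ flux B := by
      rw [Real.div_rpow hr.le hρ.le, Real.rpow_neg hρ.le, div_eq_inv_mul]
    rw [growth_of_ge hρ (not_le.1 h).le, hdiv]
    rcases lt_or_gt_of_ne hα with hneg | hpos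
    · rw [sign_neg hneg, abs_of_neg hneg, Real.rpow_neg (by positivity)]
      simp
    · rw [sign_pos hpos, abs_of_pos hpos]
      simp

lemma hardyWeight_eq (B : Plane → ℝ) (σ : SignType) (ρ : ℝ) (x : Plane) :
    hardyWeight B σ ρ x = beta B σ ρ * radialWeight (flux B) ρ ‖x‖ := rfl

-- Both constants default to `0` when the range is unbounded, so `β ≠ 0` excludes the junk values.
lemma expRatio_bounds {B : Plane → ℝ} {σ : SignType} {ρ : ℝ} (hpos : ∀ x, 0 < expRatio B σ ρ x)
    (hβ : beta B σ ρ ≠ 0) : 0 < lowerConst B σ ρ ∧ 0 < upperConst B σ ρ ∧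
      ∀ x, lowerConst B σ ρ ≤ expRatio B σ ρ x ∧ expRatio B σ ρ x ≤ upperConst B σ ρ := by
  obtain ⟨hl, hu⟩ := div_ne_zero_iff.1 ((pow_ne_zero_iff two_ne_zero).1 hβ)
  have habove : BddAbove (range (expRatio B σ ρ)) := by
    by_contra h
    exact hu (Real.iSup_of_not_bddAbove h)
  have hbelow : BddBelow (range (expRatio B σ ρ)) := ⟨0, forall_mem_range.2 fun x => (hpos x).le⟩
  have hlpos : 0 < lowerConst B σ ρ := (Real.iInf_nonneg fun x => (hpos x).le).lt_of_ne' hl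
  have hbounds (x : Plane) : lowerConst B σ ρ ≤ expRatio B σ ρ x ∧
      expRatio B σ ρ x ≤ upperConst B σ ρ := ⟨ciInf_le hbelow x, le_ciSup habove x⟩
  exact ⟨hlpos, hlpos.trans_le ((hbounds 0).1.trans (hbounds 0).2), hbounds⟩

lemma half_eLpNorm_pauliOp_sq_le {s : ℤ} (hs : s = 1 ∨ s = -1) (A : Plane → Plane)
    (u : Plane → ℂ) (G : Fin 2 → Plane → ℂ) :
    (1 / 2 : ℝ≥0∞) * eLpNorm (pauliOp s A u G) 2 volume ^ 2 ≤ magneticEnergy A u G := by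
  have hhalf : (1 / 2 : ℝ≥0∞) = ENNReal.ofReal (1 / 2) := by
    rw [ENNReal.ofReal_div_of_pos two_pos]
    simp
  rw [eLpNorm_two_sq, hhalf, ← lintegral_const_mul' _ _ ENNReal.ofReal_ne_top, magneticEnergy]
  refine lintegral_mono fun x => ?_
  rw [← ofReal_norm_sq, ← ENNReal.ofReal_mul (by norm_num), Fin.sum_univ_two]
  refine ENNReal.ofReal_le_ofReal ?_
  set p := Complex.I * G 0 x + (A x 0 : ℂ) * u x
  set q := Complex.I * G 1 x + (A x 1 : ℂ) * u x
  have hpauli : pauliOp s A u G x = p + Complex.I * s * q := by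
    simp only [pauliOp, complexPotential, p, q]
    ring
  have hunit : ‖Complex.I * (s : ℂ)‖ = 1 := by rcases hs with rfl | rfl <;> simp
  have htri : ‖p + Complex.I * s * q‖ ≤ ‖p‖ + ‖q‖ := by
    refine (norm_add_le _ _).trans_eq ?_
    rw [norm_mul, hunit, one_mul]
  rw [hpauli]
  nlinarith [pow_le_pow_left₀ (norm_nonneg _) htri 2, sq_nonneg (‖p‖ - ‖q‖)]

lemma exists_expRatio_eq {B : Plane → ℝ} (hα : flux B ≠ 0) {ρ : ℝ} (hρ : 0 < ρ) :
    ∃ s : ℤ, (s = 1 ∨ s = -1) ∧ ∀ x, expRatio B (SignType.sign (flux B)) ρ x =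
      Real.exp (s * scalarPotential B x) / growth |flux B| ρ ‖x‖ := by
  simp only [expRatio, comparison_sign hα hρ]
  rcases lt_or_gt_of_ne hα with hneg | hpos
  · exact ⟨1, Or.inl rfl, fun x => by simp [sign_neg hneg]⟩
  · exact ⟨-1, Or.inr rfl, fun x => by simp [sign_pos hpos]⟩

theorem pauliHardyBound_of_le_exp {B : Plane → ℝ}
    (hB : Integrable fun x => Real.log (2 + ‖x‖) * B x) {A : Plane → Plane}
    (hA : IsVectorPotential A B) {α ρ : ℝ} (hα : α ≠ 0) (hρ : 0 < ρ) {s : ℤ} (hs : s = 1 ∨ s = -1)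
    {k K : ℝ} (hk : 0 < k) (hK : 0 < K)
    (hlow : ∀ x, k * growth |α| ρ ‖x‖ ≤ Real.exp (s * scalarPotential B x))
    (hupp : ∀ x, Real.exp (s * scalarPotential B x) ≤ K * growth |α| ρ ‖x‖)
    {u : Plane → ℂ} {G : Fin 2 → Plane → ℂ} (hu : IsH1WithGradient u G) :
    PauliHardyBound s A (fun x => ENNReal.ofReal ((k / K) ^ 2 * radialWeight α ρ ‖x‖)) u G :=
  pauliHardyBound_of_contDiff hA.memLpLoc
    (((continuous_radialWeight α hρ).comp continuous_norm).measurable.const_mul _).ennreal_ofReal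
    (fun _ hv hvs => lintegral_radialWeight_le_pauliOp_of_contDiff hB hA hα hρ hs hk hK hlow hupp
      hv hvs) hu

end MagneticHardy

end

theorem corollary2p9_general (B : MagneticHardy.Plane → ℝ)
    (hB : Integrable fun x : MagneticHardy.Plane => Real.log (2 + ‖x‖) * B x)
    (A : MagneticHardy.Plane → MagneticHardy.Plane) (hA : MagneticHardy.IsVectorPotential A B)
    (hα : MagneticHardy.flux B ≠ 0)
    (u : MagneticHardy.Plane → ℂ) (G : Fin 2 → MagneticHardy.Plane → ℂ)
    (hu : MagneticHardy.IsH1WithGradient u G) (ρ : ℝ) (hρ : 0 < ρ) :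
    (1 / 2 : ℝ≥0∞) * ∫⁻ x, ENNReal.ofReal
        (MagneticHardy.hardyWeight B (SignType.sign (MagneticHardy.flux B)) ρ x * ‖u x‖ ^ 2) ≤
      MagneticHardy.magneticEnergy A u G := by
  set σ := SignType.sign (MagneticHardy.flux B)
  by_cases hβ : MagneticHardy.beta B σ ρ = 0
  · simp [MagneticHardy.hardyWeight_eq, hβ]
  have hg (x : MagneticHardy.Plane) := MagneticHardy.growth_pos |MagneticHardy.flux B| ρ ‖x‖
  obtain ⟨s, hs, hratio⟩ := MagneticHardy.exists_expRatio_eq hα hρ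
  obtain ⟨hk, hK, hbounds⟩ := MagneticHardy.expRatio_bounds
    (fun x => hratio x ▸ div_pos (Real.exp_pos _) (hg x)) hβ
  have hbound := MagneticHardy.pauliHardyBound_of_le_exp hB hA hα hρ hs hk hK
    (fun x => (le_div_iff₀ (hg x)).1 (hratio x ▸ (hbounds x).1))
    (fun x => (div_le_iff₀ (hg x)).1 (hratio x ▸ (hbounds x).2)) hu
  refine le_trans (mul_le_mul_right ?_ _) (MagneticHardy.half_eLpNorm_pauliOp_sq_le hs A u G)
  refine le_trans (le_of_eq (lintegral_congr fun x => ?_)) hbound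
  rw [ENNReal.ofReal_mul' (sq_nonneg _), MagneticHardy.ofReal_norm_sq,
    MagneticHardy.hardyWeight_eq, MagneticHardy.beta]

theorem corollary2p9 (B : MagneticHardy.Plane → ℝ) (hB : MagneticHardy.IsAdmissibleField B)
    (A : MagneticHardy.Plane → MagneticHardy.Plane) (hA : MagneticHardy.IsVectorPotential A B)
    (hα : MagneticHardy.flux B ≠ 0)
    (u : MagneticHardy.Plane → ℂ) (G : Fin 2 → MagneticHardy.Plane → ℂ)
    (hu : MagneticHardy.IsH1WithGradient u G) (ρ : ℝ) (hρ : 0 < ρ) :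
    (1 / 2 : ℝ≥0∞) * ∫⁻ x, ENNReal.ofReal
        (MagneticHardy.hardyWeight B (SignType.sign (MagneticHardy.flux B)) ρ x * ‖u x‖ ^ 2) ≤
      MagneticHardy.magneticEnergy A u G :=
  corollary2p9_general B hB.integrable_log_mul A hA hα u G hu ρ hρ
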